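/- **Setting.** Let $Z=(X,Y)$ take values in $\mathcal X\times\mathcal Y$, with $\mathcal Y$ a nonempty standard Borel space; let $(\mathbf H,\|\cdot\|_{\mathbf H})$ be a real Banach space, $\Theta\subset\mathbb R^{d_\theta}$ compact with nonempty interior, $\mathcal A=\Theta\times\mathbf H$, and $\|\alpha\|_s=\|\theta\|+\|h\|_{\mathbf H}$ for $\alpha=(\theta,h)$. Let $\mathcal H_k$ be nondecreasing finite dimensional subspaces of $\mathbf H$ with dense union, $k(n)\to\infty$, $\mathcal A_{k(n)}=\Theta\times\mathcal H_{k(n)}$, and let $\Pi_n$ map into $\mathcal H_{k(n)}$; $\Pi_n\alpha=(\theta,\Pi_nh)$. Let $\rho(Z,\alpha)\in\mathbb R^{d_\rho}$ be a residual function, measurable in $Z$; $m_P(x,\alpha)=E_P[\rho(Z,\alpha)|X=x]$; $\Sigma(x)$ a measurable symmetric positive definite weight with eigenvalues bounded away from $0$ and $\infty$ uniformly in $x$; $Q_P(\alpha)=E_P[m_P(X,\alpha)'\Sigma(X)^{-1}m_P(X,\alpha)]$. The penalty $Pen:\mathbf H\to[0,\infty]$ has compact sublevel sets $\{Pen\le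 M\}$, $M<\infty$. Let $\lambda_n>0$, $\lambda_n\to0$, and let $\eta_n\ge0$, $\eta_n=o(n^{-1})$, be fixed tolerances. For weights $b=(b_i)$ let $\widehat m_n^{b}(\cdot,\alpha)$ be the fit of a given regression procedure applied to regressors $X_i$ and responses $b_i\rho(Z_i,\alpha)$, and $\widehat Q_n^{b}(\alpha)=n^{-1}\sum_{i\le n}\widehat m_n^b(X_i,\alpha)'\widehat\Sigma(X_i)^{-1}\widehat m_n^b(X_i,\alpha)$ with $\widehat\Sigma$ positive definite. Write $\widehat Q_n=\widehat Q_n^{1}$, $\widehat Q_n^B=\widehat Q_n^{\omega}$, where the bootstrap weights $\omega_{i,n}\ge0$ are independent of the data, square integrable, $E\omega_{i,n}=1$, $Var(\omega_{i,n})\to\sigma_\omega^2>0$ for each $i$. The data $Z_1,\dots,Z_n$ are i.i.d. from a law $P_0$ with parameter $\alpha_0\in\mathcal A$ (null model) or from laws $P_n$ with parameters $\boldsymbol\alpha_n$ (local alternatives); ``wpa1'', $o_P$, $O_P$ are under the indicated law. $P_{V|Z}$ is the conditional law given the data; $X_n=o_{P_{V|Z}}(1)$ wpa1($P_n$) means $P_n(P_{V|Z}(|X_n|>\epsilon)>\epsilon)\to0$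 for all $\epsilon>0$; $X_n=O_{P_{V|Z}}(1)$ wpa1($P_n$) means that for each $\epsilon>0$ there is $M$ with $P_n(P_{V|Z}(|X_n|>M)>\epsilon)\to0$. A point $a\in C$ is an *approximate minimizer* of $q+\lambda_nPen$ over $C$ if $q(a)+\lambda_nPen(a)\le q(\alpha)+\lambda_nPen(\alpha)+\eta_n$ for all $\alpha\in C$ (with $Pen(\alpha)=Pen(h)$). All conditions indexed by $n$ need hold only for large $n$. **Local structure (at $\alpha_0$, $P_0$).** Fix a large $M_0$; $\mathcal A_{k(n)}^{M_0}=\{\alpha\in\mathcal A_{k(n)}:Pen(h)\le M_0\}$. $\mathcal A_{os}\subset\{\alpha\in\mathcal A:\|\alpha-\alpha_0\|_s<M_0,Pen(h)\le M_0\}$ is convex and contains $\{\alpha\in\mathcal A:\|\alpha-\alpha_0\|_s<\epsilon,Pen(h)\le M_0\}$ for some $\epsilon>0$. A linear map $v\mapsto\frac{dm}{d\alpha}[v]$, measurable in $x$, is such that $\frac{dm(x)}{d\alpha}[\alpha-\alpha_0]$ is the one-sided derivative at $t=0$ of $t\mapsto m_{P_0}(x,(1-t)\alpha_0+t\alpha)$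 for a.e. $x$ and each $\alpha\in\mathcal A_{os}$, and is square integrable on $\mathbf V=span(\mathcal A_{os}-\alpha_0)$. Put $\langle v_1,v_2\rangle=E_{P_0}[\frac{dm(X)}{d\alpha}[v_1]'\Sigma(X)^{-1}\frac{dm(X)}{d\alpha}[v_2]]$, $\|v\|^2=\langle v,v\rangle$; $\|\alpha-\alpha_0\|\le C\|\alpha-\alpha_0\|_s$ on $\mathcal A_{os}$. Let $\mathcal A_{osn}=\mathcal A_{os}\cap\mathcal A_{k(n)}$ and $\tau_n(c)=\sup\{\|\alpha-c\|_s/\|\alpha-c\|:\alpha\in\mathcal A_{osn},\|\alpha-c\|\ne0\}$. Let $0<\delta_n\le\bar\delta_n$, $\bar\delta_n\to0$, and $\delta_{s,n}=\|h_0-\Pi_nh_0\|_{\mathbf H}+\tau_n(\Pi_n\alpha_0)\delta_n$, positive and $\to0$. Put $M_n=\min\{\log\log(n+1),\log(\delta_{s,n}^{-1}+1)\}$, $$\mathcal N_{os}=\{\alpha\in\mathcal A:\|\alpha-\alpha_0\|\le M_n\delta_n,\ \|\alpha-\alpha_0\|_s\le M_n\delta_{s,n},\ Pen(h)\le M_0\},$$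 $\mathcal N_{osn}=\mathcal N_{os}\cap\mathcal A_{k(n)}$, $\mathcal T_n=\{|t|\le4M_n^2\delta_n\}$. Either $\lambda_n\sup_{\alpha,\alpha'\in\mathcal A_{os}}|Pen(h)-Pen(h')|=o(n^{-1})$ or $\lambda_n=o(n^{-1})$. **Functional.** $\phi$ is continuous, with directional derivatives $\frac{d\phi}{d\alpha}[v]$ at $\alpha_0$ given by a $\|\cdot\|_s$-bounded linear functional, nonzero on $\mathbf V$; $\phi_0=\phi(\alpha_0)$. $\alpha_{0,n}$ minimizes $\|\alpha-\alpha_0\|$ over $\mathbb R^{d_\theta}\times\mathcal H_{k(n)}$; $\overline{\mathbf V}_{k(n)}=span(\mathcal A_{osn}-\alpha_{0,n})$ equals $\mathbb R^{d_\theta}\times\mathcal H_{k(n)}$, is contained in $\mathbf V$, becomes dense in it for $\|\cdot\|$, and $\|\cdot\|$ is a norm on it. $v_n^*\in\overline{\mathbf V}_{k(n)}$ satisfies $\frac{d\phi}{d\alpha}[v]=\langle v_n^*,v\rangle$ on $\overline{\mathbf V}_{k(n)}$; $\|v_n^*\|_{sd}^2=Var_{P_0}(\frac{dm(X)}{d\alpha}[v_n^*]'\Sigma(X)^{-1}\rho(Z,\alpha_0))$,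 $u_n^*=v_n^*/\|v_n^*\|_{sd}$. Assume $\|v_n^*\|=o(\sqrt n)$, $\sqrt n|\frac{d\phi}{d\alpha}[\alpha_{0,n}-\alpha_0]|=o(\|v_n^*\|)$, and $\sqrt n\sup_{\mathcal N_{osn}\times\mathcal T_n}|\phi(\alpha+tu_n^*)-\phi(\alpha_0)-\frac{d\phi}{d\alpha}[\alpha+tu_n^*-\alpha_0]|=o(\|v_n^*\|)$. Assume that for $(\alpha,t)\in\mathcal N_{osn}\times\mathcal T_n$ one has $\alpha+tu_n^*\in\mathcal A_{k(n)}$ and $\lambda_nPen(\alpha+tu_n^*)\le\lambda_nPen(\alpha)+o(n^{-1})$ uniformly. **Conditions $\mathcal C(\beta_n,P_n)$** (for true parameters $\beta_n=(\theta_n,h_n)\in\mathcal A$ and laws $P_n$, with constants not depending on $n$). On $\mathcal A$, $\rho(\cdot,\alpha)$ is integrable and $Q_{P_n}(\alpha)<\infty$; for $\alpha\in\mathcal A$, $E_{P_n}[\rho(Z,\alpha)|X]=0$ a.s. iff $\alpha=\beta_n$; for $\alpha\in\mathcal A$, $r>0$ there is $\epsilon>0$ such that for large $n$, $Q_{P_n}(\alpha')>Q_{P_0}(\alpha)-r$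 whenever $\alpha'\in\mathcal A$, $\|\alpha'-\alpha\|_s<\epsilon$; the eigenvalues of $Var_{P_n}(\rho(Z,\beta_n)|X)$ are bounded away from $0$ and $\infty$ a.s.; $\|\Pi_nh_n-h_n\|_{\mathbf H}\to0$; $\|h_n-\Pi_nh_n\|_{\mathbf H}+\tau_n(\Pi_n\beta_n)\delta_n=O(\delta_{s,n})$; $Q_{P_n}(\Pi_n\beta_n)+\eta_n=O(\lambda_n)$; $Pen(h_n)$, $Pen(\Pi_nh_n)$ are bounded; $(c_0Q_{P_n}(\Pi_n\beta_n)+2\eta_n)/\lambda_n+Pen(\Pi_nh_n)\le M_0$; wpa1 $\widehat Q_n(\Pi_n\beta_n)\le c_0Q_{P_n}(\Pi_n\beta_n)+\eta_n$; $\widehat Q_n\ge cQ_{P_n}-O_{P_n}(\bar\delta_n^2)$ uniformly on $\mathcal A_{k(n)}^{M_0}$ and $\widehat Q_n\ge c'Q_{P_n}-O_{P_n}(\delta_n^2)$ uniformly on $\mathcal A_{osn}$; $Q_{P_n}(\alpha)\asymp\|\alpha-\beta_n\|^2$ on $\mathcal A_{os}$; for every $e_n=o(n^{-1})$, $\max\{\delta_n^2,Q_{P_n}(\Pi_n\beta_n),\lambda_n,e_n\}=\delta_n^2$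 for large $n$; wpa1 $\widehat\alpha_n$ is an approximate minimizer of $\widehat Q_n+\lambda_nPen$ over $\mathcal A_{k(n)}$. **LQA$(\beta_n,P_n,B_n)$.** With $\mathbb Z_n^b(\beta)=n^{-1}\sum_ib_i\frac{dm(X_i)}{d\alpha}[u_n^*]'\Sigma(X_i)^{-1}\rho(Z_i,\beta)$ and $\mathbb Z_n=\mathbb Z_n^1$: $B_n>0$, $B_n=O_{P_n}(1)$, $\sqrt n\,\mathbb Z_n(\beta_n)\Rightarrow N(0,1)$, and for some positive $s_n=o(n^{-1})$, $$\sup_{\mathcal N_{osn}\times\mathcal T_n}\frac{\left|\tfrac12\{\widehat Q_n(\alpha+tu_n^*)-\widehat Q_n(\alpha)\}-t\{\mathbb Z_n(\beta_n)+\langle u_n^*,\alpha-\beta_n\rangle\}-\tfrac12B_nt^2\right|}{\max\{t^2,|t|n^{-1/2},s_n\}}=o_{P_n}(1).$$ **R$(P_n)$.** Wpa1, $\widehat\alpha_n^R$ is an approximate minimizer of $\widehat Q_n+\lambda_nPen$ over $\{\alpha\in\mathcal A_{k(n)}:\phi(\alpha)=\phi_0\}$, and $\widehat\alpha_n^R\in\mathcal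 N_{osn}$ wpa1. **Local alternatives.** $\boldsymbol\alpha_n=\alpha_0+d_n\Delta_n\in\mathcal N_{os}$, $d_n\ge0$, $\Delta_n\in\overline{\mathbf V}_{k(n)}$, $\frac{d\phi}{d\alpha}[\Delta_n]\to\kappa\ne0$, and for some $\vartheta<1$, $d_n\|\Delta_n\|\le\vartheta M_n\delta_n$ and $d_n\|\Delta_n\|_s\le\vartheta M_n\delta_{s,n}$. **Bootstrap conditions (under $P_n$).** $\widehat\alpha_n^B$ and $\widehat\alpha_n^{R,B}$ are, with conditional probability tending to one in $P_n$-probability, approximate minimizers of $\widehat Q_n^B+\lambda_nPen$ over $\mathcal A_{k(n)}$ and over $\{\alpha\in\mathcal A_{k(n)}:\phi(\alpha)=\phi(\widehat\alpha_n)\}$. With $\delta_n\le\delta_n^*\to0$ and $c_0^*>0$, and in the same sense: $\widehat Q_n^B(\widehat\alpha_n)\le c_0^*\widehat Q_n(\widehat\alpha_n)+\eta_n$; $\widehat Q_n^B\ge c^*\widehat Q_n-O_{P_{V|Z}}((\delta_n^*)^2)$ uniformly on $\mathcal A_{k(n)}^{M_0}$ and $\widehat Q_n^B\ge c^{**}\widehat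 Q_n-O_{P_{V|Z}}(\delta_n^2)$ uniformly on $\mathcal A_{osn}$; moreover, with $c_0$ the constant of $\mathcal C(\boldsymbol\alpha_n,P_n)$ and $\bar c=\max(1,c_0^*)$, $\{\bar c(c_0Q_{P_n}(\Pi_n\boldsymbol\alpha_n)+2\eta_n)+2\eta_n\}/\lambda_n+\bar c\,Pen(\Pi_n\boldsymbol\alpha_n)\le M_0$. LQA$^B$: the expansion in LQA$(\boldsymbol\alpha_n,P_n,\cdot)$ holds with $\widehat Q_n^B$, $\mathbb Z_n^\omega(\boldsymbol\alpha_n)$, some positive $B_n^\omega=O_{P_{V|Z}}(1)$ and error $o_{P_{V|Z}}(1)$ wpa1($P_n$), and the conditional law of $\sqrt n\,\mathbb Z_n^{\omega-1}(\boldsymbol\alpha_n)/\sigma_\omega$ converges to $N(0,1)$ in the bounded Lipschitz metric in $P_n$-probability. Define $\widehat{QLR}_n(\phi_0)=n\{\widehat Q_n(\widehat\alpha_n^R)-\widehat Q_n(\widehat\alpha_n)\}$ and $\widehat{QLR}{}_n^B(\widehat\phi_n)=n\{\widehat Q_n^B(\widehat\alpha_n^{R,B})-\widehat Q_n^B(\widehat\alpha_n^B)\}$,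 and let $\widehat c_n(a)$ be the $a$-quantile of the conditional law of $\widehat{QLR}{}_n^B(\widehat\phi_n)/\sigma_\omega^2$ given the data. **Theorem.** Assume all of the above at $\alpha_0$; for the null model, $\mathcal C(\alpha_0,P_0)$, LQA$(\alpha_0,P_0,B_{0,n})$ with $B_{0,n}-\|u_n^*\|^2=o_{P_0}(1)$, and R$(P_0)$; and along the local alternatives, $\mathcal C(\boldsymbol\alpha_n,P_n)$, LQA$(\boldsymbol\alpha_n,P_n,B_n)$, the bootstrap conditions, and $B_n^\omega-\|u_n^*\|^2=o_{P_{V|Z}}(1)$ wpa1($P_n$). Then: (1) wpa1($P_n$), $$\frac{\widehat{QLR}{}_n^B(\widehat\phi_n)}{\sigma_\omega^2}=\left(\frac{\sqrt n\,\mathbb Z_n^{\omega-1}(\boldsymbol\alpha_n)}{\sigma_\omega\|u_n^*\|}\right)^2+o_{P_{V|Z}}(1)=O_{P_{V|Z}}(1),$$ $$\sup_{t\in\mathbb R}\left|P_{V|Z}\left(\frac{\widehat{QLR}{}_n^B(\widehat\phi_n)}{\sigma_\omega^2}\le t\right)-P_0\left(\widehat{QLR}_n(\phi_0)\le t\right)\right|=o_{P_{V|Z}}(1).$$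 (2) If in addition $B_n-\|u_n^*\|^2=o_{P_n}(1)$ and R$(P_n)$ holds, then for every $\tau\in(0,1)$: if $d_n=n^{-1/2}\|v_n^*\|_{sd}$ (for large $n$), the limit of $P_n(\widehat{QLR}_n(\phi_0)\ge\widehat c_n(1-\tau))$ exists and lies strictly between $\tau$ and $1$; if $n^{1/2}\|v_n^*\|_{sd}^{-1}d_n\to\infty$, then $P_n(\widehat{QLR}_n(\phi_0)\ge\widehat c_n(1-\tau))\to1$. -/

import Mathlib

open MeasureTheory ProbabilityTheory Filter Topology
open scoped ENNReal Matrix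

noncomputable section

namespace PSMD

/-! Parameters, norms and samples -/

/-- The space `ℝ^dθ × H` of parameters `α = (θ, h)`. -/
abbrev Par (dθ : ℕ) (H : Type*) := EuclideanSpace ℝ (Fin dθ) × H

/-- Samples `Z₁, …, Z_n` of `Z = (X, Y)`. -/
abbrev Sample (n : ℕ) (𝒳 𝒴 : Type*) := Fin n → 𝒳 × 𝒴

/-- The strong norm `‖α‖_s = ‖θ‖ + ‖h‖_H`. -/
def normS {dθ : ℕ} {H : Type*} [NormedAddCommGroup H] (α : Par dθ H) : ℝ :=
  ‖α.1‖ + ‖α.2‖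

/-! Stochastic orders under an array of laws -/

section Orders

variable {𝒳 𝒴 Ω : Type*} [MeasurableSpace 𝒳] [MeasurableSpace 𝒴] [MeasurableSpace Ω]

/-- The law of an i.i.d. sample of size `n` from `P`. -/
def law (P : ProbabilityMeasure (𝒳 × 𝒴)) (n : ℕ) : Measure (Sample n 𝒳 𝒴) :=
  Measure.pi fun _ => (P : Measure (𝒳 × 𝒴))

/-- The events `ev n` hold with probability approaching one under `P n`. -/
def Wpa1 (P : ℕ → ProbabilityMeasure (𝒳 × 𝒴)) (ev : ∀ n, Sample n 𝒳 𝒴 → Prop) : Prop :=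
  Tendsto (fun n => law (P n) n {z | ¬ ev n z}) atTop (𝓝 0)

/-- `X n = o_{P n}(1)`. -/
def SmallP (P : ℕ → ProbabilityMeasure (𝒳 × 𝒴)) (X : ∀ n, Sample n 𝒳 𝒴 → ℝ) : Prop :=
  ∀ ε : ℝ, 0 < ε → Wpa1 P fun n z => |X n z| ≤ ε

/-- `X n = O_{P n}(1)`. -/
def BoundedP (P : ℕ → ProbabilityMeasure (𝒳 × 𝒴)) (X : ∀ n, Sample n 𝒳 𝒴 → ℝ) : Prop :=
  ∀ ε : ℝ, 0 < ε → ∃ M : ℝ, ∀ᶠ n in atTop,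
    law (P n) n {z | M < |X n z|} ≤ ENNReal.ofReal ε

/-- The events `ev n` have conditional probability, given the data, approaching one,
in `P n`-probability.  The weights live on `(Ω, PΩ)` and are independent of the data, so that
the conditional probability given `Z^n = z` is the `PΩ`-probability of the section at `z`. -/
def BootWpa1 (P : ℕ → ProbabilityMeasure (𝒳 × 𝒴)) (PΩ : ProbabilityMeasure Ω)
    (ev : ∀ n, Sample n 𝒳 𝒴 → Ω → Prop) : Prop :=
  ∀ ε : ℝ, 0 < ε →
    Wpa1 P fun n z => (PΩ : Measure Ω) {w | ¬ ev n z w} ≤ ENNReal.ofReal ε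

/-- `X n = o_{P_{V|Z}}(1)` wpa1 (`P n`): for each `ε > 0`,
`P n (P_{V|Z}(|X n| > ε) > ε) → 0`. -/
def BootSmall (P : ℕ → ProbabilityMeasure (𝒳 × 𝒴)) (PΩ : ProbabilityMeasure Ω)
    (X : ∀ n, Sample n 𝒳 𝒴 → Ω → ℝ) : Prop :=
  ∀ ε : ℝ, 0 < ε → Tendsto
    (fun n => law (P n) n {z | ENNReal.ofReal ε < (PΩ : Measure Ω) {w | ε < |X n z w|}})
    atTop (𝓝 0)

/-- `X n = O_{P_{V|Z}}(1)` wpa1 (`P n`): for each `ε > 0` there is `M` with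
`P n (P_{V|Z}(|X n| > M) > ε) → 0`. -/
def BootBounded (P : ℕ → ProbabilityMeasure (𝒳 × 𝒴)) (PΩ : ProbabilityMeasure Ω)
    (X : ∀ n, Sample n 𝒳 𝒴 → Ω → ℝ) : Prop :=
  ∀ ε : ℝ, 0 < ε → ∃ M : ℝ, 0 < M ∧ Tendsto
    (fun n => law (P n) n {z | ENNReal.ofReal ε < (PΩ : Measure Ω) {w | M < |X n z w|}})
    atTop (𝓝 0)

/-- Convergence in distribution to the standard normal law, through distribution functions. -/
def ToStdNormal (P : ℕ → ProbabilityMeasure (𝒳 × 𝒴)) (X : ∀ n, Sample n 𝒳 𝒴 → ℝ) : Prop :=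
  ∀ t : ℝ, Tendsto (fun n => (law (P n) n).real {z | X n z ≤ t}) atTop
    (𝓝 ((gaussianReal 0 1).real (Set.Iic t)))

/-- The conditional law of `X n` given the data converges to the standard normal law in the
bounded Lipschitz metric, in `P n`-probability. -/
def BootToStdNormal (P : ℕ → ProbabilityMeasure (𝒳 × 𝒴)) (PΩ : ProbabilityMeasure Ω)
    (X : ∀ n, Sample n 𝒳 𝒴 → Ω → ℝ) : Prop :=
  ∀ ε : ℝ, 0 < ε → Wpa1 P fun n z =>
    ∀ f : ℝ → ℝ, (∀ x, |f x| ≤ 1) → LipschitzWith 1 f →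
      |(∫ w, f (X n z w) ∂(PΩ : Measure Ω)) - ∫ x, f x ∂(gaussianReal 0 1)| ≤ ε

/-- `e n = o(n⁻¹)`. -/
def SmallInv (e : ℕ → ℝ) : Prop := Tendsto (fun n : ℕ => (n : ℝ) * e n) atTop (𝓝 0)

end Orders

/-! The model -/

/-- The raw objects of the model, without any of their properties. -/
structure Setting (dθ dρ : ℕ) (𝒳 𝒴 H : Type*) [MeasurableSpace 𝒳] [MeasurableSpace 𝒴]
    [NormedAddCommGroup H] [NormedSpace ℝ H] where
  /-- The residual function `ρ(Z, α)`. -/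
  rho : 𝒳 × 𝒴 → Par dθ H → Fin dρ → ℝ
  /-- The set `Θ` of finite dimensional parameters. -/
  Theta : Set (EuclideanSpace ℝ (Fin dθ))
  /-- The sieve spaces `H_k`. -/
  sieve : ℕ → Submodule ℝ H
  /-- The sieve index `k(n)`. -/
  k : ℕ → ℕ
  /-- The maps `Π_n` into the sieve spaces. -/
  proj : ℕ → H → H
  /-- The penalty. -/
  Pen : H → ℝ≥0∞
  /-- The penalty weights `λ_n`. -/
  lam : ℕ → ℝ
  /-- The tolerances `η_n = o(n⁻¹)` of the approximate minimizers. -/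
  eta : ℕ → ℝ
  /-- The weighting matrix `Σ(x)`. -/
  Sigma : 𝒳 → Matrix (Fin dρ) (Fin dρ) ℝ
  /-- Its estimator. -/
  SigmaHat : ∀ n, Sample n 𝒳 𝒴 → 𝒳 → Matrix (Fin dρ) (Fin dρ) ℝ
  /-- The nonparametric regression procedure: regressors and responses of the sample are sent
  to the fitted function. -/
  reg : ∀ n, (Fin n → 𝒳) → (Fin n → Fin dρ → ℝ) → 𝒳 → Fin dρ → ℝ
  /-- The functional of interest. -/
  phi : Par dθ H → ℝ
  /-- Its derivative at `α₀`. -/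
  dphi : Par dθ H →L[ℝ] ℝ
  /-- The null parameter `α₀`. -/
  alpha0 : Par dθ H
  /-- The law of `Z = (X, Y)` under the null parameter. -/
  P0 : ProbabilityMeasure (𝒳 × 𝒴)
  /-- The pathwise derivative `v ↦ dm(·, α₀)/dα [v]`. -/
  dm : Par dθ H →ₗ[ℝ] 𝒳 → Fin dρ → ℝ
  /-- The neighbourhood `A_os` of `α₀`. -/
  Aos : Set (Par dθ H)
  /-- The bound `M₀`. -/
  M0 : ℝ
  /-- The rate `δ_n`. -/
  delta : ℕ → ℝ
  /-- The rate of the sample criterion on the whole sieve space. -/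
  deltaBar : ℕ → ℝ
  /-- The strong rate `δ_{s,n}`. -/
  deltaS : ℕ → ℝ
  /-- The best sieve approximation `α_{0,n}` of `α₀`. -/
  alpha0n : ℕ → Par dθ H
  /-- The sieve Riesz representer `v_n^*`. -/
  vstar : ℕ → Par dθ H
  /-- The estimator. -/
  est : ∀ n, Sample n 𝒳 𝒴 → Par dθ H
  /-- The restricted estimator. -/
  estR : ∀ n, Sample n 𝒳 𝒴 → Par dθ H

/-- The raw objects of the bootstrap. -/
structure Bootstrap (dθ : ℕ) (𝒳 𝒴 H Ω : Type*) [MeasurableSpace Ω] where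
  /-- The law on the space of weights. -/
  PΩ : ProbabilityMeasure Ω
  /-- The weights `ω_{i,n}`; only the indices `i < n` are used. -/
  wt : ℕ → ℕ → Ω → ℝ
  /-- The limit standard deviation `σ_ω` of the weights. -/
  sigma : ℝ
  /-- The bootstrap estimator. -/
  estB : ∀ n, Sample n 𝒳 𝒴 → Ω → Par dθ H
  /-- The restricted bootstrap estimator. -/
  estRB : ∀ n, Sample n 𝒳 𝒴 → Ω → Par dθ H
  /-- The rate of the bootstrap criterion on the whole sieve space. -/
  deltaStar : ℕ → ℝ

/-- `a` minimizes `q(α) + lam * Pen(h)` over `C` up to `tol`. -/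
def ApproxMin {dθ : ℕ} {H : Type*} (q : Par dθ H → ℝ) (Pen : H → ℝ≥0∞) (lam tol : ℝ)
    (C : Set (Par dθ H)) (a : Par dθ H) : Prop :=
  a ∈ C ∧ ∀ α ∈ C, ENNReal.ofReal (q a) + ENNReal.ofReal lam * Pen a.2 ≤
    ENNReal.ofReal (q α) + ENNReal.ofReal lam * Pen α.2 + ENNReal.ofReal tol

section Model

variable {dθ dρ : ℕ} {𝒳 𝒴 H Ω : Type*} [MeasurableSpace 𝒳] [MeasurableSpace 𝒴]
  [StandardBorelSpace 𝒴] [Nonempty 𝒴] [NormedAddCommGroup H] [NormedSpace ℝ H]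
  [MeasurableSpace Ω]

namespace Setting

variable (S : Setting dθ dρ 𝒳 𝒴 H)

/-- The parameter space `A = Θ × H`. -/
def A : Set (Par dθ H) := {α | α.1 ∈ S.Theta}

/-- The sieve parameter space `A_{k(n)} = Θ × H_{k(n)}`. -/
def Ak (n : ℕ) : Set (Par dθ H) := {α | α.1 ∈ S.Theta ∧ α.2 ∈ S.sieve (S.k n)}

/-- The part of `A_{k(n)}` where the penalty is at most `M₀`. -/
def AkM (n : ℕ) : Set (Par dθ H) := {α | α ∈ S.Ak n ∧ S.Pen α.2 ≤ ENNReal.ofReal S.M0}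

/-- The conditional mean `m(x, α) = E_P[ρ(Z, α) | X = x]`. -/
def m (P : ProbabilityMeasure (𝒳 × 𝒴)) (x : 𝒳) (α : Par dθ H) : Fin dρ → ℝ :=
  ∫ y, S.rho (x, y) α ∂((P : Measure (𝒳 × 𝒴)).condKernel x)

/-- The population criterion `Q(α) = E_P[m(X, α)' Σ(X)⁻¹ m(X, α)]`. -/
def Q (P : ProbabilityMeasure (𝒳 × 𝒴)) (α : Par dθ H) : ℝ :=
  ∫ x, S.m P x α ⬝ᵥ ((S.Sigma x)⁻¹ *ᵥ S.m P x α) ∂((P : Measure (𝒳 × 𝒴)).fst)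

/-- The conditional variance `Σ₀(x) = Var_P(ρ(Z, α) | X = x)`. -/
def Sigma0 (P : ProbabilityMeasure (𝒳 × 𝒴)) (α : Par dθ H) (x : 𝒳) :
    Matrix (Fin dρ) (Fin dρ) ℝ :=
  Matrix.of fun i j => ∫ y, (S.rho (x, y) α i - S.m P x α i) * (S.rho (x, y) α j - S.m P x α j)
    ∂((P : Measure (𝒳 × 𝒴)).condKernel x)

/-- The inner product `⟨v₁, v₂⟩ = E[(dm[v₁])' Σ(X)⁻¹ dm[v₂]]`. -/
def ip (v₁ v₂ : Par dθ H) : ℝ :=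
  ∫ x, S.dm v₁ x ⬝ᵥ ((S.Sigma x)⁻¹ *ᵥ S.dm v₂ x) ∂((S.P0 : Measure (𝒳 × 𝒴)).fst)

/-- The weak pseudo-norm `‖v‖ = ⟨v, v⟩^{1/2}`. -/
def nrm (v : Par dθ H) : ℝ := √(S.ip v v)

/-- `A_osn = A_os ∩ A_{k(n)}`. -/
def Aosn (n : ℕ) : Set (Par dθ H) := S.Aos ∩ S.Ak n

/-- The linear span `V` of `A_os - α₀`. -/
def V : Submodule ℝ (Par dθ H) := Submodule.span ℝ ((fun α => α - S.alpha0) '' S.Aos)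

/-- The finite dimensional space `ℝ^dθ × H_{k(n)}`. -/
def Sn (n : ℕ) : Submodule ℝ (Par dθ H) := Submodule.prod ⊤ (S.sieve (S.k n))

/-- The linear span `V_{k(n)}` of `A_osn - α_{0,n}`. -/
def Vk (n : ℕ) : Submodule ℝ (Par dθ H) :=
  Submodule.span ℝ ((fun α => α - S.alpha0n n) '' S.Aosn n)

/-- `(dm(x, α₀)[v])' Σ(x)⁻¹ ρ(z, α)` at `z = (x, y)`. -/
def score (α v : Par dθ H) (z : 𝒳 × 𝒴) : ℝ :=
  S.dm v z.1 ⬝ᵥ ((S.Sigma z.1)⁻¹ *ᵥ S.rho z α)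

/-- The sieve standard deviation `‖v_n^*‖_sd`. -/
def sd (n : ℕ) : ℝ :=
  √(Var[S.score S.alpha0 (S.vstar n); (S.P0 : Measure (𝒳 × 𝒴))])

/-- The scaled sieve Riesz representer `u_n^* = v_n^* / ‖v_n^*‖_sd`. -/
def u (n : ℕ) : Par dθ H := (S.sd n)⁻¹ • S.vstar n

/-- `M_n = min {log log (n + 1), log (δ_{s,n}⁻¹ + 1)}`. -/
def Mn (n : ℕ) : ℝ :=
  min (Real.log (Real.log ((n : ℝ) + 1))) (Real.log ((S.deltaS n)⁻¹ + 1))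

/-- The effective parameter space `N_os`. -/
def Nos (n : ℕ) : Set (Par dθ H) :=
  {α | α ∈ S.A ∧ S.nrm (α - S.alpha0) ≤ S.Mn n * S.delta n ∧
    normS (α - S.alpha0) ≤ S.Mn n * S.deltaS n ∧ S.Pen α.2 ≤ ENNReal.ofReal S.M0}

/-- `N_osn = N_os ∩ A_{k(n)}`. -/
def Nosn (n : ℕ) : Set (Par dθ H) := S.Nos n ∩ S.Ak n

/-- `T_n = {t : |t| ≤ 4 M_n² δ_n}`. -/
def Tn (n : ℕ) : Set ℝ := {t | |t| ≤ 4 * S.Mn n ^ 2 * S.delta n}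

/-- `Π_n α = (θ, Π_n h)`. -/
def Pi (n : ℕ) (α : Par dθ H) : Par dθ H := (α.1, S.proj n α.2)

/-- The sieve measure of local ill-posedness around `c`. -/
def tau (n : ℕ) (c : Par dθ H) : ℝ≥0∞ :=
  ⨆ α ∈ S.Aosn n, ⨆ _ : S.nrm (α - c) ≠ 0,
    ENNReal.ofReal (normS (α - c) / S.nrm (α - c))

/-- The fitted conditional mean computed from the residuals `b_i ρ(Z_i, α)`. -/
def mhat (n : ℕ) (b : ℕ → ℝ) (z : Sample n 𝒳 𝒴) (x : 𝒳) (α : Par dθ H) : Fin dρ → ℝ :=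
  S.reg n (fun i => (z i).1) (fun i => b i • S.rho (z i) α) x

/-- The sample criterion with residual weights `b`:
`n⁻¹ ∑ m̂(X_i, α)' Σ̂(X_i)⁻¹ m̂(X_i, α)`. -/
def QHatW (n : ℕ) (b : ℕ → ℝ) (z : Sample n 𝒳 𝒴) (α : Par dθ H) : ℝ :=
  (n : ℝ)⁻¹ * ∑ i, S.mhat n b z (z i).1 α ⬝ᵥ
    ((S.SigmaHat n z (z i).1)⁻¹ *ᵥ S.mhat n b z (z i).1 α)

/-- The sample criterion `Q̂_n`. -/
def QHat (n : ℕ) (z : Sample n 𝒳 𝒴) (α : Par dθ H) : ℝ := S.QHatW n (fun _ => 1) z α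

/-- The weighted score average
`ℤ_n^b(β) = n⁻¹ ∑ b_i (dm(X_i, α₀)[u_n^*])' Σ(X_i)⁻¹ ρ(Z_i, β)`. -/
def ZnW (n : ℕ) (b : ℕ → ℝ) (β : Par dθ H) (z : Sample n 𝒳 𝒴) : ℝ :=
  (n : ℝ)⁻¹ * ∑ i : Fin n, b i * S.score β (S.u n) (z i)

/-- `ℤ_n(β)`. -/
def Zn (n : ℕ) (β : Par dθ H) (z : Sample n 𝒳 𝒴) : ℝ := S.ZnW n (fun _ => 1) β z

/-- The sieve quasi likelihood ratio statistic for the hypothesis `φ(α) = φ(α₀)`. -/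
def QLR (n : ℕ) (z : Sample n 𝒳 𝒴) : ℝ :=
  n * (S.QHat n z (S.estR n z) - S.QHat n z (S.est n z))

/-- `A_{k(n)}` restricted by `φ(α) = c`. -/
def AkR (n : ℕ) (c : ℝ) : Set (Par dθ H) := {α | α ∈ S.Ak n ∧ S.phi α = c}

end Setting

namespace Bootstrap

variable (S : Setting dθ dρ 𝒳 𝒴 H) (T : Bootstrap dθ 𝒳 𝒴 H Ω)

/-- The bootstrap criterion `Q̂_n^B`. -/
def QHatB (n : ℕ) (z : Sample n 𝒳 𝒴) (w : Ω) (α : Par dθ H) : ℝ :=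
  S.QHatW n (fun i => T.wt n i w) z α

/-- The bootstrap statistic `n (Q̂_n^B(α̂^{R,B}) - Q̂_n^B(α̂^B))`. -/
def QLRB (n : ℕ) (z : Sample n 𝒳 𝒴) (w : Ω) : ℝ :=
  n * (T.QHatB S n z w (T.estRB n z w) - T.QHatB S n z w (T.estB n z w))

/-- `ℤ_n^{ω-1}(β)`. -/
def ZnB (n : ℕ) (β : Par dθ H) (z : Sample n 𝒳 𝒴) (w : Ω) : ℝ :=
  S.ZnW n (fun i => T.wt n i w - 1) β z

/-- The conditional distribution function of `QLRB / σ_ω²` given the data. -/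
def cdfB (n : ℕ) (z : Sample n 𝒳 𝒴) (t : ℝ) : ℝ :=
  (T.PΩ : Measure Ω).real {w | T.QLRB S n z w / T.sigma ^ 2 ≤ t}

/-- The quantile `ĉ_n(a)` of that conditional distribution. -/
def quantB (n : ℕ) (a : ℝ) (z : Sample n 𝒳 𝒴) : ℝ := sInf {c | a ≤ T.cdfB S n z c}

end Bootstrap

/-! Conditions -/

namespace Setting

variable (S : Setting dθ dρ 𝒳 𝒴 H)

/-- Conditions on the parameter space, the sieves, the penalty, the weighting matrix, the rates
and the local structure of the null model. -/
structure Basic : Prop where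
  theta_compact : IsCompact S.Theta
  theta_interior : (interior S.Theta).Nonempty
  sieve_mono : Monotone S.sieve
  sieve_fin : ∀ j, FiniteDimensional ℝ (S.sieve j)
  sieve_dense : closure (⋃ j, (S.sieve j : Set H)) = Set.univ
  k_tendsto : Tendsto S.k atTop atTop
  rho_meas : ∀ α, Measurable fun z => S.rho z α
  dm_meas : ∀ v, Measurable (S.dm v)
  sigma_meas : ∀ i j, Measurable fun x => S.Sigma x i j
  sigma_pos : ∀ x, (S.Sigma x).PosDef
  sigma_bdd : ∃ c C : ℝ, 0 < c ∧ ∀ x ξ, c * (ξ ⬝ᵥ ξ) ≤ ξ ⬝ᵥ (S.Sigma x *ᵥ ξ) ∧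
    ξ ⬝ᵥ (S.Sigma x *ᵥ ξ) ≤ C * (ξ ⬝ᵥ ξ)
  sigmaHat_pos : ∀ n z x, (S.SigmaHat n z x).PosDef
  pen_compact : ∀ M : ℝ, IsCompact {h | S.Pen h ≤ ENNReal.ofReal M}
  lam_pos : ∀ n, 0 < S.lam n
  lam_zero : Tendsto S.lam atTop (𝓝 0)
  eta_nonneg : ∀ n, 0 ≤ S.eta n
  eta_small : SmallInv S.eta
  delta_pos : ∀ n, 0 < S.delta n
  delta_zero : Tendsto S.delta atTop (𝓝 0)
  delta_le : ∀ n, S.delta n ≤ S.deltaBar n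
  deltaBar_zero : Tendsto S.deltaBar atTop (𝓝 0)
  deltaS_pos : ∀ n, 0 < S.deltaS n
  deltaS_zero : Tendsto S.deltaS atTop (𝓝 0)
  deltaS_eq : ∀ᶠ n in atTop, ENNReal.ofReal (S.deltaS n) =
    ENNReal.ofReal ‖S.alpha0.2 - S.proj n S.alpha0.2‖ +
      S.tau n (S.Pi n S.alpha0) * ENNReal.ofReal (S.delta n)
  alpha0_mem : S.alpha0 ∈ S.A
  aos_convex : Convex ℝ S.Aos
  aos_nhd : ∃ ε : ℝ, 0 < ε ∧ {α | α ∈ S.A ∧ normS (α - S.alpha0) < ε ∧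
    S.Pen α.2 ≤ ENNReal.ofReal S.M0} ⊆ S.Aos
  aos_sub : S.Aos ⊆ {α | α ∈ S.A ∧ normS (α - S.alpha0) < S.M0 ∧
    S.Pen α.2 ≤ ENNReal.ofReal S.M0}
  pathwise : ∀ α ∈ S.Aos, ∀ᵐ x ∂((S.P0 : Measure (𝒳 × 𝒴)).fst),
    HasDerivWithinAt (fun t : ℝ => S.m S.P0 x ((1 - t) • S.alpha0 + t • α))
      (S.dm (α - S.alpha0) x) (Set.Icc 0 1) 0
  dm_memLp : ∀ v ∈ S.V, MemLp (S.dm v) 2 ((S.P0 : Measure (𝒳 × 𝒴)).fst)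
  nrm_le : ∃ C : ℝ, ∀ α ∈ S.Aos, S.nrm (α - S.alpha0) ≤ C * normS (α - S.alpha0)
  pen_small : SmallInv S.lam ∨ ∃ e : ℕ → ℝ, SmallInv e ∧ ∀ᶠ n in atTop,
    ∀ α ∈ S.Aos, ∀ α' ∈ S.Aos, S.lam n * |(S.Pen α.2).toReal - (S.Pen α'.2).toReal| ≤ e n

/-- The sieve Riesz representation. -/
structure Riesz : Prop where
  alpha0n_mem : ∀ n, S.alpha0n n ∈ S.Sn n
  alpha0n_min : ∀ᶠ n in atTop, ∀ α ∈ S.Sn n,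
    S.nrm (S.alpha0n n - S.alpha0) ≤ S.nrm (α - S.alpha0)
  vk_eq : ∀ᶠ n in atTop, S.Vk n = S.Sn n
  vk_le : ∀ᶠ n in atTop, S.Vk n ≤ S.V
  nrm_definite : ∀ᶠ n in atTop, ∀ v ∈ S.Vk n, S.nrm v = 0 → v = 0
  vk_dense : ∀ v ∈ S.V, ∀ ε : ℝ, 0 < ε → ∀ᶠ n in atTop, ∃ w ∈ S.Vk n, S.nrm (v - w) < ε
  vstar_mem : ∀ᶠ n in atTop, S.vstar n ∈ S.Vk n
  vstar_riesz : ∀ᶠ n in atTop, ∀ v ∈ S.Vk n, S.dphi v = S.ip (S.vstar n) v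

/-- Local behaviour of the functional `φ`. -/
structure PhiLocal : Prop where
  phi_cont : Continuous S.phi
  phi_deriv : ∀ v, HasDerivAt (fun t : ℝ => S.phi (S.alpha0 + t • v)) (S.dphi v) 0
  dphi_ne : ∃ v ∈ S.V, S.dphi v ≠ 0
  vstar_small : Tendsto (fun n : ℕ => S.nrm (S.vstar n) / √n) atTop (𝓝 0)
  nonlin : ∀ ε : ℝ, 0 < ε → ∀ᶠ n : ℕ in atTop, ∀ α ∈ S.Nosn n, ∀ t ∈ S.Tn n,
    √n * |S.phi (α + t • S.u n) - S.phi S.alpha0 - S.dphi (α + t • S.u n - S.alpha0)|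
      ≤ ε * S.nrm (S.vstar n)
  bias : Tendsto (fun n : ℕ => √n * |S.dphi (S.alpha0n n - S.alpha0)| / S.nrm (S.vstar n))
    atTop (𝓝 0)

/-- Moving along `u_n^*` stays in the sieve space, with negligible increase of the penalty. -/
structure LocalFeasible : Prop where
  mem : ∀ᶠ n in atTop, ∀ α ∈ S.Nosn n, ∀ t ∈ S.Tn n, α + t • S.u n ∈ S.Ak n
  pen : ∃ e : ℕ → ℝ, SmallInv e ∧ ∀ᶠ n in atTop, ∀ α ∈ S.Nosn n, ∀ t ∈ S.Tn n,
    ENNReal.ofReal (S.lam n) * S.Pen (α + t • S.u n).2 ≤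
      ENNReal.ofReal (S.lam n) * S.Pen α.2 + ENNReal.ofReal (e n)

/-- The conditions on the data generating process, on the sample criterion and on the estimator,
when the sample of size `n` is drawn from `P n` and the true parameter is `β n`.  For constant
sequences these are the usual conditions at a fixed law; along a sequence, all constants are
common to all `n`.  The number `c₀` is the constant of the upper bound of the sample
criterion. -/
structure Dgp (β : ℕ → Par dθ H) (P : ℕ → ProbabilityMeasure (𝒳 × 𝒴)) (c₀ : ℝ) : Prop where
  c₀_pos : 0 < c₀
  true_mem : ∀ n, β n ∈ S.A
  rho_int : ∀ n, ∀ α ∈ S.A, Integrable (fun z => S.rho z α) (P n : Measure (𝒳 × 𝒴))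
  q_int : ∀ n, ∀ α ∈ S.A, Integrable
    (fun x => S.m (P n) x α ⬝ᵥ ((S.Sigma x)⁻¹ *ᵥ S.m (P n) x α))
    ((P n : Measure (𝒳 × 𝒴)).fst)
  /-- Identification. -/
  ident : ∀ n, ∀ α ∈ S.A,
    (∀ᵐ x ∂((P n : Measure (𝒳 × 𝒴)).fst), S.m (P n) x α = 0) ↔ α = β n
  /-- Lower semicontinuity of the population criterion, along the sequence. -/
  lsc : ∀ α ∈ S.A, ∀ r : ℝ, 0 < r → ∃ ε : ℝ, 0 < ε ∧ ∀ᶠ n in atTop, ∀ α' ∈ S.A,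
    normS (α' - α) < ε → S.Q S.P0 α - r < S.Q (P n) α'
  /-- Uniform bounds on the eigenvalues of the conditional variance of the residual. -/
  sigma0_bdd : ∃ c C : ℝ, 0 < c ∧ ∀ n, ∀ᵐ x ∂((P n : Measure (𝒳 × 𝒴)).fst), ∀ ξ,
    c * (ξ ⬝ᵥ ξ) ≤ ξ ⬝ᵥ (S.Sigma0 (P n) (β n) x *ᵥ ξ) ∧
      ξ ⬝ᵥ (S.Sigma0 (P n) (β n) x *ᵥ ξ) ≤ C * (ξ ⬝ᵥ ξ)
  proj_mem : ∀ n, S.proj n (β n).2 ∈ S.sieve (S.k n)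
  proj_tendsto : Tendsto (fun n => ‖S.proj n (β n).2 - (β n).2‖) atTop (𝓝 0)
  /-- `δ_{s,n}` bounds the strong rate at the true parameter. -/
  strong_rate : ∃ C : ℝ, ∀ᶠ n in atTop, ENNReal.ofReal ‖(β n).2 - S.proj n (β n).2‖ +
    S.tau n (S.Pi n (β n)) * ENNReal.ofReal (S.delta n) ≤ ENNReal.ofReal (C * S.deltaS n)
  q_proj : ∃ C : ℝ, ∀ᶠ n in atTop, S.Q (P n) (S.Pi n (β n)) + S.eta n ≤ C * S.lam n
  pen_bdd : ∃ C : ℝ, ∀ᶠ n in atTop, S.Pen (β n).2 ≤ ENNReal.ofReal C ∧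
    S.Pen (S.proj n (β n).2) ≤ ENNReal.ofReal C
  /-- `M₀` is large. -/
  m0_large : ∀ᶠ n in atTop,
    ENNReal.ofReal ((c₀ * S.Q (P n) (S.Pi n (β n)) + 2 * S.eta n) / S.lam n) +
      S.Pen (S.proj n (β n).2) ≤ ENNReal.ofReal S.M0
  crit_upper : Wpa1 P fun n z =>
    S.QHat n z (S.Pi n (β n)) ≤ c₀ * S.Q (P n) (S.Pi n (β n)) + S.eta n
  crit_lower : ∃ c : ℝ, 0 < c ∧ ∀ ε : ℝ, 0 < ε → ∃ M : ℝ, ∀ᶠ n in atTop,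
    law (P n) n {z | ∃ α ∈ S.AkM n, S.QHat n z α < c * S.Q (P n) α - M * S.deltaBar n ^ 2}
      ≤ ENNReal.ofReal ε
  /-- Local curvature: `Q(α) ≍ ‖α - β‖²`. -/
  curvature : ∃ c C : ℝ, 0 < c ∧ ∀ᶠ n in atTop, ∀ α ∈ S.Aos,
    c * S.nrm (α - β n) ^ 2 ≤ S.Q (P n) α ∧ S.Q (P n) α ≤ C * S.nrm (α - β n) ^ 2
  crit_local : ∃ c : ℝ, 0 < c ∧ ∀ ε : ℝ, 0 < ε → ∃ M : ℝ, ∀ᶠ n in atTop,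
    law (P n) n {z | ∃ α ∈ S.Aosn n, S.QHat n z α < c * S.Q (P n) α - M * S.delta n ^ 2}
      ≤ ENNReal.ofReal ε
  delta_dom : ∀ e : ℕ → ℝ, SmallInv e → ∀ᶠ n in atTop,
    max (max (S.delta n ^ 2) (S.Q (P n) (S.Pi n (β n)))) (max (S.lam n) (e n)) = S.delta n ^ 2
  est_min : Wpa1 P fun n z =>
    ApproxMin (S.QHat n z) S.Pen (S.lam n) (S.eta n) (S.Ak n) (S.est n z)

/-- The local quadratic approximation of the sample criterion. -/
structure LQA (β : ℕ → Par dθ H) (P : ℕ → ProbabilityMeasure (𝒳 × 𝒴))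
    (B : ∀ n, Sample n 𝒳 𝒴 → ℝ) : Prop where
  B_pos : ∀ n z, 0 < B n z
  B_bdd : BoundedP P B
  expansion : ∃ s : ℕ → ℝ, (∀ n, 0 < s n) ∧ SmallInv s ∧ ∀ ε : ℝ, 0 < ε →
    Wpa1 P fun n z => ∀ α ∈ S.Nosn n, ∀ t ∈ S.Tn n,
      |(S.QHat n z (α + t • S.u n) - S.QHat n z α) / 2 -
          t * (S.Zn n (β n) z + S.ip (S.u n) (α - β n)) - B n z / 2 * t ^ 2| ≤
        ε * max (max (t ^ 2) (|t| / √n)) (s n)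
  clt : ToStdNormal P fun n z => √n * S.Zn n (β n) z

/-- The restricted estimator is an approximate minimizer under `φ(α) = φ(α₀)`, and lies in
`N_osn` with probability approaching one. -/
structure RestrictedEst (P : ℕ → ProbabilityMeasure (𝒳 × 𝒴)) : Prop where
  estR_min : Wpa1 P fun n z =>
    ApproxMin (S.QHat n z) S.Pen (S.lam n) (S.eta n) (S.AkR n (S.phi S.alpha0)) (S.estR n z)
  estR_mem : Wpa1 P fun n z => S.estR n z ∈ S.Nosn n

/-- The local alternatives `α_n = α₀ + d_n Δ_n`. -/
structure LocalAlt (d : ℕ → ℝ) (Δ : ℕ → Par dθ H) (κ : ℝ) : Prop where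
  d_nonneg : ∀ n, 0 ≤ d n
  dir_mem : ∀ᶠ n in atTop, Δ n ∈ S.Vk n
  dir_phi : Tendsto (fun n => S.dphi (Δ n)) atTop (𝓝 κ)
  kappa_ne : κ ≠ 0
  mem : ∀ᶠ n in atTop, S.alpha0 + d n • Δ n ∈ S.Nos n
  rate : ∃ ϑ : ℝ, ϑ < 1 ∧ ∀ᶠ n in atTop,
    d n * S.nrm (Δ n) ≤ ϑ * (S.Mn n * S.delta n) ∧
      d n * normS (Δ n) ≤ ϑ * (S.Mn n * S.deltaS n)

end Setting

namespace Bootstrap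

variable (S : Setting dθ dρ 𝒳 𝒴 H) (T : Bootstrap dθ 𝒳 𝒴 H Ω)

/-- The bootstrap weights. -/
structure Weights : Prop where
  meas : ∀ n i, Measurable (T.wt n i)
  nonneg : ∀ n i, i < n → ∀ᵐ w ∂(T.PΩ : Measure Ω), 0 ≤ T.wt n i w
  memLp : ∀ n i, i < n → MemLp (T.wt n i) 2 (T.PΩ : Measure Ω)
  mean : ∀ n i, i < n → ∫ w, T.wt n i w ∂(T.PΩ : Measure Ω) = 1
  var : ∀ i, Tendsto (fun n => Var[T.wt n i; (T.PΩ : Measure Ω)]) atTop (𝓝 (T.sigma ^ 2))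
  sigma_pos : 0 < T.sigma

/-- The conditions on the bootstrap criterion and the bootstrap estimators, when the sample of
size `n` is drawn from `P n` and the true parameter is `β n`. -/
structure Crit (β : ℕ → Par dθ H) (P : ℕ → ProbabilityMeasure (𝒳 × 𝒴)) (c₀ cs : ℝ) :
    Prop where
  cs_pos : 0 < cs
  deltaStar_ge : ∀ n, S.delta n ≤ T.deltaStar n
  deltaStar_zero : Tendsto T.deltaStar atTop (𝓝 0)
  /-- `M₀` is large. -/
  m0_large : ∀ᶠ n in atTop,
    ENNReal.ofReal ((max 1 cs * (c₀ * S.Q (P n) (S.Pi n (β n)) + 2 * S.eta n) +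
        2 * S.eta n) / S.lam n) +
      ENNReal.ofReal (max 1 cs) * S.Pen (S.proj n (β n).2) ≤ ENNReal.ofReal S.M0
  crit_upper : BootWpa1 P T.PΩ fun n z w =>
    T.QHatB S n z w (S.est n z) ≤ cs * S.QHat n z (S.est n z) + S.eta n
  crit_lower : ∃ c : ℝ, 0 < c ∧ ∀ ε : ℝ, 0 < ε → ∃ M : ℝ, Wpa1 P fun n z =>
    (T.PΩ : Measure Ω) {w | ∃ α ∈ S.AkM n,
      T.QHatB S n z w α < c * S.QHat n z α - M * T.deltaStar n ^ 2} ≤ ENNReal.ofReal ε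
  crit_local : ∃ c : ℝ, 0 < c ∧ ∀ ε : ℝ, 0 < ε → ∃ M : ℝ, Wpa1 P fun n z =>
    (T.PΩ : Measure Ω) {w | ∃ α ∈ S.Aosn n,
      T.QHatB S n z w α < c * S.QHat n z α - M * S.delta n ^ 2} ≤ ENNReal.ofReal ε
  estB_min : BootWpa1 P T.PΩ fun n z w =>
    ApproxMin (T.QHatB S n z w) S.Pen (S.lam n) (S.eta n) (S.Ak n) (T.estB n z w)
  estRB_min : BootWpa1 P T.PΩ fun n z w =>
    ApproxMin (T.QHatB S n z w) S.Pen (S.lam n) (S.eta n) (S.AkR n (S.phi (S.est n z)))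
      (T.estRB n z w)

/-- The local quadratic approximation of the bootstrap criterion. -/
structure LQAB (β : ℕ → Par dθ H) (P : ℕ → ProbabilityMeasure (𝒳 × 𝒴))
    (Bω : ∀ n, Sample n 𝒳 𝒴 → Ω → ℝ) : Prop where
  B_pos : ∀ n z w, 0 < Bω n z w
  B_bdd : BootBounded P T.PΩ Bω
  expansion : ∃ s : ℕ → ℝ, (∀ n, 0 < s n) ∧ SmallInv s ∧ ∀ ε : ℝ, 0 < ε →
    Wpa1 P fun n z => (T.PΩ : Measure Ω) {w | ¬ ∀ α ∈ S.Nosn n, ∀ t ∈ S.Tn n,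
      |(T.QHatB S n z w (α + t • S.u n) - T.QHatB S n z w α) / 2 -
          t * (S.ZnW n (fun i => T.wt n i w) (β n) z + S.ip (S.u n) (α - β n)) -
          Bω n z w / 2 * t ^ 2| ≤
        ε * max (max (t ^ 2) (|t| / √n)) (s n)} ≤ ENNReal.ofReal ε
  clt : BootToStdNormal P T.PΩ fun n z w => √n * T.ZnB S n (β n) z w / T.sigma

end Bootstrap

end Model

end PSMD

end

namespace PSMD

/-! Stochastic orders as filters -/

section OrderFilters

variable {𝒳 𝒴 Ω : Type*} [MeasurableSpace 𝒳] [MeasurableSpace 𝒴] [MeasurableSpace Ω]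

/-! The heart is a two-sided comparison of minimizers. On the scale n^{-1/2} along u = u_n the
criterion satisfies n(q(α + τu/√n) - q(α)) ≈ 2τℓ(α) + bτ² with b = ‖u‖², and the functional
satisfies √n(φ(α + τu/√n) - φ₀)/sd ≈ √n⟨u, α - α₀⟩ + τb. An unrestricted approximate minimizer a has
ℓ(a) ≈ 0, while the constraint pins ℓ(aR) ≈ W at a restricted one. Moving aR by τ = -W/b and
comparing with a gives n(q(aR) - q(a)) ≥ W²/b - o(1). Moving a by some τ ≈ W/b at which the
constraint holds exactly (intermediate value theorem) and comparing with aR gives the reverse bound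
(`QLRSetup.tendsto_qlr`).

For the sample criterion W is √n ℤ_n(β) minus the drift √n⟨u, β - α₀⟩. For the bootstrap W =
√n(ℤ_n^ω(β) + ⟨u, α̂ - β⟩), and the first order condition of the estimator (`LQA.tendsto_foc`) turns
√n⟨u, α̂ - β⟩ into -√n ℤ_n(β). The drift cancels and √n ℤ_n^{ω-1}(β) is left, so the bootstrap
reproduces the null law even along the alternatives.

The null and bootstrap statistics are thus close to N²/b for the same deterministic b, which is
bounded away from 0 and ∞ but need not converge. Both distribution functions are therefore compared
with t ↦ P(|N| ≤ √(tb)), and b times the critical value tends to r² with P(|N| ≤ r) = 1 - τ. With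
drift tending to κ ≠ 0 the rejection probability tends to P(|N - κ| > r), which exceeds τ by
unimodality (`normalBall_lt_center`). With diverging drift a lower bound linear in |W| suffices
(`QLRSetup.eventually_le_qlr`).

The expansions hold only on N_osn, so all minimizers must be located there. The penalty confines
them to a compact set, identification and lower semicontinuity place them in A_os, curvature gives
the weak rate and the ill-posedness measure the strong one; the factor M_n → ∞ absorbs all constants
(`Dgp.eventually_mem_Nosn`). Stochastic orders are encoded as limits along the filters `wpF` and
`bwF`, so that one deterministic argument serves the sample and the bootstrap. -/

instance (P : ProbabilityMeasure (𝒳 × 𝒴)) (n : ℕ) : IsProbabilityMeasure (law P n) := by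
  unfold law; infer_instance

lemma Wpa1.mono {P : ℕ → ProbabilityMeasure (𝒳 × 𝒴)} {ev ev' : ∀ n, Sample n 𝒳 𝒴 → Prop}
    (h : Wpa1 P ev) (hi : ∀ᶠ n in atTop, ∀ z, ev n z → ev' n z) : Wpa1 P ev' := by
  refine tendsto_of_tendsto_of_tendsto_of_le_of_le' tendsto_const_nhds h
    (Eventually.of_forall fun _ => zero_le) ?_
  filter_upwards [hi] with n hn
  exact measure_mono fun z hz hz' => hz (hn z hz')

lemma Wpa1.and {P : ℕ → ProbabilityMeasure (𝒳 × 𝒴)} {ev ev' : ∀ n, Sample n 𝒳 𝒴 → Prop}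
    (h : Wpa1 P ev) (h' : Wpa1 P ev') : Wpa1 P fun n z => ev n z ∧ ev' n z := by
  have := Tendsto.add h h'
  rw [add_zero] at this
  refine tendsto_of_tendsto_of_tendsto_of_le_of_le tendsto_const_nhds this
    (fun _ => zero_le) fun n => ?_
  refine (measure_mono ?_).trans (measure_union_le _ _)
  intro z hz
  by_cases h1 : ev n z
  · exact Or.inr fun h2 => hz ⟨h1, h2⟩
  · exact Or.inl h1

lemma Wpa1.of_eventually {P : ℕ → ProbabilityMeasure (𝒳 × 𝒴)}
    {ev : ∀ n, Sample n 𝒳 𝒴 → Prop} (h : ∀ᶠ n in atTop, ∀ z, ev n z) : Wpa1 P ev := by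
  refine tendsto_const_nhds.congr' ?_
  filter_upwards [h] with n hn
  simp [hn]

lemma wpa1_iff_real {P : ℕ → ProbabilityMeasure (𝒳 × 𝒴)} {ev : ∀ n, Sample n 𝒳 𝒴 → Prop} :
    Wpa1 P ev ↔ ∀ ε : ℝ, 0 < ε → ∀ᶠ n in atTop,
      law (P n) n {z | ¬ ev n z} ≤ ENNReal.ofReal ε := by
  unfold Wpa1
  rw [ENNReal.tendsto_nhds_zero]
  refine ⟨fun h ε hε => h _ (ENNReal.ofReal_pos.2 hε), fun h ε hε => ?_⟩
  obtain ⟨r, hr, hr'⟩ := ENNReal.lt_iff_exists_nnreal_btwn.1 hε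
  filter_upwards [h r (by exact_mod_cast hr)] with n hn
  exact hn.trans ((ENNReal.ofReal_coe_nnreal).trans_le hr'.le)

/-- The filter of the sets of samples of arbitrary size whose probability approaches one. -/
def wpF (P : ℕ → ProbabilityMeasure (𝒳 × 𝒴)) : Filter (Σ n, Sample n 𝒳 𝒴) where
  sets := {s | Wpa1 P fun n z => (⟨n, z⟩ : Σ n, Sample n 𝒳 𝒴) ∈ s}
  univ_sets := Wpa1.of_eventually (by simp)
  sets_of_superset h hst := Wpa1.mono h (Eventually.of_forall fun _ _ hz => hst hz)
  inter_sets h h' := Wpa1.and h h'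

lemma eventually_wpF {P : ℕ → ProbabilityMeasure (𝒳 × 𝒴)} {ev : (Σ n, Sample n 𝒳 𝒴) → Prop} :
    (∀ᶠ i in wpF P, ev i) ↔ Wpa1 P fun n z => ev ⟨n, z⟩ := Iff.rfl

lemma Wpa1.eventually {P : ℕ → ProbabilityMeasure (𝒳 × 𝒴)} {ev : ∀ n, Sample n 𝒳 𝒴 → Prop}
    (h : Wpa1 P ev) : ∀ᶠ i in wpF P, ev i.1 i.2 := h

lemma tendsto_fst_wpF (P : ℕ → ProbabilityMeasure (𝒳 × 𝒴)) :
    Tendsto (fun i : Σ n, Sample n 𝒳 𝒴 => i.1) (wpF P) atTop := by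
  intro s hs
  exact Wpa1.of_eventually (by filter_upwards [hs] with n hn z using hn)

lemma smallP_iff_tendsto {P : ℕ → ProbabilityMeasure (𝒳 × 𝒴)}
    {X : ∀ n, Sample n 𝒳 𝒴 → ℝ} :
    SmallP P X ↔ Tendsto (fun i : Σ n, Sample n 𝒳 𝒴 => X i.1 i.2) (wpF P) (𝓝 0) := by
  rw [Metric.nhds_basis_closedBall.tendsto_right_iff]
  simp only [Metric.mem_closedBall, dist_zero_right, Real.norm_eq_abs]
  rfl

/-- This is the device that turns O_P(1) terms into constants: up to probability ε the event `E M`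
may be assumed with M fixed, at the price of adding it to the filter. -/
lemma eventually_wpF_of_tight {P : ℕ → ProbabilityMeasure (𝒳 × 𝒴)}
    {E : ℝ → ∀ n, Sample n 𝒳 𝒴 → Prop}
    (hE : ∀ ε : ℝ, 0 < ε → ∃ M : ℝ, ∀ᶠ n in atTop,
      law (P n) n {z | ¬ E M n z} ≤ ENNReal.ofReal ε)
    {ev : (Σ n, Sample n 𝒳 𝒴) → Prop}
    (h : ∀ M, ∀ᶠ i in wpF P ⊓ 𝓟 {i | E M i.1 i.2}, ev i) : ∀ᶠ i in wpF P, ev i := by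
  rw [eventually_wpF, wpa1_iff_real]
  intro ε hε
  obtain ⟨M, hM⟩ := hE (ε / 2) (by positivity)
  have h' := h M
  rw [eventually_inf_principal, eventually_wpF, wpa1_iff_real] at h'
  filter_upwards [hM, h' (ε / 2) (by positivity)] with n h1 h2
  rw [← add_halves ε, ENNReal.ofReal_add (by positivity) (by positivity)]
  refine (measure_mono ?_).trans ((measure_union_le _ _).trans (add_le_add h1 h2))
  intro z hz
  by_cases hEz : E M n z
  · exact Or.inr fun hi => hz (hi hEz)
  · exact Or.inl hEz

lemma tendsto_wpF_of_boundedP {P : ℕ → ProbabilityMeasure (𝒳 × 𝒴)}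
    {W : ∀ n, Sample n 𝒳 𝒴 → ℝ} (hW : BoundedP P W) {X : (Σ n, Sample n 𝒳 𝒴) → ℝ}
    {l : Filter ℝ}
    (h : ∀ K, Tendsto X (wpF P ⊓ 𝓟 {i | |W i.1 i.2| ≤ K}) l) : Tendsto X (wpF P) l := by
  intro s hs
  refine eventually_wpF_of_tight (E := fun K n z => |W n z| ≤ K) ?_ fun K => h K hs
  intro ε hε
  obtain ⟨M, hM⟩ := hW ε hε
  refine ⟨M, ?_⟩
  filter_upwards [hM] with n hn
  simpa only [not_le] using hn

/-- The filter of the sets of samples and weights whose conditional probability given the data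
approaches one, in probability. -/
def bwF (P : ℕ → ProbabilityMeasure (𝒳 × 𝒴)) (PΩ : ProbabilityMeasure Ω) :
    Filter (Σ n, Sample n 𝒳 𝒴 × Ω) where
  sets := {s | BootWpa1 P PΩ fun n z w => (⟨n, (z, w)⟩ : Σ n, Sample n 𝒳 𝒴 × Ω) ∈ s}
  univ_sets := fun ε _ => Wpa1.of_eventually (by simp)
  sets_of_superset h hst := fun ε hε => (h ε hε).mono (Eventually.of_forall fun _ _ hz =>
    (measure_mono (Set.ofPred_subset_ofPred.2 fun _ hw hw' => hw (hst hw'))).trans hz)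
  inter_sets {s t} h h' := fun ε hε =>
    ((h (ε / 2) (by positivity)).and (h' (ε / 2) (by positivity))).mono
      (Eventually.of_forall fun n z hz => by
        rw [← add_halves ε, ENNReal.ofReal_add (by positivity) (by positivity)]
        refine (measure_mono ?_).trans ((measure_union_le _ _).trans (add_le_add hz.1 hz.2))
        intro w hw
        by_cases h1 : (⟨n, (z, w)⟩ : Σ n, Sample n 𝒳 𝒴 × Ω) ∈ s
        · exact Or.inr fun h2 => hw ⟨h1, h2⟩
        · exact Or.inl h1)

lemma eventually_bwF {P : ℕ → ProbabilityMeasure (𝒳 × 𝒴)} {PΩ : ProbabilityMeasure Ω}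
    {ev : (Σ n, Sample n 𝒳 𝒴 × Ω) → Prop} :
    (∀ᶠ i in bwF P PΩ, ev i) ↔ BootWpa1 P PΩ fun n z w => ev ⟨n, (z, w)⟩ := Iff.rfl

lemma BootWpa1.eventually {P : ℕ → ProbabilityMeasure (𝒳 × 𝒴)} {PΩ : ProbabilityMeasure Ω}
    {ev : ∀ n, Sample n 𝒳 𝒴 → Ω → Prop}
    (h : BootWpa1 P PΩ ev) : ∀ᶠ i in bwF P PΩ, ev i.1 i.2.1 i.2.2 := h

/-- Given the data, an event that depends on the data alone has conditional probability zero or one.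
Hence every statement with probability approaching one transfers to the bootstrap filter. -/
lemma tendsto_bwF_wpF (P : ℕ → ProbabilityMeasure (𝒳 × 𝒴)) (PΩ : ProbabilityMeasure Ω) :
    Tendsto (fun i : Σ n, Sample n 𝒳 𝒴 × Ω => (⟨i.1, i.2.1⟩ : Σ n, Sample n 𝒳 𝒴))
      (bwF P PΩ) (wpF P) := by
  intro s hs ε hε
  refine Wpa1.mono hs (Eventually.of_forall fun n z hz => ?_)
  have : {w : Ω | ¬ (⟨n, (z, w)⟩ : Σ n, Sample n 𝒳 𝒴 × Ω) ∈
      (fun i : Σ n, Sample n 𝒳 𝒴 × Ω => (⟨i.1, i.2.1⟩ : Σ n, Sample n 𝒳 𝒴)) ⁻¹' s} = ∅ := by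
    ext w; simpa using hz
  rw [this]; simp

lemma tendsto_fst_bwF (P : ℕ → ProbabilityMeasure (𝒳 × 𝒴)) (PΩ : ProbabilityMeasure Ω) :
    Tendsto (fun i : Σ n, Sample n 𝒳 𝒴 × Ω => i.1) (bwF P PΩ) atTop :=
  (tendsto_fst_wpF P).comp (tendsto_bwF_wpF P PΩ)

/-- The definition uses one ε both as threshold and as probability, the filter uses two; taking the
minimum of the two reconciles them. -/
lemma bootSmall_iff_tendsto {P : ℕ → ProbabilityMeasure (𝒳 × 𝒴)} {PΩ : ProbabilityMeasure Ω}
    {X : ∀ n, Sample n 𝒳 𝒴 → Ω → ℝ} :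
    BootSmall P PΩ X ↔
      Tendsto (fun i : Σ n, Sample n 𝒳 𝒴 × Ω => X i.1 i.2.1 i.2.2) (bwF P PΩ) (𝓝 0) := by
  rw [Metric.nhds_basis_closedBall.tendsto_right_iff]
  simp only [Metric.mem_closedBall, dist_zero_right, Real.norm_eq_abs]
  have key : BootSmall P PΩ X ↔ ∀ ε : ℝ, 0 < ε → Wpa1 P fun n z =>
      (PΩ : Measure Ω) {w | ε < |X n z w|} ≤ ENNReal.ofReal ε := by
    simp only [BootSmall, Wpa1, not_le]
  rw [key]
  constructor
  · intro h ε hε ε' hε'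
    refine (h (min ε ε') (lt_min hε hε')).mono (Eventually.of_forall fun n z hz => ?_)
    refine (measure_mono ?_).trans (hz.trans (ENNReal.ofReal_le_ofReal (min_le_right _ _)))
    intro w hw
    exact (min_le_left _ _).trans_lt (not_le.1 (show ¬ |X n z w| ≤ ε from hw))
  · intro h ε hε
    refine (h ε hε ε hε).mono (Eventually.of_forall fun n z hz => ?_)
    exact (measure_mono (Set.ofPred_subset_ofPred.2 fun w hw => not_le.2 hw)).trans hz

lemma eventually_bwF_of_tight {P : ℕ → ProbabilityMeasure (𝒳 × 𝒴)} {PΩ : ProbabilityMeasure Ω}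
    {E : ℝ → ∀ n, Sample n 𝒳 𝒴 → Ω → Prop}
    (hE : ∀ ε : ℝ, 0 < ε → ∃ M : ℝ, Wpa1 P fun n z =>
      (PΩ : Measure Ω) {w | ¬ E M n z w} ≤ ENNReal.ofReal ε)
    {ev : (Σ n, Sample n 𝒳 𝒴 × Ω) → Prop}
    (h : ∀ M, ∀ᶠ i in bwF P PΩ ⊓ 𝓟 {i | E M i.1 i.2.1 i.2.2}, ev i) :
    ∀ᶠ i in bwF P PΩ, ev i := by
  intro ε hε
  obtain ⟨M, hM⟩ := hE (ε / 2) (by positivity)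
  have h' := h M
  rw [eventually_inf_principal, eventually_bwF] at h'
  refine (hM.and (h' (ε / 2) (by positivity))).mono (Eventually.of_forall fun n z hz => ?_)
  rw [← add_halves ε, ENNReal.ofReal_add (by positivity) (by positivity)]
  refine (measure_mono ?_).trans ((measure_union_le _ _).trans (add_le_add hz.1 hz.2))
  intro w hw
  by_cases hEz : E M n z w
  · exact Or.inr fun hi => hw (hi hEz)
  · exact Or.inl hEz

/-- The conditioning event concerns the data only and is tight under the sampling law. It serves for
the sample criterion inside bootstrap arguments. -/
lemma eventually_bwF_of_tight_wpF {P : ℕ → ProbabilityMeasure (𝒳 × 𝒴)}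
    {PΩ : ProbabilityMeasure Ω} {E : ℝ → ∀ n, Sample n 𝒳 𝒴 → Prop}
    (hE : ∀ ε : ℝ, 0 < ε → ∃ M : ℝ, ∀ᶠ n in atTop,
      law (P n) n {z | ¬ E M n z} ≤ ENNReal.ofReal ε)
    {ev : (Σ n, Sample n 𝒳 𝒴 × Ω) → Prop}
    (h : ∀ M, ∀ᶠ i in bwF P PΩ ⊓ 𝓟 {i | E M i.1 i.2.1}, ev i) : ∀ᶠ i in bwF P PΩ, ev i := by
  intro ε hε
  refine eventually_wpF_of_tight
    (ev := fun i => (PΩ : Measure Ω) {w | ¬ ev ⟨i.1, (i.2, w)⟩} ≤ ENNReal.ofReal ε) hE fun M => ?_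
  have h' := h M
  rw [eventually_inf_principal, eventually_bwF] at h'
  rw [eventually_inf_principal]
  refine (h' ε hε).mono (Eventually.of_forall fun n z hz hEz => ?_)
  refine (measure_mono (Set.ofPred_subset_ofPred.2 fun w hw hi => hw (hi hEz))).trans hz

lemma bootBounded_iff {P : ℕ → ProbabilityMeasure (𝒳 × 𝒴)} {PΩ : ProbabilityMeasure Ω}
    {X : ∀ n, Sample n 𝒳 𝒴 → Ω → ℝ} :
    BootBounded P PΩ X ↔ ∀ ε : ℝ, 0 < ε → ∃ M : ℝ, 0 < M ∧ Wpa1 P fun n z =>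
      (PΩ : Measure Ω) {w | ¬ |X n z w| ≤ M} ≤ ENNReal.ofReal ε := by
  simp only [BootBounded, Wpa1, not_le]

lemma BootBounded.tight {P : ℕ → ProbabilityMeasure (𝒳 × 𝒴)} {PΩ : ProbabilityMeasure Ω}
    {X : ∀ n, Sample n 𝒳 𝒴 → Ω → ℝ} (h : BootBounded P PΩ X) :
    ∀ ε : ℝ, 0 < ε → ∃ M : ℝ, Wpa1 P fun n z =>
      (PΩ : Measure Ω) {w | ¬ |X n z w| ≤ M} ≤ ENNReal.ofReal ε := fun ε hε => by
  obtain ⟨M, -, hM⟩ := bootBounded_iff.1 h ε hε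
  exact ⟨M, hM⟩

lemma tendsto_bwF_of_bootBounded {P : ℕ → ProbabilityMeasure (𝒳 × 𝒴)}
    {PΩ : ProbabilityMeasure Ω} {W : ∀ n, Sample n 𝒳 𝒴 → Ω → ℝ} (hW : BootBounded P PΩ W)
    {X : (Σ n, Sample n 𝒳 𝒴 × Ω) → ℝ} {l : Filter ℝ}
    (h : ∀ K, Tendsto X (bwF P PΩ ⊓ 𝓟 {i | |W i.1 i.2.1 i.2.2| ≤ K}) l) :
    Tendsto X (bwF P PΩ) l := by
  intro s hs
  exact eventually_bwF_of_tight (E := fun K n z w => |W n z w| ≤ K) hW.tight fun K => h K hs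

/-- A stochastically bounded sequence stays so after a negligible change. -/
lemma BootBounded.of_sub {P : ℕ → ProbabilityMeasure (𝒳 × 𝒴)} {PΩ : ProbabilityMeasure Ω}
    {X Y : ∀ n, Sample n 𝒳 𝒴 → Ω → ℝ} (hY : BootBounded P PΩ Y)
    (h : BootSmall P PΩ fun n z w => X n z w - Y n z w) : BootBounded P PΩ X := by
  rw [bootBounded_iff] at hY ⊢
  intro ε hε
  obtain ⟨M, hM, hMY⟩ := hY (ε / 2) (by positivity)
  refine ⟨M + 1, by positivity, ?_⟩
  rw [bootSmall_iff_tendsto, Metric.nhds_basis_closedBall.tendsto_right_iff] at h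
  refine (hMY.and (h 1 one_pos (ε / 2) (by positivity))).mono
    (Eventually.of_forall fun n z hz => ?_)
  rw [← add_halves ε, ENNReal.ofReal_add (by positivity) (by positivity)]
  refine (measure_mono ?_).trans ((measure_union_le _ _).trans (add_le_add hz.1 hz.2))
  intro w hw
  by_contra hcon
  simp only [Set.mem_union, Set.mem_ofPred_eq, Metric.mem_closedBall, dist_zero_right,
    Real.norm_eq_abs, not_or, not_not] at hcon hw
  have := abs_sub_abs_le_abs_sub (X n z w) (Y n z w)
  exact hw (by linarith [hcon.1, hcon.2])

end OrderFilters

/-! The standard normal law on intervals -/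

/-- The probability that a standard normal variable is within `r` of `κ`. -/
noncomputable def normalBall (κ r : ℝ) : ℝ := (gaussianReal 0 1).real (Set.Icc (κ - r) (κ + r))

lemma continuous_stdNormalPDF : Continuous (gaussianPDFReal 0 1) := by
  rw [gaussianPDFReal_def]; fun_prop

lemma stdNormalPDF_le_one (x : ℝ) : gaussianPDFReal 0 1 x ≤ 1 := by
  rw [gaussianPDFReal]
  have h1 : (1 : ℝ) ≤ √(2 * Real.pi * ((1 : NNReal) : ℝ)) := by
    rw [Real.one_le_sqrt]; push_cast; linarith [Real.pi_gt_three]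
  have h2 : (√(2 * Real.pi * ((1 : NNReal) : ℝ)))⁻¹ ≤ 1 := inv_le_one_of_one_le₀ h1
  have h3 : Real.exp (-(x - 0) ^ 2 / (2 * ((1 : NNReal) : ℝ))) ≤ 1 := by
    rw [Real.exp_le_one_iff]; push_cast; nlinarith [sq_nonneg x]
  calc _ ≤ (1 : ℝ) * 1 := mul_le_mul h2 h3 (Real.exp_nonneg _) zero_le_one
    _ = 1 := one_mul 1

lemma stdNormalPDF_lt {x y : ℝ} (h : x ^ 2 < y ^ 2) :
    gaussianPDFReal 0 1 y < gaussianPDFReal 0 1 x := by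
  simp only [gaussianPDFReal]
  refine mul_lt_mul_of_pos_left (Real.exp_lt_exp.2 ?_) (by positivity)
  push_cast; nlinarith

lemma stdNormal_Icc {a b : ℝ} (hab : a ≤ b) :
    (gaussianReal 0 1).real (Set.Icc a b) = ∫ x in a..b, gaussianPDFReal 0 1 x := by
  rw [measureReal_def, gaussianReal_apply_eq_integral _ one_ne_zero, ENNReal.toReal_ofReal
    (integral_nonneg fun x => gaussianPDFReal_nonneg _ _ _), intervalIntegral.integral_of_le hab,
    integral_Icc_eq_integral_Ioc]

lemma stdNormal_Icc_le {a b : ℝ} (hab : a ≤ b) :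
    (gaussianReal 0 1).real (Set.Icc a b) ≤ b - a := by
  rw [stdNormal_Icc hab]
  calc _ ≤ ∫ _ in a..b, (1 : ℝ) := intervalIntegral.integral_mono_on hab
        (continuous_stdNormalPDF.intervalIntegrable _ _) (by simp)
        fun x _ => stdNormalPDF_le_one x
    _ = b - a := by simp

lemma stdNormal_Icc_pos {a b : ℝ} (hab : a < b) :
    0 < (gaussianReal 0 1).real (Set.Icc a b) := by
  rw [stdNormal_Icc hab.le]
  exact intervalIntegral.intervalIntegral_pos_of_pos
    (continuous_stdNormalPDF.intervalIntegrable _ _)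
    (fun x => gaussianPDFReal_pos _ _ _ one_ne_zero) hab

lemma normalBall_nonneg (κ r : ℝ) : 0 ≤ normalBall κ r := measureReal_nonneg

lemma normalBall_le_one (κ r : ℝ) : normalBall κ r ≤ 1 := measureReal_le_one

lemma normalBall_mono (κ : ℝ) : Monotone (normalBall κ) := fun _ _ h =>
  measureReal_mono (Set.Icc_subset_Icc (by linarith) (by linarith))

lemma normalBall_of_neg (κ : ℝ) {r : ℝ} (hr : r < 0) : normalBall κ r = 0 := by
  rw [normalBall, Set.Icc_eq_empty (by linarith)]; simp

/-- The two strips added to the interval have length s - r each, and the normal density is at most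
one. -/
lemma normalBall_le_add (κ : ℝ) {r s : ℝ} (h : r ≤ s) :
    normalBall κ s ≤ normalBall κ r + 2 * (s - r) := by
  have hsub : Set.Icc (κ - s) (κ + s) ⊆ Set.Icc (κ - r) (κ + r) ∪
      (Set.Icc (κ - s) (κ - r) ∪ Set.Icc (κ + r) (κ + s)) := by
    intro x hx
    by_cases h1 : x ≤ κ - r
    · exact Or.inr (Or.inl ⟨hx.1, h1⟩)
    by_cases h2 : κ + r ≤ x
    · exact Or.inr (Or.inr ⟨h2, hx.2⟩)
    · exact Or.inl ⟨by linarith, by linarith⟩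
  have h1 := stdNormal_Icc_le (a := κ - s) (b := κ - r) (by linarith)
  have h2 := stdNormal_Icc_le (a := κ + r) (b := κ + s) (by linarith)
  have h3 := (measureReal_mono hsub (μ := gaussianReal 0 1)).trans ((measureReal_union_le _ _).trans
    (add_le_add_right (measureReal_union_le _ _) _))
  unfold normalBall
  linarith

lemma normalBall_zero (κ : ℝ) : normalBall κ 0 = 0 := by
  refine le_antisymm ?_ (normalBall_nonneg _ _)
  refine (stdNormal_Icc_le (by linarith)).trans (by linarith)

lemma continuous_normalBall (κ : ℝ) : Continuous (normalBall κ) := by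
  have : LipschitzWith 2 (normalBall κ) := by
    refine LipschitzWith.of_le_add_mul 2 fun x y => ?_
    rcases le_total y x with h | h
    · rw [Real.dist_eq, abs_of_nonneg (by linarith)]
      exact normalBall_le_add κ h
    · have := normalBall_mono κ h
      have h2 : (0 : ℝ) ≤ ((2 : NNReal) : ℝ) * dist x y := by positivity
      linarith
  exact this.continuous

lemma normalBall_strictMono (κ : ℝ) {r s : ℝ} (hr : 0 ≤ r) (h : r < s) :
    normalBall κ r < normalBall κ s := by
  obtain ⟨c, hc1, hc2⟩ := exists_between h
  have hd : Disjoint (Set.Icc (κ - r) (κ + r)) (Set.Icc (κ + c) (κ + s)) := by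
    rw [Set.disjoint_left]; intro x hx hx'; linarith [hx.2, hx'.1]
  have hp := stdNormal_Icc_pos (a := κ + c) (b := κ + s) (by linarith)
  have := measureReal_union (μ := gaussianReal 0 1) hd measurableSet_Icc
  have h2 : (gaussianReal 0 1).real (Set.Icc (κ - r) (κ + r) ∪ Set.Icc (κ + c) (κ + s)) ≤
      normalBall κ s := by
    refine measureReal_mono ?_
    rintro x (hx | hx)
    · exact ⟨by linarith [hx.1], by linarith [hx.2]⟩
    · exact ⟨by linarith [hx.1], by linarith [hx.2]⟩
  unfold normalBall at *
  linarith

lemma tendsto_normalBall (κ : ℝ) : Tendsto (normalBall κ) atTop (𝓝 1) := by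
  have h1 : Tendsto (fun r : ℝ => gaussianReal 0 1 (Set.Icc (κ - r) (κ + r))) atTop
      (𝓝 (gaussianReal 0 1 (⋃ r : ℝ, Set.Icc (κ - r) (κ + r)))) :=
    tendsto_measure_iUnion_atTop fun _ _ h => Set.Icc_subset_Icc (by linarith) (by linarith)
  have h2 : (⋃ r : ℝ, Set.Icc (κ - r) (κ + r)) = Set.univ := by
    ext x
    simp only [Set.mem_iUnion, Set.mem_Icc, Set.mem_univ, iff_true]
    exact ⟨|x - κ|, by linarith [neg_abs_le (x - κ)], by linarith [le_abs_self (x - κ)]⟩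
  rw [h2, measure_univ] at h1
  exact (ENNReal.tendsto_toReal ENNReal.one_ne_top).comp h1

lemma normalBall_neg (κ r : ℝ) : normalBall (-κ) r = normalBall κ r := by
  rcases lt_or_ge r 0 with hr | hr
  · rw [normalBall_of_neg _ hr, normalBall_of_neg _ hr]
  · have hodd (x : ℝ) : gaussianPDFReal 0 1 (-x) = gaussianPDFReal 0 1 x := by
      simp [gaussianPDFReal]
    rw [normalBall, normalBall, stdNormal_Icc (by linarith), stdNormal_Icc (by linarith)]
    have := intervalIntegral.integral_comp_neg (a := κ - r) (b := κ + r) (gaussianPDFReal 0 1)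
    simp only [hodd] at this
    rw [this]
    congr 1 <;> ring

/-- Off-centre intervals have smaller probability than centred ones of the same length. -/
lemma normalBall_lt_center {κ r : ℝ} (hκ : κ ≠ 0) (hr : 0 < r) :
    normalBall κ r < normalBall 0 r := by
  wlog hpos : 0 < κ generalizing κ
  · rw [← normalBall_neg]
    exact this (neg_ne_zero.2 hκ) (neg_pos.2 (lt_of_le_of_ne (not_lt.1 hpos) hκ))
  set f := gaussianPDFReal 0 1
  have hi : ∀ a b, IntervalIntegrable f volume a b := fun a b =>
    continuous_stdNormalPDF.intervalIntegrable a b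
  -- Both integrals are split so that they share the piece from κ - r to r. The integrals are
  -- oriented, so the case κ - r > r of disjoint intervals needs no separate treatment.
  rw [normalBall, normalBall, stdNormal_Icc (by linarith), stdNormal_Icc (by linarith),
    ← intervalIntegral.integral_add_adjacent_intervals (hi (κ - r) (0 + r)) (hi (0 + r) (κ + r)),
    ← intervalIntegral.integral_add_adjacent_intervals (hi (0 - r) (κ - r)) (hi (κ - r) (0 + r)),
    add_comm]
  refine add_lt_add_left ?_ _
  -- Translation by 2r carries the piece [-r, κ - r] onto [r, κ + r], and (x - 2r)² < x² there for x
  -- > r, so the density is larger on the former.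
  have hshift : ∫ x in (0 - r)..(κ - r), f x = ∫ x in (0 + r)..(κ + r), f (x - 2 * r) := by
    rw [intervalIntegral.integral_comp_sub_right]
    congr 1 <;> ring
  rw [hshift]
  refine intervalIntegral.integral_lt_integral_of_continuousOn_of_le_of_exists_lt
    (by linarith) continuous_stdNormalPDF.continuousOn
    (continuous_stdNormalPDF.comp (by fun_prop)).continuousOn ?_ ?_
  · intro x hx
    refine (stdNormalPDF_lt ?_).le
    nlinarith [hx.1]
  · exact ⟨κ + r, ⟨by linarith, le_rfl⟩, stdNormalPDF_lt (by nlinarith)⟩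

/-! Distribution functions of squares -/

lemma abs_sub_le_iff_mem_Icc {x κ r : ℝ} : |x - κ| ≤ r ↔ x ∈ Set.Icc (κ - r) (κ + r) := by
  rw [abs_le, Set.mem_Icc]; constructor <;> rintro ⟨h1, h2⟩ <;> constructor <;> linarith

/-- The first summand may be negative, in which case its root is 0. This lets the distribution
function t ↦ `normalBall 0 √(t * b)` be treated for all real t at once. -/
lemma sqrt_add_le (x : ℝ) {y : ℝ} (hy : 0 ≤ y) : √(x + y) ≤ √x + √y := by
  rcases le_total 0 x with hx | hx
  · rw [Real.sqrt_le_iff]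
    refine ⟨by positivity, ?_⟩
    nlinarith [Real.sq_sqrt hx, Real.sq_sqrt hy, Real.sqrt_nonneg x, Real.sqrt_nonneg y,
      mul_nonneg (Real.sqrt_nonneg x) (Real.sqrt_nonneg y)]
  · have : √(x + y) ≤ √y := Real.sqrt_le_sqrt (by linarith)
    linarith [Real.sqrt_nonneg x]

/-- If `|X|` is nearly a folded standard normal variable and `Y` is near `X² / b`, then the
distribution function of `Y` is near the one of `N² / b`. -/
lemma abs_cdf_sub_normalBall_le {α : Type*} [MeasurableSpace α] (μ : Measure α)
    [IsProbabilityMeasure μ] {X Y : α → ℝ} {b C ε : ℝ} (hb : 0 < b) (hbC : b ≤ C) (hε : 0 ≤ ε)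
    (hX : ∀ r, |μ.real {a | |X a| ≤ r} - normalBall 0 r| ≤ ε)
    (hY : μ.real {a | ¬ |Y a - X a ^ 2 / b| ≤ ε} ≤ ε) (t : ℝ) :
    |μ.real {a | Y a ≤ t} - normalBall 0 √(t * b)| ≤ 2 * ε + 2 * √(ε * C) := by
  have hεb : √(ε * b) ≤ √(ε * C) := Real.sqrt_le_sqrt (mul_le_mul_of_nonneg_left hbC hε)
  rw [abs_le]
  constructor
  · have hsub : 0 ≤ (t - ε) * b → {a | |X a| ≤ √((t - ε) * b)} ⊆
        {a | Y a ≤ t} ∪ {a | ¬ |Y a - X a ^ 2 / b| ≤ ε} := by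
      intro hnn a ha
      by_cases h : |Y a - X a ^ 2 / b| ≤ ε
      · left
        have h1 : X a ^ 2 ≤ (t - ε) * b := by
          rw [← sq_abs, ← Real.sq_sqrt hnn]
          exact pow_le_pow_left₀ (abs_nonneg _) ha 2
        have h2 : X a ^ 2 / b ≤ t - ε := by rwa [div_le_iff₀ hb]
        show Y a ≤ t
        linarith [(abs_le.1 h).2]
      · exact Or.inr h
    have hL : normalBall 0 √(t * b) ≤ normalBall 0 √((t - ε) * b) + 2 * √(ε * b) := by
      have h1 : √(t * b) ≤ √((t - ε) * b) + √(ε * b) := by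
        have := sqrt_add_le ((t - ε) * b) (y := ε * b) (by positivity)
        rwa [show (t - ε) * b + ε * b = t * b by ring] at this
      have h2 := normalBall_le_add 0
        (show √((t - ε) * b) ≤ √((t - ε) * b) + √(ε * b) by linarith [Real.sqrt_nonneg (ε * b)])
      linarith [normalBall_mono 0 h1]
    -- For (t - ε)b < 0 the first root vanishes and the target is at most 2√(εb), so nonnegativity
    -- of the probability is enough.
    rcases le_or_gt 0 ((t - ε) * b) with hnn | hneg
    · have h1 := (measureReal_mono (μ := μ) (hsub hnn)).trans (measureReal_union_le _ _)
      have h2 := (abs_le.1 (hX √((t - ε) * b))).1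
      linarith
    · rw [Real.sqrt_eq_zero_of_nonpos hneg.le, normalBall_zero] at hL
      have := measureReal_nonneg (μ := μ) (s := {a | Y a ≤ t})
      linarith
  · have hsub : {a | Y a ≤ t} ⊆
        {a | |X a| ≤ √((t + ε) * b)} ∪ {a | ¬ |Y a - X a ^ 2 / b| ≤ ε} := by
      intro a ha
      by_cases h : |Y a - X a ^ 2 / b| ≤ ε
      · left
        refine Real.abs_le_sqrt ?_
        rw [← div_le_iff₀ hb]
        have ha' : Y a ≤ t := ha
        linarith [(abs_le.1 h).1]
      · exact Or.inr h
    have h1 := (measureReal_mono (μ := μ) hsub).trans (measureReal_union_le _ _)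
    have h2 := (abs_le.1 (hX √((t + ε) * b))).2
    have h3 : √((t + ε) * b) ≤ √(t * b) + √(ε * b) := by
      rw [add_mul]; exact sqrt_add_le _ (by positivity)
    have h4 := normalBall_le_add 0
      (show √(t * b) ≤ √(t * b) + √(ε * b) by linarith [Real.sqrt_nonneg (ε * b)])
    linarith [normalBall_mono 0 h3]

/-- A Lipschitz bump function on `[-s - h, s + h]` of height `h`. -/
noncomputable def bump (h s x : ℝ) : ℝ := max 0 (min h (s + h - |x|))

lemma bump_nonneg (h s x : ℝ) : 0 ≤ bump h s x := le_max_left _ _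

lemma bump_le {h : ℝ} (h0 : 0 ≤ h) (s x : ℝ) : bump h s x ≤ h := max_le h0 (min_le_left _ _)

lemma lipschitzWith_bump (h s : ℝ) : LipschitzWith 1 (bump h s) := by
  refine LipschitzWith.const_max ?_ 0
  refine LipschitzWith.const_min ?_ h
  refine LipschitzWith.of_dist_le_mul fun x y => ?_
  simp only [Real.dist_eq, NNReal.coe_one, one_mul]
  rw [show s + h - |x| - (s + h - |y|) = |y| - |x| by ring, abs_sub_comm x y]
  exact abs_abs_sub_abs_le_abs_sub y x

/-- The bump lies between h times the indicators of |V| ≤ s and |V| ≤ s + h. Height h keeps its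
Lipschitz constant at one. -/
lemma integral_bump_mem {α : Type*} [MeasurableSpace α] (ν : Measure α) [IsProbabilityMeasure ν]
    {V : α → ℝ} (hV : Measurable V) {h : ℝ} (h0 : 0 < h) (s : ℝ) :
    h * ν.real {a | |V a| ≤ s} ≤ ∫ a, bump h s (V a) ∂ν ∧
      ∫ a, bump h s (V a) ∂ν ≤ h * ν.real {a | |V a| ≤ s + h} := by
  have hm : ∀ s, MeasurableSet {a | |V a| ≤ s} := fun s =>
    measurableSet_le (by fun_prop) measurable_const
  have hgi : Integrable (fun a => bump h s (V a)) ν := by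
    refine Integrable.of_bound
      ((lipschitzWith_bump h s).continuous.measurable.comp hV).aestronglyMeasurable h ?_
    exact Eventually.of_forall fun a => by
      rw [Real.norm_eq_abs, abs_of_nonneg (bump_nonneg _ _ _)]; exact bump_le h0.le _ _
  have hind : ∀ s, h * ν.real {a | |V a| ≤ s} = ∫ a, {a | |V a| ≤ s}.indicator (fun _ => h) a ∂ν :=
    fun s => by rw [integral_indicator_const _ (hm s), smul_eq_mul, mul_comm]
  have hii : ∀ s, Integrable ({a | |V a| ≤ s}.indicator fun _ => h) ν := fun s =>
    (integrable_const h).indicator (hm s)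
  rw [hind, hind]
  constructor
  · refine integral_mono (hii s) hgi fun a => ?_
    by_cases ha : |V a| ≤ s
    · rw [Set.indicator_of_mem (by exact ha)]
      exact le_max_of_le_right (le_min le_rfl (by linarith))
    · rw [Set.indicator_of_notMem (by exact ha)]; exact bump_nonneg _ _ _
  · refine integral_mono hgi (hii _) fun a => ?_
    by_cases ha : |V a| ≤ s + h
    · rw [Set.indicator_of_mem (by exact ha)]; exact bump_le h0.le _ _
    · rw [Set.indicator_of_notMem (by exact ha)]
      exact max_le le_rfl ((min_le_right _ _).trans (by linarith))

/-- Closeness to the standard normal law in the bounded Lipschitz metric bounds the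
distribution function of the absolute value. -/
lemma abs_cdf_abs_sub_normalBall_le_of_lipschitz {α : Type*} [MeasurableSpace α] (μ : Measure α)
    [IsProbabilityMeasure μ] {X : α → ℝ} (hX : Measurable X) {h : ℝ} (h0 : 0 < h) (h1 : h ≤ 1)
    (hf : ∀ f : ℝ → ℝ, (∀ x, |f x| ≤ 1) → LipschitzWith 1 f →
      |(∫ a, f (X a) ∂μ) - ∫ x, f x ∂(gaussianReal 0 1)| ≤ h ^ 2) (r : ℝ) :
    |μ.real {a | |X a| ≤ r} - normalBall 0 r| ≤ 3 * h := by
  -- The tolerance h² becomes h after division by the height of the bump, and the widening by h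
  -- costs at most 2h on the normal side, whence 3h.
  have gcl : ∀ s, |(∫ a, bump h s (X a) ∂μ) - ∫ x, bump h s x ∂(gaussianReal 0 1)| ≤
      h ^ 2 := fun s => hf _ (fun x => by rw [abs_of_nonneg (bump_nonneg h s x)]; exact (bump_le h0.le s x).trans h1)
      (lipschitzWith_bump h s)
  have hball : ∀ s, normalBall 0 s = (gaussianReal 0 1).real {x | |id x| ≤ s} := fun s => by
    rw [normalBall]; congr 1; ext x
    have := abs_sub_le_iff_mem_Icc (x := x) (κ := 0) (r := s)
    rw [sub_zero] at this
    exact this.symm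
  have hl := (integral_bump_mem μ hX h0 (r - h)).2
  have hu := (integral_bump_mem μ hX h0 r).1
  have hl' := (integral_bump_mem (gaussianReal 0 1) measurable_id h0 (r - h)).1
  have hu' := (integral_bump_mem (gaussianReal 0 1) measurable_id h0 r).2
  rw [← hball] at hl' hu'
  simp only [id] at hl' hu'
  rw [sub_add_cancel] at hl
  have e1 := abs_le.1 (gcl r)
  have e2 := abs_le.1 (gcl (r - h))
  have b1 := normalBall_le_add 0 (show r ≤ r + h by linarith)
  have b2 := normalBall_le_add 0 (show r - h ≤ r by linarith)
  rw [abs_le]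
  constructor
  · have : h * normalBall 0 (r - h) ≤ h * (μ.real {a | |X a| ≤ r} + h) := by nlinarith
    have := le_of_mul_le_mul_left this h0
    linarith
  · have : h * μ.real {a | |X a| ≤ r} ≤ h * (normalBall 0 (r + h) + h) := by nlinarith
    have := le_of_mul_le_mul_left this h0
    linarith

/-- Monotone functions that converge pointwise to the folded normal distribution function
converge uniformly. -/
lemma uniform_of_pointwise_normalBall {A : ℕ → ℝ → ℝ} (hmono : ∀ n, Monotone (A n))
    (hneg : ∀ n, ∀ r < 0, A n r = 0) (hle : ∀ n r, A n r ≤ 1)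
    (h : ∀ r, 0 ≤ r → Tendsto (fun n => A n r) atTop (𝓝 (normalBall 0 r)))
    {ε : ℝ} (hε : 0 < ε) : ∀ᶠ n in atTop, ∀ r, |A n r - normalBall 0 r| ≤ ε := by
  obtain ⟨R, hR⟩ := ((tendsto_normalBall 0).eventually
    (le_mem_nhds (show 1 - ε / 4 < 1 by linarith))).exists
  -- Pólya's argument: monotone functions are controlled by their values on a grid of step s
  -- reaching beyond R. Across a cell the limit grows by at most 2s, and the grid error is s, in
  -- total 3s ≤ ε.
  set s := ε / 4 with hs
  have hs0 : 0 < s := by positivity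
  obtain ⟨N, hN⟩ := exists_nat_ge (R / s)
  rw [div_le_iff₀ hs0] at hN
  have hgrid : ∀ᶠ n in atTop, ∀ j ∈ Finset.range (N + 1),
      |A n (j * s) - normalBall 0 (j * s)| ≤ s := by
    rw [eventually_all_finset]
    intro j _
    have := h (j * s) (by positivity)
    rw [Metric.tendsto_nhds] at this
    filter_upwards [this s hs0] with n hn
    exact hn.le
  filter_upwards [hgrid] with n hn r
  rcases lt_or_ge r 0 with hr | hr
  · rw [hneg n r hr, normalBall_of_neg 0 hr]; simpa using hε.le
  rcases le_or_gt (N * s) r with hbig | hsmall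
  · have h1 := abs_le.1 (hn N (by simp))
    have h2 := hmono n hbig
    have h3 := normalBall_mono 0 hN
    have h4 := normalBall_mono 0 hbig
    have h5 := hle n r
    have h6 := normalBall_le_one 0 r
    rw [abs_le]; constructor <;> linarith
  · set j := ⌊r / s⌋₊ with hj
    have hj1 : (j : ℝ) * s ≤ r := by
      rw [← le_div_iff₀ hs0]; exact Nat.floor_le (by positivity)
    have hj2 : r ≤ ((j + 1 : ℕ) : ℝ) * s := by
      rw [← div_le_iff₀ hs0]; push_cast; exact (Nat.lt_floor_add_one _).le
    have hjN : j < N := by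
      have : (j : ℝ) * s < N * s := hj1.trans_lt hsmall
      exact_mod_cast lt_of_mul_lt_mul_right this hs0.le
    have h1 := abs_le.1 (hn j (by simp; omega))
    have h2 := abs_le.1 (hn (j + 1) (by simp; omega))
    have h3 := hmono n hj1
    have h4 := hmono n hj2
    have h5 := normalBall_mono 0 hj1
    have h6 := normalBall_mono 0 hj2
    have h7 := normalBall_le_add 0 (show (j : ℝ) * s ≤ ((j + 1 : ℕ) : ℝ) * s by linarith)
    have h8 : ((j + 1 : ℕ) : ℝ) * s - j * s = s := by push_cast; ring
    rw [abs_le]; constructor <;> linarith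

/-- Bounds for the quantile of a distribution function near the one of `N² / b`. -/
lemma sInf_quantile_mem {F : ℝ → ℝ} {a b ε r₁ r₂ : ℝ} (hb : 0 < b) (hr₁ : 0 ≤ r₁) (hr₂ : 0 ≤ r₂)
    (hF : ∀ t, |F t - normalBall 0 √(t * b)| ≤ ε)
    (h₁ : normalBall 0 r₁ + ε < a) (h₂ : a ≤ normalBall 0 r₂ - ε) :
    r₁ ^ 2 ≤ sInf {c | a ≤ F c} * b ∧ sInf {c | a ≤ F c} * b ≤ r₂ ^ 2 := by
  have hlow : ∀ c ∈ {c | a ≤ F c}, r₁ ^ 2 / b ≤ c := by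
    intro c hc
    have hc' : a ≤ F c := hc
    have h := (abs_le.1 (hF c)).2
    have hlt : normalBall 0 r₁ < normalBall 0 √(c * b) := by linarith
    have hlt' := (normalBall_mono 0).reflect_lt hlt
    rw [div_le_iff₀ hb]
    exact ((Real.lt_sqrt hr₁).1 hlt').le
  have hmem : r₂ ^ 2 / b ∈ {c | a ≤ F c} := by
    have h := (abs_le.1 (hF (r₂ ^ 2 / b))).1
    rw [div_mul_cancel₀ _ hb.ne', Real.sqrt_sq hr₂] at h
    show a ≤ F _
    linarith
  constructor
  · rw [← div_le_iff₀ hb]; exact le_csInf ⟨_, hmem⟩ hlow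
  · rw [← le_div_iff₀ hb]; exact csInf_le ⟨_, hlow⟩ hmem

/-! Positive definite weights -/

section Weights

variable {n : ℕ}

lemma posDef_dotProduct_inv_pos {A : Matrix (Fin n) (Fin n) ℝ} (hA : A.PosDef)
    {ξ : Fin n → ℝ} (hξ : ξ ≠ 0) : 0 < ξ ⬝ᵥ (A⁻¹ *ᵥ ξ) := by
  simpa using hA.inv.dotProduct_mulVec_pos hξ

lemma posDef_dotProduct_inv_nonneg {A : Matrix (Fin n) (Fin n) ℝ} (hA : A.PosDef)
    (ξ : Fin n → ℝ) : 0 ≤ ξ ⬝ᵥ (A⁻¹ *ᵥ ξ) := by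
  rcases eq_or_ne ξ 0 with rfl | h
  · simp
  · exact (posDef_dotProduct_inv_pos hA h).le

lemma posDef_dotProduct_inv_comm {A : Matrix (Fin n) (Fin n) ℝ} (hA : A.PosDef)
    (ξ ζ : Fin n → ℝ) : ξ ⬝ᵥ (A⁻¹ *ᵥ ζ) = ζ ⬝ᵥ (A⁻¹ *ᵥ ξ) := by
  have h : (A⁻¹)ᵀ = A⁻¹ := by simpa [Matrix.IsHermitian] using hA.inv.isHermitian
  rw [Matrix.dotProduct_mulVec, dotProduct_comm, ← Matrix.mulVec_transpose, h]

lemma posDef_mulVec_inv {A : Matrix (Fin n) (Fin n) ℝ} (hA : A.PosDef) (ξ : Fin n → ℝ) :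
    A *ᵥ (A⁻¹ *ᵥ ξ) = ξ := by
  have : IsUnit A.det := (Matrix.isUnit_iff_isUnit_det A).1 hA.isUnit
  rw [Matrix.mulVec_mulVec, Matrix.mul_nonsing_inv _ this, Matrix.one_mulVec]

/-- The lower eigenvalue bound is applied to A⁻¹ξ. -/
lemma dotProduct_inv_self_le {A : Matrix (Fin n) (Fin n) ℝ} (hA : A.PosDef) {c : ℝ}
    (hc : ∀ ξ : Fin n → ℝ, c * (ξ ⬝ᵥ ξ) ≤ ξ ⬝ᵥ (A *ᵥ ξ)) (ξ : Fin n → ℝ) :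
    c * ((A⁻¹ *ᵥ ξ) ⬝ᵥ (A⁻¹ *ᵥ ξ)) ≤ ξ ⬝ᵥ (A⁻¹ *ᵥ ξ) := by
  have := hc (A⁻¹ *ᵥ ξ)
  rwa [posDef_mulVec_inv hA, dotProduct_comm (A⁻¹ *ᵥ ξ) ξ] at this

lemma two_mul_abs_dotProduct_le (ξ ζ : Fin n → ℝ) :
    2 * |ξ ⬝ᵥ ζ| ≤ ξ ⬝ᵥ ξ + ζ ⬝ᵥ ζ := by
  have h1 : ∀ i, 0 ≤ (ξ i - ζ i) * (ξ i - ζ i) := fun _ => mul_self_nonneg _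
  have h2 : ∀ i, 0 ≤ (ξ i + ζ i) * (ξ i + ζ i) := fun _ => mul_self_nonneg _
  have e1 : (ξ - ζ) ⬝ᵥ (ξ - ζ) = ξ ⬝ᵥ ξ + ζ ⬝ᵥ ζ - 2 * (ξ ⬝ᵥ ζ) := by
    rw [sub_dotProduct, dotProduct_sub, dotProduct_sub, dotProduct_comm ζ ξ]; ring
  have e2 : (ξ + ζ) ⬝ᵥ (ξ + ζ) = ξ ⬝ᵥ ξ + ζ ⬝ᵥ ζ + 2 * (ξ ⬝ᵥ ζ) := by
    rw [add_dotProduct, dotProduct_add, dotProduct_add, dotProduct_comm ζ ξ]; ring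
  have p1 : 0 ≤ (ξ - ζ) ⬝ᵥ (ξ - ζ) := Finset.sum_nonneg fun i _ => h1 i
  have p2 : 0 ≤ (ξ + ζ) ⬝ᵥ (ξ + ζ) := Finset.sum_nonneg fun i _ => h2 i
  rcases abs_cases (ξ ⬝ᵥ ζ) with h | h <;> linarith [h.1]

lemma dotProduct_self_nonneg' (ξ : Fin n → ℝ) : 0 ≤ ξ ⬝ᵥ ξ :=
  Finset.sum_nonneg fun _ _ => mul_self_nonneg _

/-- A pointwise bound by squares of both arguments, from 2|xy| ≤ x² + y²; it supplies the integrable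
majorant for the weak inner product. -/
lemma abs_dotProduct_inv_le {A : Matrix (Fin n) (Fin n) ℝ} (hA : A.PosDef) {c : ℝ} (hc0 : 0 < c)
    (hc : ∀ ξ : Fin n → ℝ, c * (ξ ⬝ᵥ ξ) ≤ ξ ⬝ᵥ (A *ᵥ ξ)) (ξ ζ : Fin n → ℝ) :
    |ξ ⬝ᵥ (A⁻¹ *ᵥ ζ)| ≤ ξ ⬝ᵥ ξ + (c⁻¹) ^ 2 * (ζ ⬝ᵥ ζ) := by
  set y := A⁻¹ *ᵥ ζ
  have h1 : c * (y ⬝ᵥ y) ≤ ζ ⬝ᵥ y := dotProduct_inv_self_le hA hc ζ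
  have h2 := two_mul_abs_dotProduct_le (c⁻¹ • ζ) y
  have h3 := two_mul_abs_dotProduct_le ξ y
  rw [smul_dotProduct, smul_dotProduct, dotProduct_smul, smul_eq_mul, smul_eq_mul, abs_mul,
    abs_of_pos (inv_pos.2 hc0)] at h2
  have h4 : y ⬝ᵥ y ≤ c⁻¹ * |ζ ⬝ᵥ y| := by
    rw [inv_mul_eq_div, le_div_iff₀ hc0]; linarith [le_abs_self (ζ ⬝ᵥ y)]
  have h5 : y ⬝ᵥ y ≤ (c⁻¹) ^ 2 * (ζ ⬝ᵥ ζ) := by simp only [smul_eq_mul] at h2; nlinarith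
  have := dotProduct_self_nonneg' ξ
  linarith [abs_nonneg (ξ ⬝ᵥ y), dotProduct_self_nonneg' y]

/-- Determinant and adjugate are polynomial in the entries, and the inverse is their quotient. -/
lemma measurable_inv_apply {α : Type*} [MeasurableSpace α] {A : α → Matrix (Fin n) (Fin n) ℝ}
    (hA : ∀ i j, Measurable fun a => A a i j) (i j : Fin n) :
    Measurable fun a => (A a)⁻¹ i j := by
  have hA' : Measurable fun a => (fun i j => A a i j : Fin n → Fin n → ℝ) :=
    measurable_pi_lambda _ fun i => measurable_pi_lambda _ fun j => hA i j
  have hd : Measurable fun a => (A a).det := by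
    have : Continuous fun f : Fin n → Fin n → ℝ => (Matrix.of f).det :=
      Continuous.matrix_det (by exact continuous_id)
    exact this.measurable.comp hA'
  have hj : Measurable fun a => (A a).adjugate i j := by
    have h1 : Continuous fun f : Fin n → Fin n → ℝ => (Matrix.of f).adjugate :=
      Continuous.matrix_adjugate (by exact continuous_id)
    have h2 : Continuous fun f : Fin n → Fin n → ℝ => (Matrix.of f).adjugate i j :=
      Continuous.matrix_elem h1 i j
    exact h2.measurable.comp hA'
  have : (fun a => (A a)⁻¹ i j) = fun a => ((A a).det)⁻¹ * (A a).adjugate i j := by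
    funext a
    rw [Matrix.inv_def, Matrix.smul_apply, Ring.inverse_eq_inv', smul_eq_mul]
  rw [this]
  exact hd.inv.mul hj

lemma measurable_dotProduct_mulVec {α : Type*} [MeasurableSpace α]
    {A : α → Matrix (Fin n) (Fin n) ℝ} {f g : α → Fin n → ℝ}
    (hA : ∀ i j, Measurable fun a => A a i j) (hf : Measurable f) (hg : Measurable g) :
    Measurable fun a => f a ⬝ᵥ (A a *ᵥ g a) := by
  simp only [dotProduct, Matrix.mulVec]
  refine Finset.measurable_fun_sum _ fun i _ => ((measurable_pi_apply i).comp hf).mul ?_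
  exact Finset.measurable_fun_sum _ fun j _ => (hA i j).mul ((measurable_pi_apply j).comp hg)

end Weights

/-! The weak inner product -/

section InnerProduct

variable {dθ dρ : ℕ} {𝒳 𝒴 H : Type*} [MeasurableSpace 𝒳] [MeasurableSpace 𝒴]
  [NormedAddCommGroup H] [NormedSpace ℝ H] {S : Setting dθ dρ 𝒳 𝒴 H}

lemma integrable_dotProduct_self {α : Type*} [MeasurableSpace α] {μ : Measure α} {n : ℕ}
    {f : α → Fin n → ℝ} (hf : MemLp f 2 μ) : Integrable (fun a => f a ⬝ᵥ f a) μ := by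
  simp only [dotProduct]
  refine integrable_finsetSum _ fun i _ => ?_
  have := (hf.eval i).integrable_sq
  simpa only [sq] using this

namespace Setting

lemma ip_smul_left (a : ℝ) (v w : Par dθ H) : S.ip (a • v) w = a * S.ip v w := by
  unfold ip
  rw [← integral_const_mul]
  congr 1; funext x
  rw [map_smul, Pi.smul_apply, smul_dotProduct, smul_eq_mul]

lemma nrm_nonneg (v : Par dθ H) : 0 ≤ S.nrm v := Real.sqrt_nonneg _

lemma nrm_zero : S.nrm 0 = 0 := by simp [nrm, ip]

lemma sub_mem_V {α : Par dθ H} (hα : α ∈ S.Aos) : α - S.alpha0 ∈ S.V :=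
  Submodule.subset_span ⟨α, hα, rfl⟩

variable [StandardBorelSpace 𝒴] [Nonempty 𝒴]

/-- The derivative is square integrable only on V, and the integral is additive only on integrable
functions. Additivity of `ip` is therefore stated for vectors of V, whereas homogeneity holds
everywhere. -/
lemma Basic.integrable_ip (hS : S.Basic) {v₁ v₂ : Par dθ H} (h₁ : v₁ ∈ S.V) (h₂ : v₂ ∈ S.V) :
    Integrable (fun x => S.dm v₁ x ⬝ᵥ ((S.Sigma x)⁻¹ *ᵥ S.dm v₂ x))
      (S.P0 : Measure (𝒳 × 𝒴)).fst := by
  obtain ⟨c, C, hc, hcC⟩ := hS.sigma_bdd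
  refine Integrable.mono' ((integrable_dotProduct_self (hS.dm_memLp _ h₁)).add
    ((integrable_dotProduct_self (hS.dm_memLp _ h₂)).const_mul ((c⁻¹) ^ 2)))
    (measurable_dotProduct_mulVec (measurable_inv_apply hS.sigma_meas) (hS.dm_meas _)
      (hS.dm_meas _)).aestronglyMeasurable ?_
  exact Eventually.of_forall fun x =>
    abs_dotProduct_inv_le (hS.sigma_pos x) hc (fun ξ => (hcC x ξ).1) _ _

lemma Basic.ip_comm (hS : S.Basic) (v w : Par dθ H) : S.ip v w = S.ip w v := by
  unfold ip
  congr 1; funext x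
  exact posDef_dotProduct_inv_comm (hS.sigma_pos x) _ _

lemma Basic.ip_smul_right (hS : S.Basic) (a : ℝ) (v w : Par dθ H) :
    S.ip v (a • w) = a * S.ip v w := by
  rw [hS.ip_comm, ip_smul_left, hS.ip_comm]

lemma Basic.ip_add_right (hS : S.Basic) {v w₁ w₂ : Par dθ H} (hv : v ∈ S.V) (h₁ : w₁ ∈ S.V)
    (h₂ : w₂ ∈ S.V) : S.ip v (w₁ + w₂) = S.ip v w₁ + S.ip v w₂ := by
  unfold ip
  rw [← integral_add (hS.integrable_ip hv h₁) (hS.integrable_ip hv h₂)]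
  congr 1; funext x
  rw [map_add, Pi.add_apply, Matrix.mulVec_add, dotProduct_add]

lemma Basic.ip_add_left (hS : S.Basic) {v w₁ w₂ : Par dθ H} (hv : v ∈ S.V) (h₁ : w₁ ∈ S.V)
    (h₂ : w₂ ∈ S.V) : S.ip (w₁ + w₂) v = S.ip w₁ v + S.ip w₂ v := by
  rw [hS.ip_comm, hS.ip_add_right hv h₁ h₂, hS.ip_comm v, hS.ip_comm v]

lemma Basic.ip_sub_right (hS : S.Basic) {v w₁ w₂ : Par dθ H} (hv : v ∈ S.V) (h₁ : w₁ ∈ S.V)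
    (h₂ : w₂ ∈ S.V) : S.ip v (w₁ - w₂) = S.ip v w₁ - S.ip v w₂ := by
  have : w₁ - w₂ = w₁ + (-1 : ℝ) • w₂ := by rw [neg_one_smul, sub_eq_add_neg]
  rw [this, hS.ip_add_right hv h₁ (S.V.smul_mem _ h₂), hS.ip_smul_right]; ring

lemma Basic.ip_self_nonneg (hS : S.Basic) (v : Par dθ H) : 0 ≤ S.ip v v :=
  integral_nonneg fun x => posDef_dotProduct_inv_nonneg (hS.sigma_pos x) _

lemma Basic.nrm_sq (hS : S.Basic) (v : Par dθ H) : S.nrm v ^ 2 = S.ip v v :=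
  Real.sq_sqrt (hS.ip_self_nonneg v)

lemma Basic.nrm_smul (hS : S.Basic) (a : ℝ) (v : Par dθ H) : S.nrm (a • v) = |a| * S.nrm v := by
  unfold nrm
  rw [ip_smul_left, hS.ip_smul_right, ← mul_assoc, Real.sqrt_mul (mul_self_nonneg a),
    Real.sqrt_mul_self_eq_abs]

lemma Basic.ip_line (hS : S.Basic) {v w : Par dθ H} (hv : v ∈ S.V) (hw : w ∈ S.V) (t : ℝ) :
    S.ip (v + t • w) (v + t • w) = S.ip v v + 2 * t * S.ip v w + t ^ 2 * S.ip w w := by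
  have ht : t • w ∈ S.V := S.V.smul_mem _ hw
  rw [hS.ip_add_right (S.V.add_mem hv ht) hv ht, hS.ip_add_left hv hv ht,
    hS.ip_add_left ht hv ht, ip_smul_left, ip_smul_left, hS.ip_smul_right, hS.ip_smul_right,
    hS.ip_comm w v]
  ring

/-- The quadratic t ↦ ⟨v + tw, v + tw⟩ is nonnegative, so its discriminant is at most zero; this
covers degenerate w, as the form is only semidefinite on V. -/
lemma Basic.abs_ip_le (hS : S.Basic) {v w : Par dθ H} (hv : v ∈ S.V) (hw : w ∈ S.V) :
    |S.ip v w| ≤ S.nrm v * S.nrm w := by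
  have h := discrim_le_zero (a := S.ip w w) (b := 2 * S.ip v w) (c := S.ip v v) fun t => by
    have := hS.ip_self_nonneg (v + t • w)
    rw [hS.ip_line hv hw] at this
    nlinarith
  rw [discrim, ← hS.nrm_sq, ← hS.nrm_sq] at h
  refine abs_le_of_sq_le_sq ?_ (mul_nonneg (nrm_nonneg _) (nrm_nonneg _))
  nlinarith

lemma Basic.nrm_add_le (hS : S.Basic) {v w : Par dθ H} (hv : v ∈ S.V) (hw : w ∈ S.V) :
    S.nrm (v + w) ≤ S.nrm v + S.nrm w := by
  refine abs_le_of_sq_le_sq' ?_ (add_nonneg (nrm_nonneg _) (nrm_nonneg _)) |>.2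
  have h := hS.ip_line hv hw 1
  rw [one_smul] at h
  rw [hS.nrm_sq, h, add_sq, hS.nrm_sq, hS.nrm_sq]
  nlinarith [(abs_le.1 (hS.abs_ip_le hv hw)).2]

lemma Basic.nrm_neg (hS : S.Basic) (v : Par dθ H) : S.nrm (-v) = S.nrm v := by
  rw [← neg_one_smul ℝ, hS.nrm_smul]; simp

lemma Basic.nrm_sub_le (hS : S.Basic) {v w : Par dθ H} (hv : v ∈ S.V) (hw : w ∈ S.V) :
    S.nrm (v - w) ≤ S.nrm v + S.nrm w := by
  rw [sub_eq_add_neg, ← hS.nrm_neg w]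
  exact hS.nrm_add_le hv (S.V.neg_mem hw)

/-- A vector of minimal norm in a translate of a subspace is orthogonal to the subspace. -/
lemma Basic.ip_eq_zero_of_min (hS : S.Basic) {v w : Par dθ H} (hv : v ∈ S.V) (hw : w ∈ S.V)
    (hmin : ∀ t : ℝ, S.nrm v ≤ S.nrm (v + t • w)) : S.ip v w = 0 := by
  set a := S.ip v w with ha
  set b := S.ip w w with hb
  have hb0 : 0 ≤ b := hS.ip_self_nonneg w
  -- The optimal step would be -a/b; the denominator b + 1 avoids the case b = 0 and still produces
  -- a strict decrease unless a = 0.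
  have h : 0 ≤ 2 * (-a / (b + 1)) * a + (-a / (b + 1)) ^ 2 * b := by
    have h1 := pow_le_pow_left₀ (nrm_nonneg v) (hmin (-a / (b + 1))) 2
    rw [hS.nrm_sq, hS.nrm_sq, hS.ip_line hv hw] at h1
    linarith
  have h2 : 2 * (-a / (b + 1)) * a + (-a / (b + 1)) ^ 2 * b =
      -(a ^ 2 * (b + 2) / (b + 1) ^ 2) := by field_simp; ring
  rw [h2] at h
  have h3 : 0 ≤ a ^ 2 * (b + 2) / (b + 1) ^ 2 := by positivity
  have h4 : a ^ 2 * (b + 2) / (b + 1) ^ 2 = 0 := by linarith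
  rw [div_eq_zero_iff] at h4
  rcases h4 with h4 | h4
  · have : a ^ 2 = 0 := by
      rcases mul_eq_zero.1 h4 with h5 | h5
      · exact h5
      · linarith
    exact pow_eq_zero_iff two_ne_zero |>.1 this
  · exact absurd h4 (by positivity)

lemma Basic.QHatW_nonneg (hS : S.Basic) (n : ℕ) (b : ℕ → ℝ) (z : Sample n 𝒳 𝒴) (α : Par dθ H) :
    0 ≤ S.QHatW n b z α :=
  mul_nonneg (by positivity) (Finset.sum_nonneg fun _ _ =>
    posDef_dotProduct_inv_nonneg (hS.sigmaHat_pos n z _) _)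

lemma Basic.measurable_score (hS : S.Basic) (α v : Par dθ H) : Measurable (S.score α v) :=
  measurable_dotProduct_mulVec (A := fun z : 𝒳 × 𝒴 => (S.Sigma z.1)⁻¹)
    (fun i j => (measurable_inv_apply hS.sigma_meas i j).comp measurable_fst)
    ((hS.dm_meas v).comp measurable_fst) (hS.rho_meas α)

lemma Basic.measurable_ZnW (hS : S.Basic) (n : ℕ) (b : ℕ → ℝ) (β : Par dθ H) :
    Measurable (S.ZnW n b β) := by
  unfold ZnW
  refine measurable_const.mul (Finset.measurable_fun_sum _ fun i _ => measurable_const.mul ?_)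
  exact (hS.measurable_score β _).comp (measurable_pi_apply i)

end Setting

end InnerProduct

/-! Bounds for the sieve standard deviation -/

section StandardDeviation

variable {dθ dρ : ℕ} {𝒳 𝒴 H : Type*} [MeasurableSpace 𝒳] [MeasurableSpace 𝒴]
  [StandardBorelSpace 𝒴] [Nonempty 𝒴]
  [NormedAddCommGroup H] [NormedSpace ℝ H] {S : Setting dθ dρ 𝒳 𝒴 H}

/-- The second moment of a linear form of a random vector whose matrix of second moments is
nondegenerate. -/
lemma lintegral_sq_dotProduct {α : Type*} [MeasurableSpace α] {μ : Measure α} {n : ℕ}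
    {f : α → Fin n → ℝ} (hf : Measurable f)
    (hdiag : ∀ i, ∫ a, f a i * f a i ∂μ ≠ 0) (ξ : Fin n → ℝ) :
    ∫⁻ a, ENNReal.ofReal ((ξ ⬝ᵥ f a) ^ 2) ∂μ =
      ENNReal.ofReal (ξ ⬝ᵥ ((Matrix.of fun i j => ∫ a, f a i * f a j ∂μ) *ᵥ ξ)) := by
  have hL : ∀ i, MemLp (fun a => f a i) 2 μ := fun i => by
    have hfi : Measurable fun a => f a i := (measurable_pi_apply i).comp hf
    rw [memLp_two_iff_integrable_sq hfi.aestronglyMeasurable]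
    -- The integral of a nonintegrable function is 0 by convention, so a nonzero diagonal entry
    -- certifies a finite second moment.
    have := not_imp_comm.1 integral_undef (hdiag i)
    simpa only [sq] using this
  have hij : ∀ i j, Integrable (fun a => f a i * f a j) μ := fun i j => (hL i).integrable_mul (hL j)
  have hexp : ∀ a, (ξ ⬝ᵥ f a) ^ 2 = ∑ i, ∑ j, (ξ i * ξ j) * (f a i * f a j) := fun a => by
    rw [sq, dotProduct, Finset.sum_mul_sum]
    exact Finset.sum_congr rfl fun i _ => Finset.sum_congr rfl fun j _ => by ring
  have hint : Integrable (fun a => (ξ ⬝ᵥ f a) ^ 2) μ := by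
    simp only [hexp]
    exact integrable_finsetSum _ fun i _ => integrable_finsetSum _ fun j _ => (hij i j).const_mul _
  rw [← ofReal_integral_eq_lintegral_ofReal hint (Eventually.of_forall fun a => sq_nonneg _)]
  congr 1
  simp only [hexp]
  rw [integral_finsetSum _ fun i _ => integrable_finsetSum _ fun j _ => (hij i j).const_mul _]
  simp only [dotProduct, Matrix.mulVec, Matrix.of_apply, Finset.mul_sum]
  refine Finset.sum_congr rfl fun i _ => ?_
  rw [integral_finsetSum _ fun j _ => (hij i j).const_mul _]
  refine Finset.sum_congr rfl fun j _ => ?_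
  rw [integral_const_mul]; ring

namespace Setting

/-- The variance of the score is bounded by the weak norm. -/
lemma Basic.exists_variance_le (hS : S.Basic) {c₀ : ℝ}
    (hD : S.Dgp (fun _ => S.alpha0) (fun _ => S.P0) c₀) : ∃ C : ℝ, 0 < C ∧ ∀ v ∈ S.V,
      Var[S.score S.alpha0 v; (S.P0 : Measure (𝒳 × 𝒴))] ≤ C * S.nrm v ^ 2 := by
  obtain ⟨c, C, hc, hcC⟩ := hS.sigma_bdd
  obtain ⟨c', C', hc', hcC'⟩ := hD.sigma0_bdd
  refine ⟨|C'| * c⁻¹ + 1, by positivity, fun v hv => ?_⟩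
  set P := (S.P0 : Measure (𝒳 × 𝒴))
  -- At the true parameter the conditional mean vanishes, so the conditional variance is the
  -- conditional second moment.
  have hm : ∀ᵐ x ∂P.fst, S.m S.P0 x S.alpha0 = 0 := (hD.ident 0 _ hS.alpha0_mem).2 rfl
  refine (variance_le_expectation_sq (hS.measurable_score _ _).aestronglyMeasurable).trans ?_
  have hsq : Measurable fun z => ENNReal.ofReal (S.score S.alpha0 v z ^ 2) :=
    ((hS.measurable_score _ _).pow_const 2).ennreal_ofReal
  -- The computation is made with the lower integral, because integrability of the squared score is
  -- not known beforehand.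
  have hle : ∫⁻ z, ENNReal.ofReal (S.score S.alpha0 v z ^ 2) ∂P ≤
      ENNReal.ofReal (∫ x, (|C'| * c⁻¹) * (S.dm v x ⬝ᵥ ((S.Sigma x)⁻¹ *ᵥ S.dm v x)) ∂P.fst) := by
    have hnn : ∀ x, 0 ≤ (|C'| * c⁻¹) * (S.dm v x ⬝ᵥ ((S.Sigma x)⁻¹ *ᵥ S.dm v x)) := fun x =>
      mul_nonneg (by positivity) (posDef_dotProduct_inv_nonneg (hS.sigma_pos x) _)
    rw [ofReal_integral_eq_lintegral_ofReal ((hS.integrable_ip hv hv).const_mul _)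
      (Eventually.of_forall hnn), ← Measure.lintegral_condKernel hsq]
    refine lintegral_mono_ae ?_
    filter_upwards [hm, hcC' 0] with x hx hx'
    set a := (S.Sigma x)⁻¹ *ᵥ S.dm v x with ha
    have hsc : ∀ y, S.score S.alpha0 v (x, y) = a ⬝ᵥ S.rho (x, y) S.alpha0 := fun y => by
      rw [score, posDef_dotProduct_inv_comm (hS.sigma_pos x), dotProduct_comm]
    have hcov : S.Sigma0 S.P0 S.alpha0 x = Matrix.of fun i j =>
        ∫ y, S.rho (x, y) S.alpha0 i * S.rho (x, y) S.alpha0 j ∂P.condKernel x := by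
      ext i j; simp [Sigma0, hx, P]
    -- The lower eigenvalue bound at a coordinate vector makes each diagonal entry positive.
    have hdiag : ∀ i, ∫ y, S.rho (x, y) S.alpha0 i * S.rho (x, y) S.alpha0 i ∂P.condKernel x ≠ 0 :=
      fun i h0 => by
        have := (hx' (Pi.single i 1)).1
        simp [hcov, h0] at this
        linarith
    simp only [hsc]
    rw [lintegral_sq_dotProduct (f := fun y => S.rho (x, y) S.alpha0)
      ((hS.rho_meas _).comp measurable_prodMk_left) hdiag, ← hcov]
    refine ENNReal.ofReal_le_ofReal ((hx' a).2.trans ?_)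
    have h1 := dotProduct_inv_self_le (hS.sigma_pos x) (fun ξ => (hcC x ξ).1) (S.dm v x)
    rw [← ha] at h1
    have h2 : a ⬝ᵥ a ≤ c⁻¹ * (S.dm v x ⬝ᵥ a) := by
      rw [inv_mul_eq_div, le_div_iff₀ hc]; linarith
    calc C' * (a ⬝ᵥ a) ≤ |C'| * (a ⬝ᵥ a) :=
          mul_le_mul_of_nonneg_right (le_abs_self _) (dotProduct_self_nonneg' a)
      _ ≤ |C'| * (c⁻¹ * (S.dm v x ⬝ᵥ a)) := mul_le_mul_of_nonneg_left h2 (abs_nonneg _)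
      _ = _ := by ring
  have hint : ∫ z, (S.score S.alpha0 v ^ 2) z ∂P =
      (∫⁻ z, ENNReal.ofReal (S.score S.alpha0 v z ^ 2) ∂P).toReal :=
    integral_eq_lintegral_of_nonneg_ae (Eventually.of_forall fun z => sq_nonneg _)
      ((hS.measurable_score _ _).pow_const 2).aestronglyMeasurable
  have hip : ∫ x, (|C'| * c⁻¹) * (S.dm v x ⬝ᵥ ((S.Sigma x)⁻¹ *ᵥ S.dm v x)) ∂P.fst =
      |C'| * c⁻¹ * S.nrm v ^ 2 := by
    rw [integral_const_mul, hS.nrm_sq]; rfl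
  rw [hint]
  rw [hip] at hle
  refine (ENNReal.toReal_le_of_le_ofReal (by positivity) hle).trans ?_
  nlinarith [sq_nonneg (S.nrm v)]

end Setting

end StandardDeviation

/-! The strong norm -/

section StrongNorm

variable {dθ : ℕ} {H : Type*} [NormedAddCommGroup H]

lemma normS_nonneg (α : Par dθ H) : 0 ≤ normS α := add_nonneg (norm_nonneg _) (norm_nonneg _)

lemma normS_add_le (α β : Par dθ H) : normS (α + β) ≤ normS α + normS β := by
  have h1 := norm_add_le α.1 β.1
  have h2 := norm_add_le α.2 β.2
  simp only [normS, Prod.fst_add, Prod.snd_add]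
  linarith

lemma continuous_normS : Continuous (normS : Par dθ H → ℝ) := by
  unfold normS; fun_prop

lemma normS_smul [NormedSpace ℝ H] (a : ℝ) (α : Par dθ H) : normS (a • α) = |a| * normS α := by
  simp only [normS, Prod.smul_fst, Prod.smul_snd, norm_smul, Real.norm_eq_abs]; ring

end StrongNorm

/-! ### Consistency and rates: the minimizers lie in the effective neighbourhood -/

section Localization

variable {dθ dρ : ℕ} {𝒳 𝒴 H Ω : Type*} [MeasurableSpace 𝒳] [MeasurableSpace 𝒴]
  [StandardBorelSpace 𝒴] [Nonempty 𝒴] [NormedAddCommGroup H] [NormedSpace ℝ H]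
  [MeasurableSpace Ω] {S : Setting dθ dρ 𝒳 𝒴 H} {T : Bootstrap dθ 𝒳 𝒴 H Ω}

namespace Setting

/-! Rates -/

lemma Basic.tendsto_Mn (hS : S.Basic) : Tendsto S.Mn atTop atTop := by
  unfold Mn
  have h1 : Tendsto (fun n : ℕ => Real.log (Real.log ((n : ℝ) + 1))) atTop atTop :=
    Real.tendsto_log_atTop.comp (Real.tendsto_log_atTop.comp
      (tendsto_atTop_add_const_right _ _ tendsto_natCast_atTop_atTop))
  have h2 : Tendsto (fun n => Real.log ((S.deltaS n)⁻¹ + 1)) atTop atTop := by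
    refine Real.tendsto_log_atTop.comp (tendsto_atTop_add_const_right _ _ ?_)
    exact tendsto_inv_nhdsGT_zero.comp (tendsto_nhdsWithin_iff.2
      ⟨hS.deltaS_zero, Eventually.of_forall hS.deltaS_pos⟩)
  refine tendsto_atTop.2 fun b => ?_
  filter_upwards [h1.eventually_ge_atTop b, h2.eventually_ge_atTop b] with n h3 h4
  exact le_min h3 h4

/-- The logarithm in M_n was chosen for this: log y ≤ 2√y at y = 1/δ_{s,n} + 1 gives M_n δ_{s,n} ≤
2√(δ_{s,n}² + δ_{s,n}). -/
lemma Basic.tendsto_Mn_mul_deltaS (hS : S.Basic) :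
    Tendsto (fun n => S.Mn n * S.deltaS n) atTop (𝓝 0) := by
  have hlim : Tendsto (fun n => 2 * √(S.deltaS n ^ 2 + S.deltaS n)) atTop (𝓝 0) := by
    have h := ((hS.deltaS_zero.pow 2).add hS.deltaS_zero).sqrt.const_mul 2
    simpa using h
  refine tendsto_of_tendsto_of_tendsto_of_le_of_le' tendsto_const_nhds hlim ?_ ?_
  · filter_upwards [hS.tendsto_Mn.eventually_ge_atTop 0] with n hn
    exact mul_nonneg hn (hS.deltaS_pos n).le
  · refine Eventually.of_forall fun n => ?_
    have hd := hS.deltaS_pos n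
    have h1 : 0 < (S.deltaS n)⁻¹ + 1 := by positivity
    have h2 : S.Mn n ≤ 2 * √((S.deltaS n)⁻¹ + 1) := by
      refine (min_le_right _ _).trans ?_
      have := Real.log_le_sub_one_of_pos (Real.sqrt_pos.2 h1)
      rw [Real.log_sqrt h1.le] at this
      linarith
    have h3 : √(S.deltaS n ^ 2 + S.deltaS n) = √((S.deltaS n)⁻¹ + 1) * S.deltaS n := by
      rw [show S.deltaS n ^ 2 + S.deltaS n = ((S.deltaS n)⁻¹ + 1) * S.deltaS n ^ 2 by
        field_simp; ring, Real.sqrt_mul h1.le, Real.sqrt_sq hd.le]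
    calc S.Mn n * S.deltaS n ≤ 2 * √((S.deltaS n)⁻¹ + 1) * S.deltaS n :=
          mul_le_mul_of_nonneg_right h2 hd.le
      _ = _ := by rw [h3]; ring

lemma Basic.Q_nonneg (hS : S.Basic) (P : ProbabilityMeasure (𝒳 × 𝒴)) (α : Par dθ H) :
    0 ≤ S.Q P α :=
  integral_nonneg fun x => posDef_dotProduct_inv_nonneg (hS.sigma_pos x) _

variable {β : ℕ → Par dθ H} {P : ℕ → ProbabilityMeasure (𝒳 × 𝒴)} {c₀ c₁ cs : ℝ}

lemma Dgp.delta_ge (hD : S.Dgp β P c₀) {e : ℕ → ℝ} (he : SmallInv e) :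
    ∀ᶠ n in atTop, S.Q (P n) (S.Pi n (β n)) ≤ S.delta n ^ 2 ∧ S.lam n ≤ S.delta n ^ 2 ∧
      e n ≤ S.delta n ^ 2 := by
  filter_upwards [hD.delta_dom e he] with n hn
  rw [max_eq_iff] at hn
  have h : max (S.delta n ^ 2) (S.Q (P n) (S.Pi n (β n))) ≤ S.delta n ^ 2 ∧
      max (S.lam n) (e n) ≤ S.delta n ^ 2 := by
    rcases hn with ⟨h1, h2⟩ | ⟨h1, h2⟩
    · exact ⟨h1.le, h2.trans h1.le⟩
    · exact ⟨h2.trans h1.le, h1.le⟩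
  exact ⟨(le_max_right _ _).trans h.1, (le_max_left _ _).trans h.2, (le_max_right _ _).trans h.2⟩

/-- The rate `δ_n` is not faster than the parametric one. -/
lemma Dgp.exists_le_nat_mul_delta_sq (hS : S.Basic) (hD : S.Dgp β P c₀) :
    ∃ c : ℝ, 0 < c ∧ ∀ᶠ n : ℕ in atTop, c ≤ n * S.delta n ^ 2 := by
  by_contra! hcon
  set a : ℕ → ℝ := fun n => n * S.delta n ^ 2 with ha
  have ha0 : ∀ n, 0 ≤ a n := fun n => by positivity
  have hcl : MapClusterPt 0 atTop a := by
    rw [mapClusterPt_iff_frequently]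
    intro s hs
    obtain ⟨ε, hε, hεs⟩ := Metric.mem_nhds_iff.1 hs
    refine (hcon ε hε).mono fun n hn => hεs ?_
    rw [Metric.mem_ball, dist_zero_right, Real.norm_eq_abs, abs_of_nonneg (ha0 n)]
    exact hn
  obtain ⟨x, hx0, hx⟩ := hcl.tendsto_subseq
  classical
  -- If nδ_n² had 0 as a cluster point, then 2δ_n² along a subsequence, and 0 elsewhere, would be
  -- o(1/n) without being dominated by δ_n².
  set e : ℕ → ℝ := fun n => if n ∈ Set.range x then 2 * S.delta n ^ 2 else 0 with he
  have hsmall : SmallInv e := by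
    rw [SmallInv, Metric.tendsto_nhds]
    intro ε hε
    have h1 := hx.eventually (Metric.ball_mem_nhds 0 (half_pos hε))
    obtain ⟨K, hK⟩ := eventually_atTop.1 h1
    have h2 : ∀ᶠ n in atTop, ∀ k ∈ Finset.range K, x k < n := by
      rw [eventually_all_finset]
      exact fun k _ => eventually_gt_atTop _
    filter_upwards [h2] with n hn
    by_cases hmem : n ∈ Set.range x
    · obtain ⟨k, rfl⟩ := hmem
      have hk : K ≤ k := by
        by_contra hlt
        exact lt_irrefl _ (hn k (Finset.mem_range.2 (not_le.1 hlt)))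
      have := hK k hk
      simp only [Function.comp, dist_zero_right, Real.norm_eq_abs,
        abs_of_nonneg (ha0 _), a] at this
      simp only [he, Set.mem_range_self, if_true, dist_zero_right, Real.norm_eq_abs]
      rw [abs_of_nonneg (by positivity)]
      linarith
    · simp only [he, if_neg hmem, mul_zero, dist_self]; exact hε
  obtain ⟨k, hk⟩ := (hx0.tendsto_atTop.eventually (hD.delta_ge hsmall)).exists
  have h3 := hk.2.2
  simp only [he, Set.mem_range_self, if_true] at h3
  have := pow_pos (hS.delta_pos (x k)) 2
  linarith

/-- Multiples of `n^{-1/2}` belong to `T_n`. -/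
lemma Dgp.eventually_mem_Tn (hS : S.Basic) (hD : S.Dgp β P c₀) (R : ℝ) :
    ∀ᶠ n : ℕ in atTop, ∀ τ : ℝ, |τ| ≤ R → τ / √n ∈ S.Tn n := by
  obtain ⟨c, hc, hcn⟩ := hD.exists_le_nat_mul_delta_sq hS
  -- Since √n δ_n ≥ √c eventually, the radius of T_n scaled by √n is at least 4M_n²√c, which
  -- diverges.
  have hlim : Tendsto (fun n => 4 * S.Mn n ^ 2 * √c) atTop atTop :=
    (((tendsto_pow_atTop two_ne_zero).comp hS.tendsto_Mn).const_mul_atTop four_pos).atTop_mul_const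
      (Real.sqrt_pos.2 hc)
  filter_upwards [hcn, hlim.eventually_ge_atTop R, eventually_gt_atTop 0] with n h1 h2 hn τ hτ
  have hn' : 0 < √(n : ℝ) := Real.sqrt_pos.2 (by exact_mod_cast hn)
  have hd := (hS.delta_pos n).le
  have h3 : √c ≤ √n * S.delta n := by
    rw [← Real.sqrt_sq hd, ← Real.sqrt_mul (Nat.cast_nonneg n)]
    exact Real.sqrt_le_sqrt h1
  show |τ / √n| ≤ 4 * S.Mn n ^ 2 * S.delta n
  rw [abs_div, abs_of_pos hn', div_le_iff₀ hn']
  have : 4 * S.Mn n ^ 2 * √c ≤ 4 * S.Mn n ^ 2 * (√n * S.delta n) :=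
    mul_le_mul_of_nonneg_left h3 (by positivity)
  linarith

/-! Consistency -/

/-- Points of bounded penalty with small population criterion lie near the null parameter. -/
lemma Dgp.exists_mem_Aos (hS : S.Basic) (hD : S.Dgp β P c₀)
    (hD₀ : S.Dgp (fun _ => S.alpha0) (fun _ => S.P0) c₁) :
    ∃ r : ℝ, 0 < r ∧ ∀ᶠ n in atTop, ∀ α ∈ S.AkM n, S.Q (P n) α < r → α ∈ S.Aos := by
  obtain ⟨ε, hε, hεA⟩ := hS.aos_nhd
  set K : Set (Par dθ H) := (S.Theta ×ˢ {h | S.Pen h ≤ ENNReal.ofReal S.M0}) ∩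
    {α | ε ≤ normS (α - S.alpha0)} with hK
  have hKc : IsCompact K := (hS.theta_compact.prod (hS.pen_compact S.M0)).inter_right
    (isClosed_le continuous_const (continuous_normS.comp (by fun_prop)))
  have hmain : ∃ r : ℝ, 0 < r ∧ ∀ᶠ n in atTop, ∀ α ∈ K, α ∈ S.A → r ≤ S.Q (P n) α := by
    -- Away from α₀ the criterion of the null model is positive by identification, and lower
    -- semicontinuity along the sequence keeps half of it on a small ball for all large n.
    -- Compactness makes the bound uniform.
    refine hKc.induction_on
      (p := fun s => ∃ r : ℝ, 0 < r ∧ ∀ᶠ n in atTop, ∀ α ∈ s, α ∈ S.A → r ≤ S.Q (P n) α)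
      ⟨1, one_pos, by simp⟩ ?_ ?_ ?_
    · rintro s t hst ⟨r, hr, h⟩
      exact ⟨r, hr, h.mono fun n hn α hα => hn α (hst hα)⟩
    · rintro s t ⟨r, hr, h⟩ ⟨r', hr', h'⟩
      refine ⟨min r r', lt_min hr hr', ?_⟩
      filter_upwards [h, h'] with n hn hn' α hα hA
      rcases hα with hα | hα
      · exact (min_le_left _ _).trans (hn α hα hA)
      · exact (min_le_right _ _).trans (hn' α hα hA)
    · intro α hα
      have hαA : α ∈ S.A := hα.1.1
      have hαne : α ≠ S.alpha0 := by
        rintro rfl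
        have h0 : ε ≤ normS (S.alpha0 - S.alpha0) := hα.2
        rw [sub_self] at h0
        have : normS (0 : Par dθ H) = 0 := by simp [normS]
        linarith
      have hpos : 0 < S.Q S.P0 α := by
        refine lt_of_le_of_ne (hS.Q_nonneg _ _) fun h0 => hαne ?_
        refine (hD₀.ident 0 α hαA).1 ?_
        have h1 := (integral_eq_zero_iff_of_nonneg
          (fun x => posDef_dotProduct_inv_nonneg (hS.sigma_pos x) _) (hD₀.q_int 0 α hαA)).1 h0.symm
        filter_upwards [h1] with x hx
        by_contra hne
        exact (posDef_dotProduct_inv_pos (hS.sigma_pos x) hne).ne' hx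
      obtain ⟨ε', hε', hl⟩ := hD.lsc α hαA (S.Q S.P0 α / 2) (half_pos hpos)
      refine ⟨{α' | normS (α' - α) < ε'}, mem_nhdsWithin_of_mem_nhds ?_,
        S.Q S.P0 α / 2, half_pos hpos, ?_⟩
      · refine (isOpen_lt (continuous_normS.comp (by fun_prop)) continuous_const).mem_nhds ?_
        show normS (α - α) < ε'
        rw [sub_self]
        simpa [normS] using hε'
      · filter_upwards [hl] with n hn α' hα' hA
        have := hn α' hA hα'
        linarith
  obtain ⟨r, hr, h⟩ := hmain
  refine ⟨r, hr, ?_⟩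
  filter_upwards [h] with n hn α hα hQ
  refine hεA ⟨hα.1.1, ?_, hα.2⟩
  by_contra hge
  exact absurd (hn α ⟨⟨hα.1.1, hα.2⟩, not_lt.1 hge⟩ hα.1.1) (not_le.2 hQ)

/-! Convergence rates -/

variable (S) in
/-- The parameters `β n` approach the null parameter along the sieve tangent space, strictly
within the neighbourhoods `N_os`. -/
structure NearNull (β : ℕ → Par dθ H) : Prop where
  mem : ∀ᶠ n in atTop, β n - S.alpha0 ∈ S.Vk n
  rate : ∃ ϑ : ℝ, ϑ < 1 ∧ ∀ᶠ n in atTop,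
    S.nrm (β n - S.alpha0) ≤ ϑ * (S.Mn n * S.delta n) ∧
      normS (β n - S.alpha0) ≤ ϑ * (S.Mn n * S.deltaS n)

/-- The penalty bound M₀ of the projection is read off from the condition that M₀ is large;
closeness to α₀ combines the sieve error with the distance of β n from α₀. -/
lemma Dgp.eventually_proj_mem (hS : S.Basic) (hD : S.Dgp β P c₀) (hβ : S.NearNull β) :
    ∀ᶠ n in atTop, S.Pi n (β n) ∈ S.Aosn n := by
  obtain ⟨ε, hε, hεA⟩ := hS.aos_nhd
  obtain ⟨ϑ, -, hϑ'⟩ := hβ.rate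
  have hlim : Tendsto (fun n => ‖S.proj n (β n).2 - (β n).2‖ + ϑ * (S.Mn n * S.deltaS n))
      atTop (𝓝 0) := by
    simpa using hD.proj_tendsto.add (hS.tendsto_Mn_mul_deltaS.const_mul ϑ)
  filter_upwards [hϑ', hlim.eventually_lt_const hε, hD.m0_large] with n h1 h2 h3
  have hA : S.Pi n (β n) ∈ S.A := hD.true_mem n
  refine ⟨hεA ⟨hA, ?_, le_add_self.trans h3⟩, hA, hD.proj_mem n⟩
  have h4 : S.Pi n (β n) - S.alpha0 = (S.Pi n (β n) - β n) + (β n - S.alpha0) := by abel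
  have h5 : normS (S.Pi n (β n) - β n) = ‖S.proj n (β n).2 - (β n).2‖ := by
    simp [normS, Pi]
  rw [h4]
  refine (normS_add_le _ _).trans_lt ?_
  rw [h5]
  linarith [h1.2]

/-- Local parameters with population criterion of order `δ_n²` lie in `N_osn`. -/
lemma Dgp.eventually_mem_Nosn (hS : S.Basic) (hR : S.Riesz) (hD : S.Dgp β P c₀)
    (hβ : S.NearNull β) (K : ℝ) : ∀ᶠ n in atTop, ∀ α ∈ S.Aosn n,
      S.Q (P n) α ≤ K * S.delta n ^ 2 → α ∈ S.Nosn n := by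
  obtain ⟨ϑ, hϑ, hϑ'⟩ := hβ.rate
  obtain ⟨c, _, hc, hcur⟩ := hD.curvature
  obtain ⟨C, hC⟩ := hD.strong_rate
  set K₁ := √(|K| / c)
  set K₂ := √(1 / c)
  set K₃ := (K₁ + K₂) * |C| + |C|
  have hK₁ : 0 ≤ K₁ := Real.sqrt_nonneg _
  have hK₂ : 0 ≤ K₂ := Real.sqrt_nonneg _
  -- The true parameter uses only the fraction ϑ of the radius of N_os, so (1 - ϑ)M_n → ∞ is left
  -- for the constants of the weak rate `K₁` and of the strong rate `K₃`.
  have hMn := hS.tendsto_Mn.const_mul_atTop (sub_pos.2 hϑ)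
  filter_upwards [hϑ', hcur, hC, hD.eventually_proj_mem hS hβ, hD.delta_ge hS.eta_small,
    hMn.eventually_ge_atTop (K₁ + K₃ + 1), hR.vk_eq, hR.vk_le, hR.nrm_definite, hβ.mem]
    with n hϑn hcn hCn hPn hdn hMnn hVeq hVle hdef hβn α hα hQ
  have hδ := hS.delta_pos n
  have hδS := hS.deltaS_pos n
  have hVα : α - S.alpha0 ∈ S.V := sub_mem_V hα.1
  have hVβ : β n - S.alpha0 ∈ S.V := hVle hβn
  have hVP : S.Pi n (β n) - S.alpha0 ∈ S.V := sub_mem_V hPn.1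
  have hVαβ : α - β n ∈ S.V := by simpa using S.V.sub_mem hVα hVβ
  have hVPβ : S.Pi n (β n) - β n ∈ S.V := by simpa using S.V.sub_mem hVP hVβ
  have hroot : ∀ (α' : Par dθ H) (k : ℝ), 0 ≤ k → α' ∈ S.Aos →
      S.Q (P n) α' ≤ k * S.delta n ^ 2 → S.nrm (α' - β n) ≤ √(k / c) * S.delta n := by
    intro α' k hk hα' hQ'
    refine abs_le_of_sq_le_sq' ?_ (by positivity) |>.2
    rw [mul_pow, Real.sq_sqrt (by positivity), div_mul_eq_mul_div, le_div_iff₀ hc]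
    linarith [(hcn α' hα').1]
  have h1 : S.nrm (α - β n) ≤ K₁ * S.delta n := hroot α |K| (abs_nonneg K) hα.1
    (hQ.trans (mul_le_mul_of_nonneg_right (le_abs_self K) (sq_nonneg _)))
  have h2 : S.nrm (S.Pi n (β n) - β n) ≤ K₂ * S.delta n :=
    hroot _ 1 zero_le_one hPn.1 (by rw [one_mul]; exact hdn.1)
  have h3 : S.nrm (α - S.Pi n (β n)) ≤ (K₁ + K₂) * S.delta n := by
    have := hS.nrm_sub_le hVαβ hVPβ
    rw [sub_sub_sub_cancel_right] at this
    linarith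
  have hCn' : ENNReal.ofReal (C * S.deltaS n) ≤ ENNReal.ofReal (|C| * S.deltaS n) :=
    ENNReal.ofReal_le_ofReal (mul_le_mul_of_nonneg_right (le_abs_self C) hδS.le)
  have h4 : normS (α - S.Pi n (β n)) ≤ (K₁ + K₂) * |C| * S.deltaS n := by
    -- Points at weak distance zero are excluded from the supremum `tau`; on the sieve tangent space
    -- the weak norm is definite, so there the difference is zero.
    rcases eq_or_ne (S.nrm (α - S.Pi n (β n))) 0 with h0 | h0
    · have hmem : α - S.Pi n (β n) ∈ S.Vk n := by
        rw [hVeq]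
        exact ⟨trivial, (S.sieve (S.k n)).sub_mem hα.2.2 hPn.2.2⟩
      rw [hdef _ hmem h0]
      have : normS (0 : Par dθ H) = 0 := by simp [normS]
      rw [this]; positivity
    · have hτ : ENNReal.ofReal (normS (α - S.Pi n (β n)) / S.nrm (α - S.Pi n (β n))) ≤
          S.tau n (S.Pi n (β n)) := by
        unfold tau
        exact le_iSup₂_of_le α hα (le_iSup_of_le h0 le_rfl)
      have hpos : 0 < S.nrm (α - S.Pi n (β n)) := lt_of_le_of_ne (nrm_nonneg _) h0.symm
      have h5 : ENNReal.ofReal (normS (α - S.Pi n (β n))) ≤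
          ENNReal.ofReal ((K₁ + K₂) * |C| * S.deltaS n) := by
        calc ENNReal.ofReal (normS (α - S.Pi n (β n)))
            = ENNReal.ofReal (normS (α - S.Pi n (β n)) / S.nrm (α - S.Pi n (β n))) *
                ENNReal.ofReal (S.nrm (α - S.Pi n (β n))) := by
              rw [← ENNReal.ofReal_mul (div_nonneg (normS_nonneg _) hpos.le),
                div_mul_cancel₀ _ h0]
          _ ≤ S.tau n (S.Pi n (β n)) * ENNReal.ofReal ((K₁ + K₂) * S.delta n) :=
              mul_le_mul' hτ (ENNReal.ofReal_le_ofReal h3)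
          _ = ENNReal.ofReal (K₁ + K₂) *
                (S.tau n (S.Pi n (β n)) * ENNReal.ofReal (S.delta n)) := by
              rw [ENNReal.ofReal_mul (by positivity)]; ring
          _ ≤ ENNReal.ofReal (K₁ + K₂) * ENNReal.ofReal (|C| * S.deltaS n) :=
              mul_le_mul' le_rfl ((le_add_self.trans hCn).trans hCn')
          _ = _ := by rw [← ENNReal.ofReal_mul (by positivity), mul_assoc]
      exact (ENNReal.ofReal_le_ofReal_iff (by positivity)).1 h5
  have h6 : normS (S.Pi n (β n) - β n) ≤ |C| * S.deltaS n := by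
    have h7 : normS (S.Pi n (β n) - β n) = ‖(β n).2 - S.proj n (β n).2‖ := by
      rw [norm_sub_rev]; simp [normS, Pi]
    rw [h7]
    exact (ENNReal.ofReal_le_ofReal_iff (by positivity)).1 ((le_self_add.trans hCn).trans hCn')
  have hnrm : S.nrm (α - S.alpha0) ≤ S.Mn n * S.delta n := by
    have h8 := hS.nrm_add_le hVαβ hVβ
    rw [sub_add_sub_cancel] at h8
    have h9 : (K₁ + K₃ + 1) * S.delta n ≤ (1 - ϑ) * S.Mn n * S.delta n :=
      mul_le_mul_of_nonneg_right hMnn hδ.le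
    have h10 : 0 ≤ (K₃ + 1) * S.delta n := by positivity
    linarith [hϑn.1]
  have hstrong : normS (α - S.alpha0) ≤ S.Mn n * S.deltaS n := by
    have h8 : normS (α - S.alpha0) ≤ normS (α - S.Pi n (β n)) + normS (S.Pi n (β n) - β n) +
        normS (β n - S.alpha0) := by
      have e : α - S.alpha0 = (α - S.Pi n (β n)) + (S.Pi n (β n) - β n) + (β n - S.alpha0) := by
        abel
      rw [e]
      exact (normS_add_le _ _).trans (add_le_add_left (normS_add_le _ _) _)
    have h9 : (K₁ + K₃ + 1) * S.deltaS n ≤ (1 - ϑ) * S.Mn n * S.deltaS n :=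
      mul_le_mul_of_nonneg_right hMnn hδS.le
    have h10 : 0 ≤ (K₁ + 1) * S.deltaS n := by positivity
    have h11 : K₃ * S.deltaS n = (K₁ + K₂) * |C| * S.deltaS n + |C| * S.deltaS n := by ring
    linarith [hϑn.2]
  exact ⟨⟨hα.2.1, hnrm, hstrong, (hS.aos_sub hα.1).2.2⟩, hα.2⟩

/-! Approximate minimizers -/

/-- Criterion and weighted penalty are both nonnegative and share the budget l M₀, so each is
bounded by it separately. -/
lemma pen_le_and_crit_le {q l X M₀ : ℝ} {p pe : ℝ≥0∞} (hl : 0 < l)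
    (h : ENNReal.ofReal q + ENNReal.ofReal l * pe ≤ ENNReal.ofReal X + ENNReal.ofReal l * p)
    (hM : ENNReal.ofReal (X / l) + p ≤ ENNReal.ofReal M₀) :
    pe ≤ ENNReal.ofReal M₀ ∧ q ≤ l * |M₀| := by
  have h1 : ENNReal.ofReal X + ENNReal.ofReal l * p ≤ ENNReal.ofReal l * ENNReal.ofReal M₀ := by
    calc ENNReal.ofReal X + ENNReal.ofReal l * p
        = ENNReal.ofReal l * (ENNReal.ofReal (X / l) + p) := by
          rw [mul_add, ← ENNReal.ofReal_mul hl.le, mul_div_cancel₀ _ hl.ne']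
      _ ≤ _ := mul_le_mul' le_rfl hM
  have hl0 : ENNReal.ofReal l ≠ 0 := (ENNReal.ofReal_pos.2 hl).ne'
  refine ⟨(ENNReal.mul_le_mul_iff_right hl0 ENNReal.ofReal_ne_top).1
    ((le_add_self.trans h).trans h1), ?_⟩
  have h2 : ENNReal.ofReal q ≤ ENNReal.ofReal (l * |M₀|) := by
    refine ((le_self_add.trans h).trans h1).trans ?_
    rw [← ENNReal.ofReal_mul hl.le]
    exact ENNReal.ofReal_le_ofReal (mul_le_mul_of_nonneg_left (le_abs_self _) hl.le)
  exact (ENNReal.ofReal_le_ofReal_iff (by positivity)).1 h2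

/-- The penalized criterion at an approximate minimizer over the sieve space. -/
lemma Dgp.eventually_est_le (hS : S.Basic) (hD : S.Dgp β P c₀) :
    ∀ᶠ i in wpF P, S.est i.1 i.2 ∈ S.Ak i.1 ∧
      ENNReal.ofReal (S.QHat i.1 i.2 (S.est i.1 i.2)) +
          ENNReal.ofReal (S.lam i.1) * S.Pen (S.est i.1 i.2).2 ≤
        ENNReal.ofReal (c₀ * S.Q (P i.1) (S.Pi i.1 (β i.1)) + 2 * S.eta i.1) +
          ENNReal.ofReal (S.lam i.1) * S.Pen (S.proj i.1 (β i.1).2) := by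
  filter_upwards [hD.est_min.eventually, hD.crit_upper.eventually] with ⟨n, z⟩ h1 h2
  refine ⟨h1.1, (h1.2 (S.Pi n (β n)) ⟨hD.true_mem n, hD.proj_mem n⟩).trans ?_⟩
  have hη := hS.eta_nonneg n
  have hQ := mul_nonneg hD.c₀_pos.le (hS.Q_nonneg (P n) (S.Pi n (β n)))
  rw [add_right_comm, two_mul, ← add_assoc, ENNReal.ofReal_add (by positivity) hη]
  exact add_le_add_left (add_le_add_left (ENNReal.ofReal_le_ofReal h2) _) _

/-- Comparison with the projected truth bounds the criterion by λ_n|M₀|, and λ_n ≤ δ_n² by the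
choice of δ_n. -/
lemma Dgp.eventually_est_mem_AkM (hS : S.Basic) (hD : S.Dgp β P c₀) :
    ∀ᶠ i in wpF P, S.est i.1 i.2 ∈ S.AkM i.1 ∧
      S.QHat i.1 i.2 (S.est i.1 i.2) ≤ |S.M0| * S.delta i.1 ^ 2 := by
  filter_upwards [hD.eventually_est_le hS, (tendsto_fst_wpF P).eventually hD.m0_large,
    (tendsto_fst_wpF P).eventually (hD.delta_ge hS.eta_small)] with ⟨n, z⟩ h1 h2 h3
  obtain ⟨h4, h5⟩ := pen_le_and_crit_le (hS.lam_pos n) h1.2 h2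
  refine ⟨⟨h1.1, h4⟩, h5.trans ?_⟩
  rw [mul_comm]
  exact mul_le_mul_of_nonneg_left h3.2.1 (abs_nonneg _)

/-- The estimator lies in `N_osn` with probability approaching one. -/
lemma Dgp.eventually_est_mem_Nosn (hS : S.Basic) (hR : S.Riesz)
    (hD : S.Dgp β P c₀) (hD₀ : S.Dgp (fun _ => S.alpha0) (fun _ => S.P0) c₁)
    (hβ : S.NearNull β) : ∀ᶠ i in wpF P, S.est i.1 i.2 ∈ S.Nosn i.1 := by
  obtain ⟨r, hr, hcons⟩ := hD.exists_mem_Aos hS hD₀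
  -- The global lower bound, with its slower rate, only makes the population criterion small; that
  -- is enough for consistency.
  have hAos : ∀ᶠ i in wpF P, S.est i.1 i.2 ∈ S.Aosn i.1 := by
    obtain ⟨c, hc, hlow⟩ := hD.crit_lower
    refine eventually_wpF_of_tight (E := fun M n z => ∀ α ∈ S.AkM n,
      c * S.Q (P n) α - M * S.deltaBar n ^ 2 ≤ S.QHat n z α) ?_ fun M => ?_
    · simpa only [not_forall, not_le, exists_prop] using hlow
    · rw [eventually_inf_principal]
      have hlim : Tendsto (fun n => |S.M0| * S.delta n ^ 2 + M * S.deltaBar n ^ 2) atTop (𝓝 0) := by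
        simpa using ((hS.delta_zero.pow 2).const_mul |S.M0|).add
          ((hS.deltaBar_zero.pow 2).const_mul M)
      filter_upwards [hD.eventually_est_mem_AkM hS, (tendsto_fst_wpF P).eventually hcons,
        (tendsto_fst_wpF P).eventually (hlim.eventually_lt_const (mul_pos hc hr))]
        with ⟨n, z⟩ h1 h2 h3 h4
      refine ⟨h2 _ h1.1 ?_, h1.1.1⟩
      have h5 := h4 _ h1.1
      refine lt_of_mul_lt_mul_left ?_ hc.le
      simp only at h1 h3 h5 ⊢
      linarith [h1.2]
  -- Once in A_os, the local lower bound improves this to order δ_n², as the rate lemma requires.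
  obtain ⟨c, hc, hlow⟩ := hD.crit_local
  refine eventually_wpF_of_tight (E := fun M n z => ∀ α ∈ S.Aosn n,
    c * S.Q (P n) α - M * S.delta n ^ 2 ≤ S.QHat n z α) ?_ fun M => ?_
  · simpa only [not_forall, not_le, exists_prop] using hlow
  · rw [eventually_inf_principal]
    filter_upwards [hD.eventually_est_mem_AkM hS, hAos, (tendsto_fst_wpF P).eventually
      (hD.eventually_mem_Nosn hS hR hβ ((|S.M0| + M) / c))] with ⟨n, z⟩ h1 h2 h3 h4
    refine h3 _ h2 ?_
    have h5 := h4 _ h2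
    simp only at h1 h5 ⊢
    rw [div_mul_eq_mul_div, le_div_iff₀ hc]
    linarith [h1.2]

end Setting

namespace Bootstrap

open Setting

variable {β : ℕ → Par dθ H} {P : ℕ → ProbabilityMeasure (𝒳 × 𝒴)} {c₀ c₁ cs : ℝ}

/-- Approximate minimizers of the bootstrap criterion over sets that contain the estimator have
bounded penalty and a small criterion. -/
lemma Crit.eventually_mem_AkM (hS : S.Basic) (hD : S.Dgp β P c₀) (hC : T.Crit S β P c₀ cs)
    {a : (Σ n, Sample n 𝒳 𝒴 × Ω) → Par dθ H} {A : (Σ n, Sample n 𝒳 𝒴 × Ω) → Set (Par dθ H)}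
    (ha : ∀ᶠ i in bwF P T.PΩ, ApproxMin (T.QHatB S i.1 i.2.1 i.2.2) S.Pen (S.lam i.1)
      (S.eta i.1) (A i) (a i))
    (hA : ∀ i, A i ⊆ S.Ak i.1)
    (hmem : ∀ i, S.est i.1 i.2.1 ∈ S.Ak i.1 → S.est i.1 i.2.1 ∈ A i) :
    ∀ᶠ i in bwF P T.PΩ, a i ∈ S.AkM i.1 ∧
      T.QHatB S i.1 i.2.1 i.2.2 (a i) ≤ |S.M0| * S.delta i.1 ^ 2 := by
  filter_upwards [ha, hC.crit_upper.eventually,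
    (tendsto_bwF_wpF P T.PΩ).eventually (hD.eventually_est_le hS),
    (tendsto_fst_bwF P T.PΩ).eventually hC.m0_large,
    (tendsto_fst_bwF P T.PΩ).eventually (hD.delta_ge hS.eta_small)] with i h1 h2 h3 h4 h5
  obtain ⟨n, z, w⟩ := i
  simp only at h1 h2 h3 h4 h5 ⊢
  have hη := hS.eta_nonneg n
  have hq : 0 ≤ S.QHat n z (S.est n z) := hS.QHatW_nonneg _ _ _ _
  have hQ := mul_nonneg hD.c₀_pos.le (hS.Q_nonneg (P n) (S.Pi n (β n)))
  set q := S.QHat n z (S.est n z)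
  set cb := max 1 cs
  have hcb : 1 ≤ cb := le_max_left _ _
  -- The estimator is feasible, so it serves as comparison point, and its own inequality is
  -- multiplied by `cb`: `cs ≤ cb` handles the criterion, `1 ≤ cb` the penalty.
  have hle : ENNReal.ofReal (T.QHatB S n z w (a ⟨n, z, w⟩)) +
      ENNReal.ofReal (S.lam n) * S.Pen (a ⟨n, z, w⟩).2 ≤
      ENNReal.ofReal (cb * (c₀ * S.Q (P n) (S.Pi n (β n)) + 2 * S.eta n) + 2 * S.eta n) +
        ENNReal.ofReal (S.lam n) * (ENNReal.ofReal cb * S.Pen (S.proj n (β n).2)) := by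
    calc _ ≤ ENNReal.ofReal (T.QHatB S n z w (S.est n z)) +
          ENNReal.ofReal (S.lam n) * S.Pen (S.est n z).2 + ENNReal.ofReal (S.eta n) :=
        h1.2 _ (hmem ⟨n, z, w⟩ h3.1)
      _ ≤ ENNReal.ofReal (cb * q + S.eta n) +
          ENNReal.ofReal cb * (ENNReal.ofReal (S.lam n) * S.Pen (S.est n z).2) +
          ENNReal.ofReal (S.eta n) := by
        refine add_le_add_left (add_le_add (ENNReal.ofReal_le_ofReal (h2.trans ?_)) ?_) _
        · exact add_le_add_left (mul_le_mul_of_nonneg_right (le_max_right _ _) hq) _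
        · refine le_mul_of_one_le_left' ?_
          rw [← ENNReal.ofReal_one]
          exact ENNReal.ofReal_le_ofReal hcb
      _ = ENNReal.ofReal cb * (ENNReal.ofReal q +
            ENNReal.ofReal (S.lam n) * S.Pen (S.est n z).2) + ENNReal.ofReal (2 * S.eta n) := by
        rw [ENNReal.ofReal_add (by positivity) hη, ENNReal.ofReal_mul (by positivity), two_mul,
          ENNReal.ofReal_add hη hη]
        ring
      _ ≤ ENNReal.ofReal cb * (ENNReal.ofReal (c₀ * S.Q (P n) (S.Pi n (β n)) + 2 * S.eta n) +
          ENNReal.ofReal (S.lam n) * S.Pen (S.proj n (β n).2)) + ENNReal.ofReal (2 * S.eta n) :=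
        add_le_add_left (mul_le_mul' le_rfl h3.2) _
      _ = _ := by
        rw [ENNReal.ofReal_add (p := cb * _) (by positivity) (by positivity),
          ENNReal.ofReal_mul (p := cb) (by positivity)]
        ring
  obtain ⟨h6, h7⟩ := pen_le_and_crit_le (hS.lam_pos n) hle h4
  refine ⟨⟨hA _ h1.1, h6⟩, h7.trans ?_⟩
  rw [mul_comm]
  exact mul_le_mul_of_nonneg_left h5.2.1 (abs_nonneg _)

/-- Approximate minimizers of the bootstrap criterion over sets that contain the estimator lie
in `N_osn`. -/
lemma Crit.eventually_mem_Nosn (hS : S.Basic) (hR : S.Riesz)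
    (hD : S.Dgp β P c₀) (hD₀ : S.Dgp (fun _ => S.alpha0) (fun _ => S.P0) c₁)
    (hβ : S.NearNull β) (hC : T.Crit S β P c₀ cs)
    {a : (Σ n, Sample n 𝒳 𝒴 × Ω) → Par dθ H}
    (ha : ∀ᶠ i in bwF P T.PΩ, a i ∈ S.AkM i.1 ∧
      T.QHatB S i.1 i.2.1 i.2.2 (a i) ≤ |S.M0| * S.delta i.1 ^ 2) :
    ∀ᶠ i in bwF P T.PΩ, a i ∈ S.Nosn i.1 := by
  have hN := tendsto_fst_bwF P T.PΩ
  obtain ⟨r, hr, hcons⟩ := hD.exists_mem_Aos hS hD₀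
  -- A small bootstrap criterion forces a small sample criterion, which in turn forces a small
  -- population criterion; each passage has its own tight constant.
  have hq : ∀ r : ℝ, 0 < r → ∀ᶠ i in bwF P T.PΩ, S.QHat i.1 i.2.1 (a i) < r := by
    intro r hr
    obtain ⟨c, hc, hlow⟩ := hC.crit_lower
    refine eventually_bwF_of_tight (E := fun M n z w => ∀ α ∈ S.AkM n,
      c * S.QHat n z α - M * T.deltaStar n ^ 2 ≤ T.QHatB S n z w α) ?_ fun M => ?_
    · simpa only [not_forall, not_le, exists_prop] using hlow
    · rw [eventually_inf_principal]
      have hlim : Tendsto (fun n => |S.M0| * S.delta n ^ 2 + M * T.deltaStar n ^ 2) atTop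
          (𝓝 0) := by
        simpa using ((hS.delta_zero.pow 2).const_mul |S.M0|).add
          ((hC.deltaStar_zero.pow 2).const_mul M)
      filter_upwards [ha, hN.eventually (hlim.eventually_lt_const (mul_pos hc hr))] with i h1 h3 h4
      have h5 := h4 _ h1.1
      refine lt_of_mul_lt_mul_left ?_ hc.le
      linarith [h1.2]
  have hAos : ∀ᶠ i in bwF P T.PΩ, a i ∈ S.Aosn i.1 := by
    obtain ⟨c, hc, hlow⟩ := hD.crit_lower
    refine eventually_bwF_of_tight_wpF (E := fun M n z => ∀ α ∈ S.AkM n,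
      c * S.Q (P n) α - M * S.deltaBar n ^ 2 ≤ S.QHat n z α) ?_ fun M => ?_
    · simpa only [not_forall, not_le, exists_prop] using hlow
    · rw [eventually_inf_principal]
      have hlim : Tendsto (fun n => M * S.deltaBar n ^ 2) atTop (𝓝 0) := by
        simpa using (hS.deltaBar_zero.pow 2).const_mul M
      have hcr : 0 < c * r / 2 := by positivity
      filter_upwards [ha, hq _ hcr, hN.eventually hcons,
        hN.eventually (hlim.eventually_lt_const hcr)] with i h1 h2 h3 h4 h5
      refine ⟨h3 _ h1.1 ?_, h1.1.1⟩
      have h6 := h5 _ h1.1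
      refine lt_of_mul_lt_mul_left ?_ hc.le
      linarith
  obtain ⟨c, hc, hlow⟩ := hC.crit_local
  obtain ⟨c', hc', hlow'⟩ := hD.crit_local
  refine eventually_bwF_of_tight (E := fun M n z w => ∀ α ∈ S.Aosn n,
    c * S.QHat n z α - M * S.delta n ^ 2 ≤ T.QHatB S n z w α) ?_ fun M => ?_
  · simpa only [not_forall, not_le, exists_prop] using hlow
  rw [eventually_inf_principal]
  -- Two constants are frozen: `M` for the conditional law of the weights, `M'` for the law of the
  -- data. They add up to the constant of the rate lemma.
  refine eventually_bwF_of_tight_wpF (E := fun M n z => ∀ α ∈ S.Aosn n,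
    c' * S.Q (P n) α - M * S.delta n ^ 2 ≤ S.QHat n z α) ?_ fun M' => ?_
  · simpa only [not_forall, not_le, exists_prop] using hlow'
  rw [eventually_inf_principal]
  filter_upwards [ha, hAos, hN.eventually
    (hD.eventually_mem_Nosn hS hR hβ (((|S.M0| + M) / c + M') / c'))] with i h1 h2 h3 h4 h5
  refine h3 _ h2 ?_
  have h6 := h5 _ h2
  have h8 : S.QHat i.1 i.2.1 (a i) ≤ (|S.M0| + M) / c * S.delta i.1 ^ 2 := by
    rw [div_mul_eq_mul_div, le_div_iff₀ hc]
    linarith [h1.2]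
  rw [div_mul_eq_mul_div, le_div_iff₀ hc']
  linarith [h4 _ h2]

end Bootstrap

end Localization

/-! ### The Riesz direction, and the quadratic expansion of the likelihood ratio -/

section Expansion

variable {dθ dρ : ℕ} {𝒳 𝒴 H Ω : Type*} [MeasurableSpace 𝒳] [MeasurableSpace 𝒴]
  [NormedAddCommGroup H] [NormedSpace ℝ H]
  [MeasurableSpace Ω] {S : Setting dθ dρ 𝒳 𝒴 H} {T : Bootstrap dθ 𝒳 𝒴 H Ω}

namespace Setting

variable (S) in
/-- The scaled Riesz representers are well defined, with weak norm bounded away from zero and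
infinity. -/
structure ScaleBounds (c C : ℝ) : Prop where
  pos : 0 < c
  bounds : ∀ᶠ n in atTop, 0 < S.sd n ∧ S.u n ∈ S.Vk n ∧ c ≤ S.nrm (S.u n) ^ 2 ∧
    S.nrm (S.u n) ^ 2 ≤ C

lemma sd_nonneg (n : ℕ) : 0 ≤ S.sd n := Real.sqrt_nonneg _

/-- The derivative of the functional in terms of the scaled Riesz representer. -/
lemma Riesz.eventually_dphi_eq (hR : S.Riesz) {c C : ℝ} (hsc : S.ScaleBounds c C) :
    ∀ᶠ n in atTop, ∀ v ∈ S.Vk n, S.dphi v = S.sd n * S.ip (S.u n) v := by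
  filter_upwards [hR.vstar_riesz, hsc.bounds] with n h1 h2 v hv
  rw [h1 v hv, u, ip_smul_left, mul_inv_cancel_left₀ h2.1.ne']

/-! The scaled Riesz representer -/

/-- Nondegeneracy follows from the central limit theorem: if u_n were 0 then ℤ_n would vanish
identically, contradicting the positive limit probability of (-∞, -1]. Definiteness of the weak norm
then gives ‖v_n^*‖ > 0. -/
lemma LQA.eventually_sd_pos (hR : S.Riesz) {β : ℕ → Par dθ H}
    {P : ℕ → ProbabilityMeasure (𝒳 × 𝒴)} {B : ∀ n, Sample n 𝒳 𝒴 → ℝ} (hL : S.LQA β P B) :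
    ∀ᶠ n in atTop, 0 < S.sd n ∧ S.u n ∈ S.Vk n ∧ 0 < S.nrm (S.vstar n) := by
  have hpos : 0 < (gaussianReal 0 1).real (Set.Iic (-1)) :=
    (stdNormal_Icc_pos (a := -2) (b := -1) (by norm_num)).trans_le
      (measureReal_mono fun _ hx => hx.2)
  filter_upwards [(hL.clt (-1)).eventually_const_lt hpos, hR.vstar_mem, hR.nrm_definite]
    with n h1 h2 h3
  have hu : S.u n ≠ 0 := by
    intro h0
    have : {z | √(n : ℝ) * S.Zn n (β n) z ≤ -1} = ∅ := by
      ext z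
      simp [Zn, ZnW, score, h0]
    rw [this] at h1
    simp at h1
  have hsd : S.sd n ≠ 0 := fun h0 => hu (by simp [u, h0])
  have hv : S.vstar n ≠ 0 := fun h0 => hu (by simp [u, h0])
  exact ⟨lt_of_le_of_ne (Real.sqrt_nonneg _) hsd.symm, (S.Vk n).smul_mem _ h2,
    lt_of_le_of_ne (nrm_nonneg _) fun h0 => hv (h3 _ h2 h0.symm)⟩

variable [StandardBorelSpace 𝒴] [Nonempty 𝒴]

lemma Basic.nrm_u (hS : S.Basic) (n : ℕ) : S.nrm (S.u n) = S.nrm (S.vstar n) / S.sd n := by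
  rw [u, hS.nrm_smul, abs_of_nonneg (inv_nonneg.2 (sd_nonneg n)), inv_mul_eq_div]

/-- The lower bound is the variance bound divided by sd². The upper bound holds because ‖u_n‖² is
deterministic and close to the stochastically bounded `B`. -/
lemma LQA.exists_scaleBounds (hS : S.Basic) (hR : S.Riesz) {c₀ : ℝ}
    (hD : S.Dgp (fun _ => S.alpha0) (fun _ => S.P0) c₀) {B : ∀ n, Sample n 𝒳 𝒴 → ℝ}
    (hL : S.LQA (fun _ => S.alpha0) (fun _ => S.P0) B)
    (hB : SmallP (fun _ => S.P0) fun n z => B n z - S.nrm (S.u n) ^ 2) :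
    ∃ c C : ℝ, S.ScaleBounds c C := by
  obtain ⟨K, hK, hvar⟩ := hS.exists_variance_le hD
  obtain ⟨M, hM⟩ := hL.B_bdd (1 / 2) (by norm_num)
  have hB1 := wpa1_iff_real.1 (hB 1 one_pos) (1 / 4) (by norm_num)
  refine ⟨K⁻¹, M + 1, inv_pos.2 hK, ?_⟩
  filter_upwards [hL.eventually_sd_pos hR, hM, hB1, hR.vstar_mem, hR.vk_le]
    with n h1 h2 h3 h4 h5
  refine ⟨h1.1, h1.2.1, ?_, ?_⟩
  · have h6 := hvar (S.vstar n) (h5 h4)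
    have h7 : S.sd n ^ 2 = Var[S.score S.alpha0 (S.vstar n); (S.P0 : Measure (𝒳 × 𝒴))] :=
      Real.sq_sqrt (variance_nonneg _ _)
    have h8 := pow_pos h1.1 2
    rw [hS.nrm_u, div_pow, le_div_iff₀ h8, inv_mul_le_iff₀ hK, h7]
    exact h6
  · by_contra hlt
    -- If ‖u_n‖² exceeded M + 1, every sample would lie in one of two events of probabilities at
    -- most 1/2 and 1/4.
    have huniv : (Set.univ : Set (Sample n 𝒳 𝒴)) ⊆ {z | M < |B n z|} ∪
        {z | ¬ |B n z - S.nrm (S.u n) ^ 2| ≤ 1} := by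
      intro z _
      by_contra hz
      simp only [Set.mem_union, Set.mem_ofPred_eq, not_or, not_lt, not_not] at hz
      have e1 := (abs_le.1 hz.2).1
      have e2 := le_abs_self (B n z)
      linarith [hz.1]
    have h6 := (measure_mono huniv (μ := law S.P0 n)).trans
      ((measure_union_le _ _).trans (add_le_add h2 h3))
    rw [measure_univ, ← ENNReal.ofReal_add (by norm_num) (by norm_num), ← ENNReal.ofReal_one,
      ENNReal.ofReal_le_ofReal_iff (by norm_num)] at h6
    norm_num at h6

lemma Basic.eventually_Nosn_subset (hS : S.Basic) :
    ∀ᶠ n in atTop, S.Nosn n ⊆ S.Aosn n := by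
  obtain ⟨ε, hε, hεA⟩ := hS.aos_nhd
  filter_upwards [hS.tendsto_Mn_mul_deltaS.eventually_lt_const hε] with n hn α hα
  exact ⟨hεA ⟨hα.1.1, hα.1.2.2.1.trans_lt hn, hα.1.2.2.2⟩, hα.2⟩

/-- The functional is linear near the null parameter, on the scale of the sieve standard
deviation. -/
lemma PhiLocal.eventually_linear (hS : S.Basic) (hR : S.Riesz) (hφ : S.PhiLocal) {c C : ℝ}
    (hsc : S.ScaleBounds c C) {R ε : ℝ} (hε : 0 < ε)
    (hTn : ∀ᶠ n : ℕ in atTop, ∀ τ : ℝ, |τ| ≤ R → τ / √n ∈ S.Tn n) :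
    ∀ᶠ n : ℕ in atTop, ∀ α ∈ S.Nosn n, ∀ τ : ℝ, |τ| ≤ R →
      |√n * (S.phi (α + (τ / √n) • S.u n) - S.phi S.alpha0) / S.sd n -
        (√n * S.ip (S.u n) (α - S.alpha0) + τ * S.nrm (S.u n) ^ 2)| ≤ ε := by
  -- Nonlinearity and sieve bias each cost ε'‖v_n^*‖/sd = ε'‖u_n‖ ≤ ε'√C.
  set ε' := ε / (2 * (√C + 1)) with hε'
  have hC1 : 0 < √C + 1 := by positivity
  have hε'0 : 0 < ε' := by positivity
  filter_upwards [hTn, hφ.nonlin ε' hε'0, hφ.bias.eventually_lt_const hε'0, hsc.bounds,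
    hR.eventually_dphi_eq hsc, hR.alpha0n_min, hR.vk_eq, hR.vk_le, hS.eventually_Nosn_subset,
    eventually_gt_atTop 0]
    with n h1 h2 h3 h4 h5 h6 h7 h8 h9 hn α hα τ hτ
  have hn' : 0 < √(n : ℝ) := Real.sqrt_pos.2 (by exact_mod_cast hn)
  have hsd := h4.1
  have hα0 : α - S.alpha0 ∈ S.V := sub_mem_V (h9 hα).1
  have hα0n : α - S.alpha0n n ∈ S.Vk n := by
    rw [h7]; exact (S.Sn n).sub_mem ⟨trivial, hα.2.2⟩ (hR.alpha0n_mem n)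
  have h0n : S.alpha0n n - S.alpha0 ∈ S.V := by
    simpa using S.V.sub_mem hα0 (h8 hα0n)
  -- As α_{0,n} is the nearest sieve point to α₀, the approximation error is orthogonal to u_n. The
  -- Riesz identity, valid on the sieve tangent space only, thus gives ⟨u_n, α - α₀⟩ without a
  -- remainder.
  have horth : S.ip (S.u n) (S.alpha0n n - S.alpha0) = 0 := by
    rw [hS.ip_comm]
    refine hS.ip_eq_zero_of_min h0n (h8 h4.2.1) fun t => ?_
    have hmem : S.alpha0n n + t • S.u n ∈ S.Sn n :=
      (S.Sn n).add_mem (hR.alpha0n_mem n) ((S.Sn n).smul_mem _ (h7 ▸ h4.2.1))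
    have := h6 _ hmem
    rwa [add_sub_right_comm] at this
  have hlin : S.dphi (α + (τ / √n) • S.u n - S.alpha0) =
      S.sd n * (S.ip (S.u n) (α - S.alpha0) + τ / √n * S.nrm (S.u n) ^ 2) +
        S.dphi (S.alpha0n n - S.alpha0) := by
    have e1 : α + (τ / √n) • S.u n - S.alpha0 =
        (α - S.alpha0n n) + (τ / √n) • S.u n + (S.alpha0n n - S.alpha0) := by abel
    have e2 : α - S.alpha0n n = (α - S.alpha0) - (S.alpha0n n - S.alpha0) := by abel
    rw [e1, map_add, map_add, map_smul, h5 _ hα0n, h5 _ h4.2.1, smul_eq_mul, e2,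
      hS.ip_sub_right (h8 h4.2.1) hα0 h0n, horth, hS.nrm_sq]
    ring
  have hv : 0 < S.nrm (S.vstar n) := by
    have h10 : S.nrm (S.vstar n) = S.nrm (S.u n) * S.sd n := by
      rw [hS.nrm_u, div_mul_cancel₀ _ hsd.ne']
    have h11 : S.nrm (S.u n) ≠ 0 := fun h0 => by
      have h12 := h4.2.2.1
      rw [h0] at h12
      have := hsc.pos
      norm_num at h12
      linarith
    rw [h10]
    exact mul_pos (lt_of_le_of_ne (nrm_nonneg _) h11.symm) hsd
  have hnl := h2 α hα _ (h1 τ hτ)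
  rw [div_lt_iff₀ hv] at h3
  rw [hlin] at hnl
  have hv' : S.nrm (S.vstar n) / S.sd n ≤ √C := by
    rw [← hS.nrm_u]
    exact Real.le_sqrt_of_sq_le h4.2.2.2
  set A := S.phi (α + (τ / √n) • S.u n) - S.phi S.alpha0
  set D := S.dphi (S.alpha0n n - S.alpha0)
  set L := S.ip (S.u n) (α - S.alpha0)
  set b := S.nrm (S.u n) ^ 2
  have hid : √n * A / S.sd n - (√n * L + τ * b) =
      (√n * (A - (S.sd n * (L + τ / √n * b) + D)) + √n * D) / S.sd n := by
    field_simp; ring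
  rw [hid, abs_div, abs_of_pos hsd, div_le_iff₀ hsd]
  have h13 : |√n * (A - (S.sd n * (L + τ / √n * b) + D)) + √n * D| ≤
      2 * ε' * S.nrm (S.vstar n) := by
    refine (abs_add_le _ _).trans ?_
    rw [abs_mul, abs_mul, abs_of_pos hn']
    linarith
  refine h13.trans ?_
  rw [div_le_iff₀ hsd] at hv'
  have h14 : 2 * ε' * (√C + 1) = ε := by rw [hε']; field_simp
  calc 2 * ε' * S.nrm (S.vstar n) ≤ 2 * ε' * (√C * S.sd n) :=
        mul_le_mul_of_nonneg_left hv' (by positivity)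
    _ ≤ 2 * ε' * ((√C + 1) * S.sd n) := by gcongr; linarith
    _ = ε * S.sd n := by rw [← mul_assoc, h14]

/-! Comparison of penalized criteria -/

/-- Either λ_n = o(1/n) and the penalty is at most M₀ on A_os, or the oscillation of the penalty
there is itself negligible. -/
lemma Basic.exists_pen_le (hS : S.Basic) : ∃ e : ℕ → ℝ, SmallInv e ∧ ∀ᶠ n in atTop,
    ∀ α ∈ S.Aos, ∀ α' ∈ S.Aos, ENNReal.ofReal (S.lam n) * S.Pen α.2 ≤
      ENNReal.ofReal (S.lam n) * S.Pen α'.2 + ENNReal.ofReal (e n) := by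
  rcases hS.pen_small with h | ⟨e, he, h⟩
  · refine ⟨fun n => S.lam n * |S.M0|, ?_, Eventually.of_forall fun n α hα α' _ => ?_⟩
    · have := h.mul_const |S.M0|
      simpa only [SmallInv, zero_mul, mul_assoc] using this
    · refine le_add_of_nonneg_of_le zero_le ?_
      rw [ENNReal.ofReal_mul (hS.lam_pos n).le]
      exact mul_le_mul' le_rfl ((hS.aos_sub hα).2.2.trans
        (ENNReal.ofReal_le_ofReal (le_abs_self _)))
  · refine ⟨e, he, h.mono fun n hn α hα α' hα' => ?_⟩
    have hl := (hS.lam_pos n).le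
    have hfin : ∀ α ∈ S.Aos, S.Pen α.2 = ENNReal.ofReal (S.Pen α.2).toReal := fun α hα =>
      (ENNReal.ofReal_toReal (((hS.aos_sub hα).2.2).trans_lt ENNReal.ofReal_lt_top).ne).symm
    rw [hfin α hα, hfin α' hα', ← ENNReal.ofReal_mul hl, ← ENNReal.ofReal_mul hl]
    refine le_trans (ENNReal.ofReal_le_ofReal ?_) ENNReal.ofReal_add_le
    have h1 := hn α hα α' hα'
    have h2 := mul_le_mul_of_nonneg_left (le_abs_self ((S.Pen α.2).toReal - (S.Pen α'.2).toReal)) hl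
    linarith

/-- Approximate minimizers in `N_osn` nearly minimize the unpenalized criterion along the
direction of the Riesz representer. -/
lemma LocalFeasible.eventually_compare (hS : S.Basic) (hF : S.LocalFeasible) {R γ : ℝ}
    (hγ : 0 < γ) (hTn : ∀ᶠ n : ℕ in atTop, ∀ τ : ℝ, |τ| ≤ R → τ / √n ∈ S.Tn n) :
    ∀ᶠ n : ℕ in atTop, ∀ a ∈ S.Nosn n, ∀ α ∈ S.Nosn n, ∀ τ : ℝ, |τ| ≤ R →
      α + (τ / √n) • S.u n ∈ S.Ak n ∧
      ∀ (q : Par dθ H → ℝ) (A : Set (Par dθ H)), (∀ x, 0 ≤ q x) →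
        ApproxMin q S.Pen (S.lam n) (S.eta n) A a → α + (τ / √n) • S.u n ∈ A →
        n * (q a - q (α + (τ / √n) • S.u n)) ≤ γ := by
  obtain ⟨e, he, h1⟩ := hF.pen
  obtain ⟨e', he', h2⟩ := hS.exists_pen_le
  have hlim : Tendsto (fun n : ℕ => (n : ℝ) * |e n| + n * |e' n| + n * S.eta n) atTop (𝓝 0) := by
    have h3 := (he.abs.add he'.abs).add hS.eta_small
    simp only [abs_mul, Nat.abs_cast, abs_zero, add_zero] at h3
    exact h3
  filter_upwards [hTn, hF.mem, h1, h2, hS.eventually_Nosn_subset, hlim.eventually_lt_const hγ]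
    with n g1 g2 g3 g4 g5 g6 a ha α hα τ hτ
  have ht := g1 τ hτ
  refine ⟨g2 α hα _ ht, fun q A hq hmin hA => ?_⟩
  set x := α + (τ / √n) • S.u n
  have hη := hS.eta_nonneg n
  have hfin : ENNReal.ofReal (S.lam n) * S.Pen a.2 ≠ ∞ :=
    ENNReal.mul_ne_top ENNReal.ofReal_ne_top
      ((ha.1.2.2.2).trans_lt ENNReal.ofReal_lt_top).ne
  -- The penalty at the moved point is exchanged first for the one at α and then for the one at a.
  -- The penalty at a is finite and cancels from both sides.
  have h5 : ENNReal.ofReal (q a) + ENNReal.ofReal (S.lam n) * S.Pen a.2 ≤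
      ENNReal.ofReal (q x + |e n| + |e' n| + S.eta n) +
        ENNReal.ofReal (S.lam n) * S.Pen a.2 := by
    calc _ ≤ ENNReal.ofReal (q x) + ENNReal.ofReal (S.lam n) * S.Pen x.2 +
          ENNReal.ofReal (S.eta n) := hmin.2 x hA
      _ ≤ ENNReal.ofReal (q x) + (ENNReal.ofReal (S.lam n) * S.Pen a.2 + ENNReal.ofReal |e' n| +
          ENNReal.ofReal |e n|) + ENNReal.ofReal (S.eta n) := by
        refine add_le_add_left (add_le_add_right ((g3 α hα _ ht).trans (add_le_add ?_ ?_)) _) _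
        · exact (g4 α (g5 hα).1 a (g5 ha).1).trans
            (add_le_add_right (ENNReal.ofReal_le_ofReal (le_abs_self _)) _)
        · exact ENNReal.ofReal_le_ofReal (le_abs_self _)
      _ = _ := by
        have hx := hq x
        rw [ENNReal.ofReal_add (by positivity) hη, ENNReal.ofReal_add (by positivity)
          (abs_nonneg _), ENNReal.ofReal_add hx (abs_nonneg _)]
        ring
  have h6 := (ENNReal.add_le_add_iff_right hfin).1 h5
  have hx := hq x
  rw [ENNReal.ofReal_le_ofReal_iff (by positivity)] at h6
  have h7 : (n : ℝ) * (q a - q x) ≤ n * (|e n| + |e' n| + S.eta n) :=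
    mul_le_mul_of_nonneg_left (by linarith) (Nat.cast_nonneg n)
  refine h7.trans ?_
  rw [mul_add, mul_add]
  exact g6.le

end Setting

/-! Quadratic expansions along a filter -/

section QuadraticExpansion

variable {ι : Type*}

/-- The criteria `q`, scaled by the sample size, have a quadratic expansion on the scale
`n^{-1/2}` along the Riesz representer, with linear term `ℓ` and quadratic term `b`. -/
def QuadExp (S : Setting dθ dρ 𝒳 𝒴 H) (F : Filter ι) (N : ι → ℕ) (q ℓ : ι → Par dθ H → ℝ)
    (b : ι → ℝ) : Prop :=
  ∀ R γ : ℝ, 0 < γ → ∀ᶠ i in F, ∀ α ∈ S.Nosn (N i), ∀ τ : ℝ, |τ| ≤ R →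
    |N i * (q i (α + (τ / √(N i)) • S.u (N i)) - q i α) - 2 * τ * ℓ i α - b i * τ ^ 2| ≤ γ

variable {F F' : Filter ι} {N : ι → ℕ} {q ℓ : ι → Par dθ H → ℝ} {b B : ι → ℝ}
  {a aR : ι → Par dθ H}

lemma QuadExp.mono (h : QuadExp S F N q ℓ b) (hF : F' ≤ F) : QuadExp S F' N q ℓ b :=
  fun R γ hγ => (h R γ hγ).filter_mono hF

/-- On |τ| ≤ R the quadratic terms differ by at most |B - b|R². -/
lemma QuadExp.congr_quad (h : QuadExp S F N q ℓ B) (hB : Tendsto (fun i => B i - b i) F (𝓝 0)) :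
    QuadExp S F N q ℓ b := by
  intro R γ hγ
  have h2 := hB.mul_const (R ^ 2)
  rw [zero_mul] at h2
  rw [Metric.tendsto_nhds] at h2
  filter_upwards [h R (γ / 2) (half_pos hγ), h2 (γ / 2) (half_pos hγ)] with i h3 h4 α hα τ hτ
  have h5 := h3 α hα τ hτ
  rw [dist_zero_right, Real.norm_eq_abs, abs_mul, abs_sq] at h4
  have h6 : |(B i - b i) * τ ^ 2| ≤ γ / 2 := by
    rw [abs_mul, abs_sq]
    refine le_trans (mul_le_mul_of_nonneg_left ?_ (abs_nonneg _)) h4.le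
    rw [← sq_abs τ]
    exact pow_le_pow_left₀ (abs_nonneg _) hτ 2
  have h7 := abs_add_le (N i * (q i (α + (τ / √(N i)) • S.u (N i)) - q i α) - 2 * τ * ℓ i α -
    B i * τ ^ 2) ((B i - b i) * τ ^ 2)
  have h8 : N i * (q i (α + (τ / √(N i)) • S.u (N i)) - q i α) - 2 * τ * ℓ i α -
      B i * τ ^ 2 + (B i - b i) * τ ^ 2 = N i * (q i (α + (τ / √(N i)) • S.u (N i)) - q i α) -
        2 * τ * ℓ i α - b i * τ ^ 2 := by ring
  rw [h8] at h7
  linarith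

/-- The scaled form of a local quadratic approximation. -/
lemma quadExp_of_expansion (hN : Tendsto N F atTop)
    (hTn : ∀ R, ∀ᶠ n : ℕ in atTop, ∀ τ : ℝ, |τ| ≤ R → τ / √n ∈ S.Tn n)
    {m : ι → Par dθ H → ℝ} {s : ℕ → ℝ} (hs : SmallInv s)
    (h : ∀ ε : ℝ, 0 < ε → ∀ᶠ i in F, ∀ α ∈ S.Nosn (N i), ∀ t ∈ S.Tn (N i),
      |(q i (α + t • S.u (N i)) - q i α) / 2 - t * m i α - B i / 2 * t ^ 2| ≤
        ε * max (max (t ^ 2) (|t| / √(N i))) (s (N i))) :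
    QuadExp S F N q (fun i α => √(N i) * m i α) B := by
  intro R γ hγ
  -- With t = τ/√n, n times the three entries of the maximum is at most R², |R| and 1.
  set D := R ^ 2 + |R| + 1 with hD
  have hD0 : 0 < D := by positivity
  filter_upwards [h (γ / (2 * D)) (by positivity), hN.eventually (hTn R),
    hN.eventually (hs.eventually_lt_const one_pos), hN.eventually (eventually_gt_atTop 0)]
    with i h1 h2 h3 h4 α hα τ hτ
  have hn0 : (0 : ℝ) < N i := by exact_mod_cast h4
  have hn' : 0 < √(N i : ℝ) := Real.sqrt_pos.2 hn0
  have hsq : √(N i : ℝ) ^ 2 = N i := Real.sq_sqrt hn0.le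
  have h5 := h1 α hα _ (h2 τ hτ)
  set x := q i (α + (τ / √(N i)) • S.u (N i)) - q i α
  have hR : |τ| ≤ |R| := hτ.trans (le_abs_self R)
  have hτ2 : τ ^ 2 ≤ R ^ 2 := sq_le_sq.2 hR
  have hmax : (N i : ℝ) * max (max ((τ / √(N i)) ^ 2) (|τ / √(N i)| / √(N i))) (s (N i)) ≤ D := by
    rw [mul_max_of_nonneg _ _ hn0.le, mul_max_of_nonneg _ _ hn0.le]
    refine max_le (max_le ?_ ?_) ?_
    · rw [div_pow, hsq, mul_div_cancel₀ _ hn0.ne']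
      have := abs_nonneg R
      linarith
    · rw [abs_div, abs_of_pos hn', div_div, ← sq, hsq, mul_div_cancel₀ _ hn0.ne']
      have := sq_nonneg R
      linarith
    · have := abs_nonneg R
      have := sq_nonneg R
      linarith
  have hid : N i * x - 2 * τ * (√(N i) * m i α) - B i * τ ^ 2 =
      2 * N i * (x / 2 - τ / √(N i) * m i α - B i / 2 * (τ / √(N i)) ^ 2) := by
    rw [div_pow, hsq]
    have : τ / √(N i) = τ * √(N i) / N i := by
      rw [div_eq_div_iff hn'.ne' hn0.ne', ← hsq, Real.sqrt_sq hn'.le]; ring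
    rw [this]
    field_simp
  rw [hid, abs_mul, abs_of_pos (by positivity)]
  calc _ ≤ 2 * N i * (γ / (2 * D) *
        max (max ((τ / √(N i)) ^ 2) (|τ / √(N i)| / √(N i))) (s (N i))) :=
        mul_le_mul_of_nonneg_left h5 (by positivity)
    _ = γ / D * (N i * max (max ((τ / √(N i)) ^ 2) (|τ / √(N i)| / √(N i))) (s (N i))) := by
        field_simp
    _ ≤ γ / D * D := mul_le_mul_of_nonneg_left hmax (by positivity)
    _ = γ := by field_simp

/-- Data of a restricted and an unrestricted minimization problem near the null parameter: the
linear term of the expansion is `ζ + √n ⟨u, α - α₀⟩`, and the restriction is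
`√n ⟨u, α - α₀⟩ ≈ x`. -/
structure QLRSetup (S : Setting dθ dρ 𝒳 𝒴 H) (F : Filter ι) (N : ι → ℕ)
    (q ℓ : ι → Par dθ H → ℝ) (a aR : ι → Par dθ H) (ζ x κ : ι → ℝ) : Prop where
  tendsto_N : Tendsto N F atTop
  nonneg : ∀ i y, 0 ≤ q i y
  exp : QuadExp S F N q ℓ fun i => S.nrm (S.u (N i)) ^ 2
  lin : ∀ᶠ i in F, ∀ α ∈ S.Nosn (N i),
    ℓ i α = ζ i + √(N i) * S.ip (S.u (N i)) (α - S.alpha0)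
  mem : ∀ᶠ i in F, a i ∈ S.Nosn (N i)
  memR : ∀ᶠ i in F, aR i ∈ S.Nosn (N i)
  estMin : ∀ᶠ i in F, ApproxMin (q i) S.Pen (S.lam (N i)) (S.eta (N i)) (S.Ak (N i)) (a i)
  estRMin : ∀ᶠ i in F, ApproxMin (q i) S.Pen (S.lam (N i)) (S.eta (N i)) (S.AkR (N i) (κ i)) (aR i)
  level : Tendsto (fun i => √(N i) * (κ i - S.phi S.alpha0) / S.sd (N i) - x i) F (𝓝 0)

variable {ζ x κ : ι → ℝ} {c C : ℝ}

lemma QLRSetup.mono (h : QLRSetup S F N q ℓ a aR ζ x κ) (hF : F' ≤ F) :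
    QLRSetup S F' N q ℓ a aR ζ x κ where
  tendsto_N := h.tendsto_N.mono_left hF
  nonneg := h.nonneg
  exp := h.exp.mono hF
  lin := h.lin.filter_mono hF
  mem := h.mem.filter_mono hF
  memR := h.memR.filter_mono hF
  estMin := h.estMin.filter_mono hF
  estRMin := h.estRMin.filter_mono hF
  level := h.level.mono_left hF

variable [StandardBorelSpace 𝒴] [Nonempty 𝒴]

/-- The first order condition of an unrestricted approximate minimizer. -/
lemma QuadExp.tendsto_foc (hS : S.Basic) (hFeas : S.LocalFeasible) (hN : Tendsto N F atTop)
    (hTn : ∀ R, ∀ᶠ n : ℕ in atTop, ∀ τ : ℝ, |τ| ≤ R → τ / √n ∈ S.Tn n)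
    (h : QuadExp S F N q ℓ B) (hq : ∀ i x, 0 ≤ q i x) {K : ℝ} (hB : ∀ᶠ i in F, |B i| ≤ K)
    (ha : ∀ᶠ i in F, a i ∈ S.Nosn (N i))
    (hmin : ∀ᶠ i in F, ApproxMin (q i) S.Pen (S.lam (N i)) (S.eta (N i)) (S.Ak (N i)) (a i)) :
    Tendsto (fun i => ℓ i (a i)) F (𝓝 0) := by
  rw [Metric.tendsto_nhds]
  intro ε hε
  -- Steps of ±r give ±2rℓ ≥ -(Br² + 2γ), and this r makes Br² ≤ εr. Only a bound on `B` is needed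
  -- here, not its limit.
  set r := ε / (|K| + 1) with hr
  have hK1 : 0 < |K| + 1 := by positivity
  have hr0 : 0 < r := by positivity
  have hKr : |K| * r ≤ ε := by
    rw [hr, mul_div_assoc', div_le_iff₀ hK1, mul_comm]
    exact mul_le_mul_of_nonneg_left (by linarith) hε.le
  have hγ : 0 < r * ε / 4 := by positivity
  filter_upwards [h r _ hγ, hB, ha, hmin,
    hN.eventually (hFeas.eventually_compare hS hγ (hTn r))] with i h1 h2 h3 h4 h5
  have hBr : B i * r ^ 2 ≤ ε * r := by
    have : B i * r ≤ |K| * r :=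
      mul_le_mul_of_nonneg_right ((le_abs_self _).trans (h2.trans (le_abs_self _))) hr0.le
    nlinarith
  have key : ∀ τ : ℝ, |τ| = r → -(ε * r + r * ε / 2) ≤ 2 * τ * ℓ i (a i) := by
    intro τ hτ
    obtain ⟨h6, h7⟩ := h5 _ h3 _ h3 τ hτ.le
    have h8 := h7 (q i) _ (hq i) h4 h6
    have h9 := (abs_le.1 (h1 _ h3 τ hτ.le)).2
    rw [← sq_abs τ, hτ] at h9
    linarith
  have k1 := key r (abs_of_pos hr0)
  have k2 := key (-r) (by rw [abs_neg, abs_of_pos hr0])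
  rw [dist_zero_right, Real.norm_eq_abs, abs_lt]
  constructor
  · have : r * (-ε) < r * ℓ i (a i) := by nlinarith
    exact lt_of_mul_lt_mul_left this hr0.le
  · have : r * ℓ i (a i) < r * ε := by nlinarith
    exact lt_of_mul_lt_mul_left this hr0.le

/-- The linear term at the restricted minimizer. -/
lemma QLRSetup.tendsto_restricted (hS : S.Basic) (hR : S.Riesz) (hφ : S.PhiLocal)
    (hsc : S.ScaleBounds c C)
    (hTn : ∀ R, ∀ᶠ n : ℕ in atTop, ∀ τ : ℝ, |τ| ≤ R → τ / √n ∈ S.Tn n)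
    (h : QLRSetup S F N q ℓ a aR ζ x κ) :
    Tendsto (fun i => ℓ i (aR i) - (ζ i + x i)) F (𝓝 0) := by
  rw [Metric.tendsto_nhds]
  intro ε hε
  filter_upwards [h.lin, h.memR, h.estRMin, Metric.tendsto_nhds.1 h.level (ε / 2) (half_pos hε),
    h.tendsto_N.eventually (hφ.eventually_linear hS hR hsc (half_pos hε) (hTn 0))]
    with i h1 h2 h3 h4 h5
  -- At τ = 0 the linearization of φ evaluates √n⟨u, aR - α₀⟩ from the constraint φ(aR) = κ.
  have h6 := h5 _ h2 0 (by simp)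
  rw [zero_div, zero_smul, add_zero, zero_mul, add_zero, h3.1.2] at h6
  rw [dist_zero_right, Real.norm_eq_abs, abs_lt] at h4
  rw [abs_le] at h6
  rw [h1 _ h2, dist_zero_right, Real.norm_eq_abs, abs_lt]
  constructor <;> linarith [h4.1, h4.2, h6.1, h6.2]

/-- The expansion of the quasi likelihood ratio. -/
lemma QLRSetup.tendsto_qlr (hS : S.Basic) (hR : S.Riesz) (hφ : S.PhiLocal)
    (hFeas : S.LocalFeasible) (hsc : S.ScaleBounds c C)
    (hTn : ∀ R, ∀ᶠ n : ℕ in atTop, ∀ τ : ℝ, |τ| ≤ R → τ / √n ∈ S.Tn n)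
    (h : QLRSetup S F N q ℓ a aR ζ x κ) {K : ℝ} (hK : ∀ᶠ i in F, |ζ i + x i| ≤ K) :
    Tendsto (fun i => N i * (q i (aR i) - q i (a i)) -
      (ζ i + x i) ^ 2 / S.nrm (S.u (N i)) ^ 2) F (𝓝 0) := by
  rw [Metric.tendsto_nhds]
  intro ε hε
  have hc := hsc.pos
  -- R bounds all displacements used below, which are at most (|W| + 4γ)/b with γ ≤ 1. In `D`, 2R
  -- comes from the linear term, 8R from the excess of τ over W/b, and 4 dominates the two remaining
  -- errors of size γ.
  set R := (|K| + 4) / c with hRdef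
  have hR0 : 0 < R := by positivity
  set D := 2 * R + 8 * R + 4 with hDdef
  have hD0 : 0 < D := by positivity
  set γ := min 1 (ε / (2 * D)) with hγdef
  have hγ : 0 < γ := lt_min one_pos (by positivity)
  have hγ1 : γ ≤ 1 := min_le_left _ _
  have hγD : γ * D < ε := by
    have h1 : γ * D ≤ ε / (2 * D) * D := mul_le_mul_of_nonneg_right (min_le_right _ _) hD0.le
    have h2 : ε / (2 * D) * D = ε / 2 := by field_simp
    linarith
  have hfoc := h.exp.tendsto_foc hS hFeas h.tendsto_N hTn h.nonneg (K := C) (by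
    filter_upwards [h.tendsto_N.eventually hsc.bounds] with i hi
    rw [abs_of_nonneg (sq_nonneg _)]; exact hi.2.2.2) h.mem h.estMin
  filter_upwards [h.exp R γ hγ, h.lin, h.mem, h.memR, h.estMin, h.estRMin, hK,
    h.tendsto_N.eventually hsc.bounds,
    h.tendsto_N.eventually (hφ.eventually_linear hS hR hsc hγ (hTn R)),
    h.tendsto_N.eventually (hFeas.eventually_compare hS hγ (hTn R)),
    h.tendsto_N.eventually (eventually_gt_atTop 0),
    Metric.tendsto_nhds.1 h.level γ hγ, Metric.tendsto_nhds.1 hfoc γ hγ,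
    Metric.tendsto_nhds.1 (h.tendsto_restricted hS hR hφ hsc hTn) γ hγ]
    with i h1 h2 h3 h4 h5 h6 h7 h8 h9 h10 h11 h12 h13 h14
  have hn0 : (0 : ℝ) < N i := by exact_mod_cast h11
  have hn' : 0 < √(N i : ℝ) := Real.sqrt_pos.2 hn0
  have hsd := h8.1
  rw [dist_zero_right, Real.norm_eq_abs] at h12 h13 h14
  set W := ζ i + x i with hW
  set b := S.nrm (S.u (N i)) ^ 2 with hb
  have hbc : c ≤ b := h8.2.2.1
  have hb0 : 0 < b := hc.trans_le hbc
  have hWK : |W| ≤ |K| := h7.trans (le_abs_self K)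
  have hdiv : ∀ y, |y| ≤ |K| + 4 → |y / b| ≤ R := fun y hy => by
    rw [abs_div, abs_of_pos hb0]
    exact div_le_div₀ (by positivity) hy hc hbc
  rw [dist_zero_right, Real.norm_eq_abs, abs_lt]
  constructor
  -- Lower bound: τ = -W/b minimizes 2τW + bτ², with value -W²/b, and the unrestricted minimizer
  -- does at least as well up to γ.
  · have hτ : |-W / b| ≤ R := hdiv _ (by rw [abs_neg]; linarith)
    obtain ⟨g1, g2⟩ := h10 _ h3 _ h4 _ hτ
    have g3 := g2 (q i) _ (h.nonneg i) h5 g1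
    have g4 := (abs_le.1 (h1 _ h4 _ hτ)).2
    have g5 : |(-W / b) * (ℓ i (aR i) - W)| ≤ R * γ := by
      rw [abs_mul]
      exact mul_le_mul hτ h14.le (abs_nonneg _) hR0.le
    have g6 : 2 * (-W / b) * ℓ i (aR i) + b * (-W / b) ^ 2 =
        2 * ((-W / b) * (ℓ i (aR i) - W)) - W ^ 2 / b := by field_simp; ring
    have g7 := (abs_le.1 g5).2
    have g8 : γ * D = 2 * (R * γ) + 8 * (R * γ) + 4 * γ := by rw [hDdef]; ring
    have g9 : 0 ≤ R * γ := by positivity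
    linarith
  -- Upper bound: the unrestricted minimizer is moved onto the constraint set. At τ = (W ± 4γ)/b the
  -- linearized functional lies on either side of the level, since the three errors (linearization,
  -- first order condition, level) amount to at most 3γ.
  · obtain ⟨τ, hτ, hφτ⟩ : ∃ τ : ℝ, |τ| * b ≤ |W| + 4 * γ ∧
        S.phi (a i + (τ / √(N i)) • S.u (N i)) = κ i := by
      set ψ : ℝ → ℝ := fun τ => √(N i) * (S.phi (a i + (τ / √(N i)) • S.u (N i)) -
        S.phi S.alpha0) / S.sd (N i) with hψ
      have hcont : Continuous ψ := by
        have := hφ.phi_cont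
        fun_prop
      have hℓ := h2 _ h3
      have hval : ∀ y : ℝ, |y| ≤ |K| + 4 →
          |ψ (y / b) - (ℓ i (a i) - ζ i + y)| ≤ γ := fun y hy => by
        have := h9 _ h3 _ (hdiv y hy)
        rw [div_mul_cancel₀ _ hb0.ne'] at this
        rw [hℓ, add_sub_cancel_left]
        exact this
      have b1 : |W - 4 * γ| ≤ |W| + 4 * γ := (abs_sub _ _).trans (by
        rw [abs_of_pos (show 0 < 4 * γ by positivity)])
      have b2 : |W + 4 * γ| ≤ |W| + 4 * γ := (abs_add_le _ _).trans (by
        rw [abs_of_pos (show 0 < 4 * γ by positivity)])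
      have v1 := abs_le.1 (hval (W - 4 * γ) (by linarith))
      have v2 := abs_le.1 (hval (W + 4 * γ) (by linarith))
      have l1 := abs_lt.1 h12
      have l2 := abs_lt.1 h13
      have hle : (W - 4 * γ) / b ≤ (W + 4 * γ) / b :=
        div_le_div_of_nonneg_right (by linarith) hb0.le
      obtain ⟨τ, hτ, hτψ⟩ := intermediate_value_Icc hle hcont.continuousOn
        (show √(N i) * (κ i - S.phi S.alpha0) / S.sd (N i) ∈
          Set.Icc (ψ ((W - 4 * γ) / b)) (ψ ((W + 4 * γ) / b)) by
          constructor <;> linarith [l1.1, l1.2, l2.1, l2.2, v1.2, v2.1])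
      refine ⟨τ, ?_, ?_⟩
      · have t1 := hτ.1
        have t2 := hτ.2
        rw [div_le_iff₀ hb0] at t1
        rw [le_div_iff₀ hb0] at t2
        rw [← abs_of_pos hb0, ← abs_mul, abs_le]
        constructor <;> linarith [neg_abs_le W, le_abs_self W]
      · rw [hψ] at hτψ
        simp only at hτψ
        rw [div_left_inj' hsd.ne', mul_right_inj' hn'.ne'] at hτψ
        linarith
    have hτR : |τ| ≤ R := by
      rw [hRdef, le_div_iff₀ hc]
      exact (mul_le_mul_of_nonneg_left hbc (abs_nonneg τ)).trans (by linarith)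
    obtain ⟨g1, g2⟩ := h10 _ h4 _ h3 _ hτR
    have g3 := g2 (q i) _ (h.nonneg i) h6 ⟨g1, hφτ⟩
    have g4 := (abs_le.1 (h1 _ h3 _ hτR)).2
    have g5 : |τ * ℓ i (a i)| ≤ R * γ := by
      rw [abs_mul]
      exact mul_le_mul hτR h13.le (abs_nonneg _) hR0.le
    have g7 := (abs_le.1 g5).2
    have g9 : b * τ ^ 2 ≤ W ^ 2 / b + 8 * (R * γ) := by
      have e1 : (|τ| * b) ^ 2 ≤ (|W| + 4 * γ) ^ 2 :=
        pow_le_pow_left₀ (by positivity) hτ 2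
      have e2 : b * τ ^ 2 ≤ (|W| + 4 * γ) ^ 2 / b := by
        rw [le_div_iff₀ hb0, ← sq_abs τ]; linarith
      have e3 : (|W| + 4 * γ) ^ 2 / b = W ^ 2 / b + 8 * γ * ((|W| + 2 * γ) / b) := by
        rw [← sq_abs W]; field_simp; ring
      have e4 : (|W| + 2 * γ) / b ≤ R := div_le_div₀ (by positivity) (by linarith) hc hbc
      have e5 : 8 * γ * ((|W| + 2 * γ) / b) ≤ 8 * γ * R :=
        mul_le_mul_of_nonneg_left e4 (by positivity)
      linarith
    have g8 : γ * D = 2 * (R * γ) + 8 * (R * γ) + 4 * γ := by rw [hDdef]; ring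
    linarith

/-- A lower bound for the quasi likelihood ratio far away from the null hypothesis. -/
lemma QLRSetup.eventually_le_qlr (hS : S.Basic) (hR : S.Riesz) (hφ : S.PhiLocal)
    (hFeas : S.LocalFeasible) (hsc : S.ScaleBounds c C)
    (hTn : ∀ R, ∀ᶠ n : ℕ in atTop, ∀ τ : ℝ, |τ| ≤ R → τ / √n ∈ S.Tn n)
    (h : QLRSetup S F N q ℓ a aR ζ x κ) :
    ∀ᶠ i in F, 2 * |ζ i + x i| - (C + 4) ≤ N i * (q i (aR i) - q i (a i)) := by
  filter_upwards [h.exp 1 1 one_pos, h.mem, h.memR, h.estMin,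
    h.tendsto_N.eventually hsc.bounds,
    h.tendsto_N.eventually (hFeas.eventually_compare hS one_pos (hTn 1)),
    Metric.tendsto_nhds.1 (h.tendsto_restricted hS hR hφ hsc hTn) 1 one_pos]
    with i h1 h3 h4 h5 h8 h10 h14
  rw [dist_zero_right, Real.norm_eq_abs] at h14
  -- W may be unbounded, and the optimal displacement -W/b is then out of reach of an expansion on
  -- bounded τ. The fixed steps ±1 still give a bound linear in |W|.
  have key : ∀ τ : ℝ, |τ| = 1 → -(2 * τ * ℓ i (aR i)) - (C + 2) ≤
      N i * (q i (aR i) - q i (a i)) := fun τ hτ => by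
    obtain ⟨g1, g2⟩ := h10 _ h3 _ h4 τ hτ.le
    have g3 := g2 (q i) _ (h.nonneg i) h5 g1
    have g4 := (abs_le.1 (h1 _ h4 _ hτ.le)).2
    rw [← sq_abs τ, hτ] at g4
    linarith [h8.2.2.2]
  have k1 := key 1 (by simp)
  have k2 := key (-1) (by simp)
  have := abs_lt.1 h14
  rcases abs_cases (ζ i + x i) with ⟨e, -⟩ | ⟨e, -⟩ <;> rw [e] <;> linarith

end QuadraticExpansion

end Expansion

/-! Limit distributions -/

section Limits

variable {𝒳 𝒴 Ω : Type*} [MeasurableSpace 𝒳] [MeasurableSpace 𝒴] [MeasurableSpace Ω]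

/-- Differences of distribution functions give half-open intervals. The missing left endpoint may
carry mass for finite n, so the upper bound starts at κ - r - ε/4, a strip of normal probability at
most ε/4. -/
lemma ToStdNormal.tendsto_abs_sub_le {P : ℕ → ProbabilityMeasure (𝒳 × 𝒴)}
    {X : ∀ n, Sample n 𝒳 𝒴 → ℝ} (h : ToStdNormal P X) (hX : ∀ n, Measurable (X n)) (κ r : ℝ) :
    Tendsto (fun n => (law (P n) n).real {z | |X n z - κ| ≤ r}) atTop (𝓝 (normalBall κ r)) := by
  rcases lt_or_ge r 0 with hr | hr
  · have : ∀ n, {z | |X n z - κ| ≤ r} = ∅ := fun n => by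
      ext z
      simp only [Set.mem_ofPred_eq, Set.mem_empty_iff_false, iff_false, not_le]
      exact hr.trans_le (abs_nonneg _)
    simp [this, normalBall_of_neg κ hr]
  set Φ : ℝ → ℝ := fun t => (gaussianReal 0 1).real (Set.Iic t) with hΦ
  have hΦd : ∀ a b, a ≤ b → Φ b - Φ a = (gaussianReal 0 1).real (Set.Icc a b) := by
    intro a b hab
    have h1 : Set.Iic b = Set.Iic a ∪ Set.Ioc a b := (Set.Iic_union_Ioc_eq_Iic hab).symm
    have h2 := measureReal_union (μ := gaussianReal 0 1)
      (s₁ := Set.Iic a) (s₂ := Set.Ioc a b) (Set.Iic_disjoint_Ioc le_rfl) measurableSet_Ioc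
    have h3 : (gaussianReal 0 1).real (Set.Ioc a b) = (gaussianReal 0 1).real (Set.Icc a b) := by
      rw [stdNormal_Icc hab, measureReal_def, gaussianReal_apply_eq_integral _ one_ne_zero,
        ENNReal.toReal_ofReal (integral_nonneg fun x => gaussianPDFReal_nonneg _ _ _),
        intervalIntegral.integral_of_le hab]
    rw [← h1, h3] at h2
    simp only [hΦ]
    linarith
  have hd : ∀ n a b, a ≤ b → (law (P n) n).real {z | X n z ≤ b} -
      (law (P n) n).real {z | X n z ≤ a} = (law (P n) n).real {z | a < X n z ∧ X n z ≤ b} := by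
    intro n a b hab
    have h1 : {z | X n z ≤ b} = {z | X n z ≤ a} ∪ {z | a < X n z ∧ X n z ≤ b} := by
      ext z
      simp only [Set.mem_union, Set.mem_ofPred_eq]
      constructor
      · intro hz
        rcases le_or_gt (X n z) a with h2 | h2
        · exact Or.inl h2
        · exact Or.inr ⟨h2, hz⟩
      · rintro (h2 | h2)
        · exact h2.trans hab
        · exact h2.2
    have hdis : Disjoint {z | X n z ≤ a} {z | a < X n z ∧ X n z ≤ b} := by
      rw [Set.disjoint_left]
      intro z hz hz'
      exact absurd (show X n z ≤ a from hz) (not_le.2 hz'.1)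
    have hm : MeasurableSet {z | a < X n z ∧ X n z ≤ b} :=
      (measurableSet_lt measurable_const (hX n)).inter (measurableSet_le (hX n) measurable_const)
    rw [h1, measureReal_union hdis hm, add_sub_cancel_left]
  rw [Metric.tendsto_nhds]
  intro ε hε
  have c1 := Metric.tendsto_nhds.1 (h (κ + r)) (ε / 4) (by positivity)
  have c2 := Metric.tendsto_nhds.1 (h (κ - r)) (ε / 4) (by positivity)
  have c3 := Metric.tendsto_nhds.1 (h (κ - r - ε / 4)) (ε / 4) (by positivity)
  filter_upwards [c1, c2, c3] with n h1 h2 h3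
  rw [Real.dist_eq, abs_lt] at h1 h2 h3 ⊢
  have e1 := hd n (κ - r) (κ + r) (by linarith)
  have e2 := hd n (κ - r - ε / 4) (κ + r) (by linarith)
  have g1 := hΦd (κ - r) (κ + r) (by linarith)
  have g2 := hΦd (κ - r - ε / 4) (κ - r) (by linarith)
  have g3 := stdNormal_Icc_le (a := κ - r - ε / 4) (b := κ - r) (by linarith)
  have m1 : (law (P n) n).real {z | κ - r < X n z ∧ X n z ≤ κ + r} ≤
      (law (P n) n).real {z | |X n z - κ| ≤ r} := by
    refine measureReal_mono fun z hz => abs_sub_le_iff_mem_Icc.2 ⟨hz.1.le, hz.2⟩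
  have m2 : (law (P n) n).real {z | |X n z - κ| ≤ r} ≤
      (law (P n) n).real {z | κ - r - ε / 4 < X n z ∧ X n z ≤ κ + r} := by
    refine measureReal_mono fun z hz => ?_
    have := abs_sub_le_iff_mem_Icc.1 hz
    exact ⟨by linarith [this.1], this.2⟩
  simp only [hΦ] at g1 g2
  unfold normalBall
  constructor <;> linarith [h1.1, h1.2, h2.1, h2.2, h3.1, h3.2]

lemma measureReal_not {α : Type*} [MeasurableSpace α] (μ : Measure α) [IsProbabilityMeasure μ]
    {p : α → Prop} (hp : MeasurableSet {a | p a}) : μ.real {a | ¬ p a} = 1 - μ.real {a | p a} :=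
  probReal_compl_eq_one_sub hp

lemma ToStdNormal.boundedP {P : ℕ → ProbabilityMeasure (𝒳 × 𝒴)}
    {X : ∀ n, Sample n 𝒳 𝒴 → ℝ} (h : ToStdNormal P X) (hX : ∀ n, Measurable (X n)) :
    BoundedP P X := by
  intro ε hε
  obtain ⟨M, hM⟩ := ((tendsto_normalBall 0).eventually
    (lt_mem_nhds (show 1 - ε < 1 by linarith))).exists
  refine ⟨M, ?_⟩
  filter_upwards [(h.tendsto_abs_sub_le hX 0 M).eventually (lt_mem_nhds hM)] with n hn
  simp only [sub_zero] at hn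
  have h1 := measureReal_not (law (P n) n) (p := fun z => |X n z| ≤ M)
    (measurableSet_le (hX n).abs measurable_const)
  simp only [not_le] at h1
  rw [← ofReal_measureReal]
  exact ENNReal.ofReal_le_ofReal (by linarith)

lemma BootToStdNormal.wpa1_abs {P : ℕ → ProbabilityMeasure (𝒳 × 𝒴)} {PΩ : ProbabilityMeasure Ω}
    {X : ∀ n, Sample n 𝒳 𝒴 → Ω → ℝ} (h : BootToStdNormal P PΩ X)
    (hX : ∀ n z, Measurable (X n z)) {ε : ℝ} (hε : 0 < ε) :
    Wpa1 P fun n z => ∀ r, |(PΩ : Measure Ω).real {w | |X n z w| ≤ r} - normalBall 0 r| ≤ ε := by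
  set s := min 1 (ε / 3) with hs
  have hs0 : 0 < s := lt_min one_pos (by positivity)
  refine (h (s ^ 2) (by positivity)).mono (Eventually.of_forall fun n z hz r => ?_)
  refine (abs_cdf_abs_sub_normalBall_le_of_lipschitz (PΩ : Measure Ω) (hX n z) hs0
    (min_le_left _ _) hz r).trans ?_
  linarith [min_le_right 1 (ε / 3)]

lemma BootToStdNormal.bootBounded {P : ℕ → ProbabilityMeasure (𝒳 × 𝒴)}
    {PΩ : ProbabilityMeasure Ω} {X : ∀ n, Sample n 𝒳 𝒴 → Ω → ℝ} (h : BootToStdNormal P PΩ X)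
    (hX : ∀ n z, Measurable (X n z)) : BootBounded P PΩ X := by
  rw [bootBounded_iff]
  intro ε hε
  obtain ⟨M, hM, hM0⟩ := (((tendsto_normalBall 0).eventually
    (lt_mem_nhds (show 1 - ε / 2 < 1 by linarith))).and (eventually_gt_atTop 0)).exists
  refine ⟨M, hM0, (h.wpa1_abs hX (half_pos hε)).mono (Eventually.of_forall fun n z hz => ?_)⟩
  have h1 := measureReal_not (PΩ : Measure Ω) (p := fun w => |X n z w| ≤ M)
    (measurableSet_le (hX n z).abs measurable_const)
  have h2 := (abs_le.1 (hz M)).1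
  rw [← ofReal_measureReal]
  exact ENNReal.ofReal_le_ofReal (by linarith)

lemma exists_two_mul_add_sqrt_le (C : ℝ) {η : ℝ} (hη : 0 < η) :
    ∃ ε : ℝ, 0 < ε ∧ 2 * ε + 2 * √(ε * C) ≤ η := by
  have hc : Continuous fun ε : ℝ => 2 * ε + 2 * √(ε * C) := by fun_prop
  have h0 : Tendsto (fun ε : ℝ => 2 * ε + 2 * √(ε * C)) (𝓝[>] 0) (𝓝 0) := by
    have := (hc.tendsto 0).mono_left (nhdsWithin_le_nhds (s := Set.Ioi 0))
    simpa using this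
  obtain ⟨ε, h1, h2⟩ := ((h0.eventually_lt_const hη).and self_mem_nhdsWithin).exists
  exact ⟨ε, h2, h1.le⟩

lemma measureReal_le_of_le_ofReal {α : Type*} [MeasurableSpace α] {μ : Measure α} {s : Set α}
    {ε : ℝ} (hε : 0 ≤ ε) (h : μ s ≤ ENNReal.ofReal ε) : μ.real s ≤ ε :=
  ENNReal.toReal_le_of_le_ofReal hε h

/-- The distribution function of a statistic near `X² / b` with `X` asymptotically normal. -/
lemma ToStdNormal.eventually_cdf {P : ℕ → ProbabilityMeasure (𝒳 × 𝒴)}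
    {X Y : ∀ n, Sample n 𝒳 𝒴 → ℝ} (h : ToStdNormal P X) (hX : ∀ n, Measurable (X n))
    {b : ℕ → ℝ} {C : ℝ} (hb : ∀ᶠ n in atTop, 0 < b n ∧ b n ≤ C)
    (hY : SmallP P fun n z => Y n z - X n z ^ 2 / b n) {η : ℝ} (hη : 0 < η) :
    ∀ᶠ n in atTop, ∀ t,
      |(law (P n) n).real {z | Y n z ≤ t} - normalBall 0 √(t * b n)| ≤ η := by
  obtain ⟨ε, hε, hεη⟩ := exists_two_mul_add_sqrt_le C hη
  have hun := uniform_of_pointwise_normalBall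
    (A := fun n r => (law (P n) n).real {z | |X n z| ≤ r})
    (fun n r s hrs => measureReal_mono fun z (hz : |X n z| ≤ r) => hz.trans hrs)
    (fun n r hr => by
      have : {z | |X n z| ≤ r} = ∅ := by
        ext z
        simp only [Set.mem_ofPred_eq, Set.mem_empty_iff_false, iff_false, not_le]
        exact hr.trans_le (abs_nonneg _)
      simp [this])
    (fun n r => measureReal_le_one)
    (fun r _ => by simpa only [sub_zero] using h.tendsto_abs_sub_le hX 0 r) hε
  filter_upwards [hun, hb, wpa1_iff_real.1 (hY ε hε) ε hε] with n h1 h2 h3 t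
  exact (abs_cdf_sub_normalBall_le (law (P n) n) h2.1 h2.2 hε.le h1
    (measureReal_le_of_le_ofReal hε.le h3) t).trans hεη

/-- The conditional distribution function of a statistic near `X² / b` with `X` conditionally
asymptotically normal. -/
lemma BootToStdNormal.wpa1_cdf {P : ℕ → ProbabilityMeasure (𝒳 × 𝒴)} {PΩ : ProbabilityMeasure Ω}
    {X Y : ∀ n, Sample n 𝒳 𝒴 → Ω → ℝ} (h : BootToStdNormal P PΩ X)
    (hX : ∀ n z, Measurable (X n z))
    {b : ℕ → ℝ} {C : ℝ} (hb : ∀ᶠ n in atTop, 0 < b n ∧ b n ≤ C)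
    (hY : BootSmall P PΩ fun n z w => Y n z w - X n z w ^ 2 / b n) {η : ℝ} (hη : 0 < η) :
    Wpa1 P fun n z => ∀ t,
      |(PΩ : Measure Ω).real {w | Y n z w ≤ t} - normalBall 0 √(t * b n)| ≤ η := by
  obtain ⟨ε, hε, hεη⟩ := exists_two_mul_add_sqrt_le C hη
  have hY' : BootWpa1 P PΩ fun n z w => |Y n z w - X n z w ^ 2 / b n| ≤ ε := by
    have := Metric.nhds_basis_closedBall.tendsto_right_iff.1 (bootSmall_iff_tendsto.1 hY) ε hε
    simpa only [Metric.mem_closedBall, dist_zero_right, Real.norm_eq_abs] using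
      eventually_bwF.1 this
  refine ((h.wpa1_abs hX hε).and (hY' ε hε)).mono ?_
  filter_upwards [hb] with n h2 z hz t
  exact (abs_cdf_sub_normalBall_le (PΩ : Measure Ω) h2.1 h2.2 hε.le hz.1
    (measureReal_le_of_le_ofReal hε.le hz.2) t).trans hεη

/-- The events need not be measurable, so the complement rule is replaced by subadditivity of the
outer measure. -/
lemma Wpa1.tendsto_real {P : ℕ → ProbabilityMeasure (𝒳 × 𝒴)} {ev : ∀ n, Sample n 𝒳 𝒴 → Prop}
    (h : Wpa1 P ev) : Tendsto (fun n => (law (P n) n).real {z | ev n z}) atTop (𝓝 1) := by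
  have h1 : Tendsto (fun n => (law (P n) n).real {z | ¬ ev n z}) atTop (𝓝 0) := by
    have := (ENNReal.tendsto_toReal ENNReal.zero_ne_top).comp h
    rwa [ENNReal.toReal_zero] at this
  have h2 : Tendsto (fun n => 1 - (law (P n) n).real {z | ¬ ev n z}) atTop (𝓝 1) := by
    simpa using h1.const_sub 1
  refine tendsto_of_tendsto_of_tendsto_of_le_of_le h2 tendsto_const_nhds (fun n => ?_)
    fun n => measureReal_le_one
  have h3 : (Set.univ : Set (Sample n 𝒳 𝒴)) ⊆ {z | ev n z} ∪ {z | ¬ ev n z} := fun z _ =>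
    em (ev n z)
  have h4 := (measureReal_mono (μ := law (P n) n) h3).trans (measureReal_union_le _ _)
  rw [probReal_univ] at h4
  simp only
  linarith

/-- Rejection probabilities: if `b` times the statistic is near `(X - κ)²` with `X` asymptotically
normal, and `b` times the critical value is near `r²`, then the rejection probability converges
to the probability that a standard normal variable is not within `r` of `κ`. -/
lemma ToStdNormal.tendsto_rejection {P : ℕ → ProbabilityMeasure (𝒳 × 𝒴)}
    {X Y c : ∀ n, Sample n 𝒳 𝒴 → ℝ} (h : ToStdNormal P X) (hX : ∀ n, Measurable (X n))
    {b : ℕ → ℝ} (hb : ∀ᶠ n in atTop, 0 < b n) {κ r : ℝ} (hr : 0 < r)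
    (hY : SmallP P fun n z => b n * Y n z - (X n z - κ) ^ 2)
    (hc : ∀ s, 0 < s → s < r → Wpa1 P fun n z => (r - s) ^ 2 ≤ c n z * b n ∧
      c n z * b n ≤ (r + s) ^ 2) :
    Tendsto (fun n => (law (P n) n).real {z | c n z ≤ Y n z}) atTop
      (𝓝 (1 - normalBall κ r)) := by
  rw [Metric.tendsto_nhds]
  intro ε hε
  -- For s ≤ r/4 the squares (r - 3s)², (r - s)² and (r + s)², (r + 2s)² are separated by more than
  -- the error sr. The strips between r - 3s, r and r + 2s have normal probability at most 6s ≤ ε/4.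
  set s := min (r / 4) (ε / 24) with hs
  have hs0 : 0 < s := lt_min (by positivity) (by positivity)
  have hsr : s ≤ r / 4 := min_le_left _ _
  have hsε : s ≤ ε / 24 := min_le_right _ _
  have hε4 : 0 < ε / 4 := by positivity
  have hgood := (hc s hs0 (by linarith)).and (hY (s * r) (by positivity))
  filter_upwards [wpa1_iff_real.1 hgood (ε / 4) hε4, hb,
    Metric.tendsto_nhds.1 (h.tendsto_abs_sub_le hX κ (r - 3 * s)) (ε / 4) hε4,
    Metric.tendsto_nhds.1 (h.tendsto_abs_sub_le hX κ (r + 2 * s)) (ε / 4) hε4]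
    with n h1 h2 h3 h4
  have hbad := measureReal_le_of_le_ofReal hε4.le h1
  have hm : ∀ ρ : ℝ, (law (P n) n).real {z | ¬ |X n z - κ| ≤ ρ} =
      1 - (law (P n) n).real {z | |X n z - κ| ≤ ρ} := fun ρ =>
    measureReal_not _ (measurableSet_le ((hX n).sub_const κ).abs measurable_const)
  have s1 : {z | c n z ≤ Y n z} ⊆ {z | ¬ |X n z - κ| ≤ r - 3 * s} ∪
      {z | ¬ (((r - s) ^ 2 ≤ c n z * b n ∧ c n z * b n ≤ (r + s) ^ 2) ∧
        |b n * Y n z - (X n z - κ) ^ 2| ≤ s * r)} := by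
    intro z hz
    by_cases hg : ((r - s) ^ 2 ≤ c n z * b n ∧ c n z * b n ≤ (r + s) ^ 2) ∧
        |b n * Y n z - (X n z - κ) ^ 2| ≤ s * r
    · left
      intro hle
      have e1 : c n z * b n ≤ b n * Y n z := by
        rw [mul_comm]; exact mul_le_mul_of_nonneg_left hz h2.le
      have e2 := (abs_le.1 hg.2).2
      have e3 : (X n z - κ) ^ 2 ≤ (r - 3 * s) ^ 2 := by
        rw [← sq_abs (X n z - κ)]; exact pow_le_pow_left₀ (abs_nonneg _) hle 2
      nlinarith [hg.1.1]
    · exact Or.inr hg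
  have s2 : {z | ¬ |X n z - κ| ≤ r + 2 * s} ⊆ {z | c n z ≤ Y n z} ∪
      {z | ¬ (((r - s) ^ 2 ≤ c n z * b n ∧ c n z * b n ≤ (r + s) ^ 2) ∧
        |b n * Y n z - (X n z - κ) ^ 2| ≤ s * r)} := by
    intro z hz
    by_cases hg : ((r - s) ^ 2 ≤ c n z * b n ∧ c n z * b n ≤ (r + s) ^ 2) ∧
        |b n * Y n z - (X n z - κ) ^ 2| ≤ s * r
    · left
      have hlt : r + 2 * s < |X n z - κ| := not_le.1 hz
      have e2 := (abs_le.1 hg.2).1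
      have e3 : (r + 2 * s) ^ 2 ≤ (X n z - κ) ^ 2 := by
        rw [← sq_abs (X n z - κ)]; exact pow_le_pow_left₀ (by positivity) hlt.le 2
      have e4 : c n z * b n ≤ Y n z * b n := by nlinarith [hg.1.2]
      exact le_of_mul_le_mul_right e4 h2
    · exact Or.inr hg
  have b1 := (measureReal_mono (μ := law (P n) n) s1).trans (measureReal_union_le _ _)
  have b2 := (measureReal_mono (μ := law (P n) n) s2).trans (measureReal_union_le _ _)
  rw [hm] at b1 b2
  have n1 := normalBall_le_add κ (show r - 3 * s ≤ r by linarith)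
  have n2 := normalBall_le_add κ (show r ≤ r + 2 * s by linarith)
  rw [Real.dist_eq, abs_lt] at h3 h4 ⊢
  constructor <;> linarith [h3.1, h3.2, h4.1, h4.2]

end Limits

/-! ### Expansions of the sample and bootstrap statistics -/

section Statistics

variable {dθ dρ : ℕ} {𝒳 𝒴 H Ω : Type*} [MeasurableSpace 𝒳] [MeasurableSpace 𝒴]
  [NormedAddCommGroup H] [NormedSpace ℝ H]
  [MeasurableSpace Ω] {S : Setting dθ dρ 𝒳 𝒴 H} {T : Bootstrap dθ 𝒳 𝒴 H Ω}
  {β : ℕ → Par dθ H} {P : ℕ → ProbabilityMeasure (𝒳 × 𝒴)}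

namespace Setting

lemma LQA.quadExp {B : ∀ n, Sample n 𝒳 𝒴 → ℝ} (hL : S.LQA β P B)
    (hTn : ∀ R, ∀ᶠ n : ℕ in atTop, ∀ τ : ℝ, |τ| ≤ R → τ / √n ∈ S.Tn n) :
    QuadExp S (wpF P) (fun i => i.1) (fun i => S.QHat i.1 i.2)
      (fun i α => √i.1 * (S.Zn i.1 (β i.1) i.2 + S.ip (S.u i.1) (α - β i.1)))
      fun i => B i.1 i.2 := by
  obtain ⟨s, -, hs, h⟩ := hL.expansion
  exact quadExp_of_expansion (tendsto_fst_wpF P) hTn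
    (m := fun i α => S.Zn i.1 (β i.1) i.2 + S.ip (S.u i.1) (α - β i.1)) hs
    fun ε hε => (h ε hε).eventually

/-- The constant sequence is admissible, so the results for drifting parameters include the null
model. -/
lemma nearNull_const : S.NearNull fun _ => S.alpha0 where
  mem := by simp
  rate := by
    refine ⟨0, one_pos, Eventually.of_forall fun n => ?_⟩
    simp [nrm_zero, normS]

end Setting

lemma Bootstrap.LQAB.quadExp {Bω : ∀ n, Sample n 𝒳 𝒴 → Ω → ℝ} (hL : T.LQAB S β P Bω)
    (hTn : ∀ R, ∀ᶠ n : ℕ in atTop, ∀ τ : ℝ, |τ| ≤ R → τ / √n ∈ S.Tn n) :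
    QuadExp S (bwF P T.PΩ) (fun i => i.1) (fun i => T.QHatB S i.1 i.2.1 i.2.2)
      (fun i α => √i.1 * (S.ZnW i.1 (fun j => T.wt i.1 j i.2.2) (β i.1) i.2.1 +
        S.ip (S.u i.1) (α - β i.1)))
      fun i => Bω i.1 i.2.1 i.2.2 := by
  obtain ⟨s, hs0, hs, h⟩ := hL.expansion
  refine quadExp_of_expansion (tendsto_fst_bwF P T.PΩ) hTn
    (m := fun i α => S.ZnW i.1 (fun j => T.wt i.1 j i.2.2) (β i.1) i.2.1 +
        S.ip (S.u i.1) (α - β i.1)) hs fun ε hε => ?_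
  rw [eventually_bwF]
  intro ε' hε'
  -- The single ε of the expansion controls both the error and the conditional probability;
  -- positivity of `s` keeps the maximum nonnegative, so that enlarging ε enlarges the bound.
  refine (h (min ε ε') (lt_min hε hε')).mono (Eventually.of_forall fun n z hz => ?_)
  refine (measure_mono ?_).trans (hz.trans (ENNReal.ofReal_le_ofReal (min_le_right _ _)))
  refine fun w hw hw' => hw fun α hα t ht => (hw' α hα t ht).trans ?_
  exact mul_le_mul_of_nonneg_right (min_le_left _ _) ((hs0 n).le.trans (le_max_right _ _))

lemma Bootstrap.ZnW_eq_ZnB_add (n : ℕ) (γ : Par dθ H) (z : Sample n 𝒳 𝒴) (w : Ω) :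
    S.ZnW n (fun i => T.wt n i w) γ z = T.ZnB S n γ z w + S.Zn n γ z := by
  simp only [ZnB, Setting.Zn, Setting.ZnW]
  rw [← mul_add, ← Finset.sum_add_distrib]
  congr 1
  refine Finset.sum_congr rfl fun i _ => ?_
  ring

lemma Bootstrap.Weights.measurable_ZnB (hW : T.Weights) (n : ℕ) (γ : Par dθ H)
    (z : Sample n 𝒳 𝒴) : Measurable (T.ZnB S n γ z) := by
  have := hW.meas
  unfold ZnB Setting.ZnW
  fun_prop

lemma Bootstrap.LQAB.bootBounded (hW : T.Weights) {Bω : ∀ n, Sample n 𝒳 𝒴 → Ω → ℝ}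
    (hL : T.LQAB S β P Bω) :
    BootBounded P T.PΩ fun n z w => √n * T.ZnB S n (β n) z w / T.sigma :=
  hL.clt.bootBounded fun n z => ((hW.measurable_ZnB n _ z).const_mul _).div_const _

variable [StandardBorelSpace 𝒴] [Nonempty 𝒴]

namespace Setting

lemma LocalAlt.nearNull (hS : S.Basic) {d : ℕ → ℝ} {Δ : ℕ → Par dθ H} {κ : ℝ}
    (hA : S.LocalAlt d Δ κ) (hβ : ∀ n, β n = S.alpha0 + d n • Δ n) : S.NearNull β where
  mem := by
    filter_upwards [hA.dir_mem] with n hn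
    rw [hβ, add_sub_cancel_left]
    exact (S.Vk n).smul_mem _ hn
  rate := by
    obtain ⟨ϑ, h1, h2⟩ := hA.rate
    refine ⟨ϑ, h1, h2.mono fun n hn => ?_⟩
    rwa [hβ, add_sub_cancel_left, hS.nrm_smul, normS_smul, abs_of_nonneg (hA.d_nonneg n)]

/-- Near the null parameter, the linear term centred at `β` is an affine function of
`α - α₀`. -/
lemma Basic.eventually_ip_sub (hS : S.Basic) (hR : S.Riesz) {c C : ℝ} (hsc : S.ScaleBounds c C)
    (hβ : S.NearNull β) : ∀ᶠ n in atTop, ∀ α ∈ S.Nosn n,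
      S.ip (S.u n) (α - β n) = S.ip (S.u n) (α - S.alpha0) - S.ip (S.u n) (β n - S.alpha0) := by
  filter_upwards [hR.vk_le, hsc.bounds, hβ.mem, hS.eventually_Nosn_subset] with n h1 h2 h3 h4 α hα
  rw [← hS.ip_sub_right (h1 h2.2.1) (sub_mem_V (h4 hα).1) (h1 h3)]
  congr 1
  abel

lemma LQA.boundedP (hS : S.Basic) {B : ∀ n, Sample n 𝒳 𝒴 → ℝ} (hL : S.LQA β P B) :
    BoundedP P fun n z => √n * S.Zn n (β n) z :=
  hL.clt.boundedP fun n => (hS.measurable_ZnW n _ _).const_mul _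

/-- The first order condition of the estimator. -/
lemma LQA.tendsto_foc (hS : S.Basic) (hR : S.Riesz) (hFeas : S.LocalFeasible) {c₀ c₁ : ℝ}
    {B : ∀ n, Sample n 𝒳 𝒴 → ℝ} (hL : S.LQA β P B) (hD : S.Dgp β P c₁)
    (hD₀ : S.Dgp (fun _ => S.alpha0) (fun _ => S.P0) c₀) (hβ : S.NearNull β) :
    Tendsto (fun i : Σ n, Sample n 𝒳 𝒴 => √i.1 * (S.Zn i.1 (β i.1) i.2 +
      S.ip (S.u i.1) (S.est i.1 i.2 - β i.1))) (wpF P) (𝓝 0) := by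
  have hq := hL.quadExp (hD₀.eventually_mem_Tn hS)
  -- Boundedness of the quadratic coefficient suffices, so the centring of the bootstrap does not
  -- rely on `B` being close to ‖u_n‖².
  refine tendsto_wpF_of_boundedP hL.B_bdd fun K => ?_
  have hle : wpF P ⊓ 𝓟 {i | |B i.1 i.2| ≤ K} ≤ wpF P := inf_le_left
  have h := (hq.mono hle).tendsto_foc (a := fun i => S.est i.1 i.2) hS hFeas
    ((tendsto_fst_wpF P).mono_left hle) (hD₀.eventually_mem_Tn hS)
    (fun i => hS.QHatW_nonneg _ _ _)
    (eventually_inf_principal.2 (Eventually.of_forall fun _ h => h))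
    ((hD.eventually_est_mem_Nosn hS hR hD₀ hβ).filter_mono hle)
    (hD.est_min.eventually.filter_mono hle)
  exact h

/-- Recentring the linear term from β at α₀ makes the drift part of `ζ`; the restriction is at the
level φ(α₀), hence `x = 0`. -/
lemma LQA.qlrSetup (hS : S.Basic) (hR : S.Riesz) {c C c₀ c₁ : ℝ} (hsc : S.ScaleBounds c C)
    {B : ∀ n, Sample n 𝒳 𝒴 → ℝ} (hL : S.LQA β P B) (hD : S.Dgp β P c₁)
    (hD₀ : S.Dgp (fun _ => S.alpha0) (fun _ => S.P0) c₀) (hβ : S.NearNull β)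
    (hB : SmallP P fun n z => B n z - S.nrm (S.u n) ^ 2) (hRest : S.RestrictedEst P) :
    QLRSetup S (wpF P) (fun i => i.1) (fun i => S.QHat i.1 i.2)
      (fun i α => √i.1 * (S.Zn i.1 (β i.1) i.2 + S.ip (S.u i.1) (α - β i.1)))
      (fun i => S.est i.1 i.2) (fun i => S.estR i.1 i.2)
      (fun i => √i.1 * S.Zn i.1 (β i.1) i.2 - √i.1 * S.ip (S.u i.1) (β i.1 - S.alpha0))
      (fun _ => 0) (fun _ => S.phi S.alpha0) where
  tendsto_N := tendsto_fst_wpF P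
  nonneg i := hS.QHatW_nonneg _ _ _
  exp := by
    have h := hL.quadExp (hD₀.eventually_mem_Tn hS)
    have h' := smallP_iff_tendsto.1 hB
    exact h.congr_quad h'
  lin := by
    filter_upwards [(tendsto_fst_wpF P).eventually (hS.eventually_ip_sub hR hsc hβ)] with i hi α hα
    rw [hi α hα]; ring
  mem := hD.eventually_est_mem_Nosn hS hR hD₀ hβ
  memR := by
    have h := hRest.estR_mem.eventually
    exact h
  estMin := by
    have h := hD.est_min.eventually
    exact h
  estRMin := by
    have h := hRest.estR_min.eventually
    exact h
  level := by simp only [sub_self, mul_zero, zero_div]; exact tendsto_const_nhds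

/-- The expansion of the quasi likelihood ratio statistic. -/
lemma LQA.smallP_qlr (hS : S.Basic) (hR : S.Riesz) (hφ : S.PhiLocal) (hFeas : S.LocalFeasible)
    {c C c₀ c₁ : ℝ} (hsc : S.ScaleBounds c C)
    {B : ∀ n, Sample n 𝒳 𝒴 → ℝ} (hL : S.LQA β P B) (hD : S.Dgp β P c₁)
    (hD₀ : S.Dgp (fun _ => S.alpha0) (fun _ => S.P0) c₀) (hβ : S.NearNull β)
    (hB : SmallP P fun n z => B n z - S.nrm (S.u n) ^ 2) (hRest : S.RestrictedEst P) {K : ℝ}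
    (hK : ∀ᶠ n : ℕ in atTop, |√n * S.ip (S.u n) (β n - S.alpha0)| ≤ K) :
    SmallP P fun n z => S.QLR n z -
      (√n * S.Zn n (β n) z - √n * S.ip (S.u n) (β n - S.alpha0)) ^ 2 / S.nrm (S.u n) ^ 2 := by
  rw [smallP_iff_tendsto]
  -- On |√n ℤ_n| ≤ M the shifted score is bounded by M + K, as the expansion of the likelihood ratio
  -- requires.
  refine tendsto_wpF_of_boundedP (hL.boundedP hS) fun M => ?_
  have hle : wpF P ⊓ 𝓟 {i | |√i.1 * S.Zn i.1 (β i.1) i.2| ≤ M} ≤ wpF P := inf_le_left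
  have h := ((hL.qlrSetup hS hR hsc hD hD₀ hβ hB hRest).mono hle).tendsto_qlr hS hR hφ hFeas hsc
    (hD₀.eventually_mem_Tn hS) (K := M + K) (by
      rw [eventually_inf_principal]
      filter_upwards [(tendsto_fst_wpF P).eventually hK] with i h1 h2
      rw [add_zero]
      exact (abs_sub _ _).trans (add_le_add h2 h1))
  simp only [add_zero] at h
  exact h

end Setting

namespace Bootstrap

/-- The restriction is at the level φ(α̂), so linearizing φ at the sample estimator gives `x`. The
estimator itself satisfies the restriction, which is what localizes the restricted bootstrap
minimizer. -/
lemma LQAB.qlrSetup (hS : S.Basic) (hR : S.Riesz) (hφ : S.PhiLocal) {c C c₀ c₁ cs : ℝ}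
    (hsc : S.ScaleBounds c C)
    {Bω : ∀ n, Sample n 𝒳 𝒴 → Ω → ℝ} (hL : T.LQAB S β P Bω) (hD : S.Dgp β P c₁)
    (hD₀ : S.Dgp (fun _ => S.alpha0) (fun _ => S.P0) c₀) (hβ : S.NearNull β)
    (hC : T.Crit S β P c₁ cs)
    (hB : BootSmall P T.PΩ fun n z w => Bω n z w - S.nrm (S.u n) ^ 2) :
    QLRSetup S (bwF P T.PΩ) (fun i => i.1) (fun i => T.QHatB S i.1 i.2.1 i.2.2)
      (fun i α => √i.1 * (S.ZnW i.1 (fun j => T.wt i.1 j i.2.2) (β i.1) i.2.1 +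
        S.ip (S.u i.1) (α - β i.1)))
      (fun i => T.estB i.1 i.2.1 i.2.2) (fun i => T.estRB i.1 i.2.1 i.2.2)
      (fun i => √i.1 * (S.ZnW i.1 (fun j => T.wt i.1 j i.2.2) (β i.1) i.2.1 -
        S.ip (S.u i.1) (β i.1 - S.alpha0)))
      (fun i => √i.1 * S.ip (S.u i.1) (S.est i.1 i.2.1 - S.alpha0))
      (fun i => S.phi (S.est i.1 i.2.1)) where
  tendsto_N := tendsto_fst_bwF P T.PΩ
  nonneg i := hS.QHatW_nonneg _ _ _
  exp := by
    have h := hL.quadExp (hD₀.eventually_mem_Tn hS)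
    have h' := bootSmall_iff_tendsto.1 hB
    exact h.congr_quad h'
  lin := by
    filter_upwards [(tendsto_fst_bwF P T.PΩ).eventually (hS.eventually_ip_sub hR hsc hβ)]
      with i hi α hα
    rw [hi α hα]; ring
  mem := by
    have h := hC.estB_min.eventually
    exact hC.eventually_mem_Nosn hS hR hD hD₀ hβ (hC.eventually_mem_AkM
      (A := fun i => S.Ak i.1) hS hD h (fun _ => subset_rfl) fun _ h => h)
  memR := by
    have h := hC.estRB_min.eventually
    exact hC.eventually_mem_Nosn hS hR hD hD₀ hβ (hC.eventually_mem_AkM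
      (A := fun i => S.AkR i.1 (S.phi (S.est i.1 i.2.1))) hS hD h (fun _ _ h => h.1)
      fun _ h => ⟨h, rfl⟩)
  estMin := by
    have h := hC.estB_min.eventually
    exact h
  estRMin := by
    have h := hC.estRB_min.eventually
    exact h
  level := by
    have h : Tendsto (fun i : Σ n, Sample n 𝒳 𝒴 => √i.1 * (S.phi (S.est i.1 i.2) -
        S.phi S.alpha0) / S.sd i.1 - √i.1 * S.ip (S.u i.1) (S.est i.1 i.2 - S.alpha0))
        (wpF P) (𝓝 0) := by
      rw [Metric.nhds_basis_closedBall.tendsto_right_iff]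
      intro ε hε
      filter_upwards [hD.eventually_est_mem_Nosn hS hR hD₀ hβ,
        (tendsto_fst_wpF P).eventually (hφ.eventually_linear hS hR hsc hε
          (hD₀.eventually_mem_Tn hS 0))] with i h1 h2
      have h3 := h2 _ h1 0 (by simp)
      rw [zero_div, zero_smul, add_zero, zero_mul, add_zero] at h3
      rwa [Metric.mem_closedBall, dist_zero_right]
    have h' := h.comp (tendsto_bwF_wpF P T.PΩ)
    exact h'

/-- The expansion of the bootstrap quasi likelihood ratio statistic. -/
lemma LQAB.bootSmall_qlr (hS : S.Basic) (hR : S.Riesz) (hφ : S.PhiLocal)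
    (hFeas : S.LocalFeasible) (hW : T.Weights) {c C c₀ c₁ cs : ℝ} (hsc : S.ScaleBounds c C)
    {B : ∀ n, Sample n 𝒳 𝒴 → ℝ} {Bω : ∀ n, Sample n 𝒳 𝒴 → Ω → ℝ} (hL : T.LQAB S β P Bω)
    (hL₁ : S.LQA β P B) (hD : S.Dgp β P c₁)
    (hD₀ : S.Dgp (fun _ => S.alpha0) (fun _ => S.P0) c₀) (hβ : S.NearNull β)
    (hC : T.Crit S β P c₁ cs)
    (hB : BootSmall P T.PΩ fun n z w => Bω n z w - S.nrm (S.u n) ^ 2) :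
    BootSmall P T.PΩ fun n z w => T.QLRB S n z w / T.sigma ^ 2 -
      (√n * T.ZnB S n (β n) z w / T.sigma) ^ 2 / S.nrm (S.u n) ^ 2 := by
  have hσ := hW.sigma_pos
  have hN := tendsto_fst_bwF P T.PΩ
  rw [bootSmall_iff_tendsto]
  refine tendsto_bwF_of_bootBounded (hL.bootBounded hW) fun M => ?_
  set F := bwF P T.PΩ ⊓ 𝓟 {i | |√i.1 * T.ZnB S i.1 (β i.1) i.2.1 i.2.2 / T.sigma| ≤ M}
  have hle : F ≤ bwF P T.PΩ := inf_le_left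
  set U : (Σ n, Sample n 𝒳 𝒴 × Ω) → ℝ := fun i => √i.1 * T.ZnB S i.1 (β i.1) i.2.1 i.2.2
  set E : (Σ n, Sample n 𝒳 𝒴 × Ω) → ℝ := fun i =>
    √i.1 * (S.ZnW i.1 (fun j => T.wt i.1 j i.2.2) (β i.1) i.2.1 -
      S.ip (S.u i.1) (β i.1 - S.alpha0)) +
      √i.1 * S.ip (S.u i.1) (S.est i.1 i.2.1 - S.alpha0)
  -- The difference is exactly √n(ℤ_n(β) + ⟨u, α̂ - β⟩), which vanishes by the first order condition
  -- of the sample estimator. This is where the drift drops out and the weights ω turn into ω - 1.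
  have hEU : Tendsto (fun i => E i - U i) F (𝓝 0) := by
    have h1 := ((hL₁.tendsto_foc hS hR hFeas hD hD₀ hβ).comp
      (tendsto_bwF_wpF P T.PΩ)).mono_left hle
    refine h1.congr' ?_
    filter_upwards [(hN.mono_left hle).eventually (hS.eventually_ip_sub hR hsc hβ),
      ((tendsto_bwF_wpF P T.PΩ).mono_left hle).eventually
        (hD.eventually_est_mem_Nosn hS hR hD₀ hβ)] with i h2 h3
    simp only [E, U, Function.comp_apply]
    rw [h2 _ h3, ZnW_eq_ZnB_add]
    ring
  have hU : ∀ᶠ i in F, |U i| ≤ M * T.sigma := by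
    refine eventually_inf_principal.2 (Eventually.of_forall fun i hi => ?_)
    have hi' : |U i / T.sigma| ≤ M := hi
    rwa [abs_div, abs_of_pos hσ, div_le_iff₀ hσ] at hi'
  have hE : ∀ᶠ i in F, |E i| ≤ M * T.sigma + 1 := by
    filter_upwards [hU, Metric.tendsto_nhds.1 hEU 1 one_pos] with i h1 h2
    rw [dist_zero_right, Real.norm_eq_abs] at h2
    have := abs_sub_abs_le_abs_sub (E i) (U i)
    linarith
  have h := ((hL.qlrSetup hS hR hφ hsc hD hD₀ hβ hC hB).mono hle).tendsto_qlr hS hR hφ hFeas hsc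
    (hD₀.eventually_mem_Tn hS) hE
  have hsq : Tendsto (fun i => (E i ^ 2 - U i ^ 2) / S.nrm (S.u i.1) ^ 2) F (𝓝 0) := by
    have hbd : Tendsto (fun i => |E i - U i| * ((2 * (M * T.sigma) + 1) / c)) F (𝓝 0) := by
      simpa using hEU.abs.mul_const ((2 * (M * T.sigma) + 1) / c)
    refine squeeze_zero_norm' ?_ hbd
    filter_upwards [hU, hE, (hN.mono_left hle).eventually hsc.bounds] with i h1 h2 h3
    have hb : 0 < S.nrm (S.u i.1) ^ 2 := hsc.pos.trans_le h3.2.2.1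
    have h4 : |E i + U i| ≤ 2 * (M * T.sigma) + 1 := (abs_add_le _ _).trans (by linarith)
    rw [Real.norm_eq_abs, sq_sub_sq, abs_div, abs_mul, abs_of_pos hb, mul_comm |E i + U i|,
      mul_div_assoc]
    exact mul_le_mul_of_nonneg_left (div_le_div₀ ((abs_nonneg _).trans h4) h4 hsc.pos h3.2.2.1)
      (abs_nonneg _)
  have h5 := (h.add hsq).div_const (T.sigma ^ 2)
  rw [add_zero, zero_div] at h5
  refine h5.congr fun i => ?_
  change ((i.1 : ℝ) * (_ - _) - E i ^ 2 / _ + _) / _ = T.QLRB S i.1 i.2.1 i.2.2 / T.sigma ^ 2 -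
    (U i / T.sigma) ^ 2 / _
  rw [QLRB, div_pow, sub_div (E i ^ 2)]
  ring

end Bootstrap

end Statistics

/-! ### Critical values, null distribution and local power -/

section Tests

variable {dθ dρ : ℕ} {𝒳 𝒴 H Ω : Type*} [MeasurableSpace 𝒳] [MeasurableSpace 𝒴]
  [NormedAddCommGroup H] [NormedSpace ℝ H]
  [MeasurableSpace Ω] {S : Setting dθ dρ 𝒳 𝒴 H} {T : Bootstrap dθ 𝒳 𝒴 H Ω}
  {β : ℕ → Par dθ H} {P : ℕ → ProbabilityMeasure (𝒳 × 𝒴)}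

lemma exists_normalBall_eq {τ : ℝ} (h0 : 0 < τ) (h1 : τ < 1) :
    ∃ r, 0 < r ∧ normalBall 0 r = 1 - τ := by
  obtain ⟨R, hR, hR0⟩ := (((tendsto_normalBall 0).eventually
    (lt_mem_nhds (show 1 - τ < 1 by linarith))).and (eventually_ge_atTop 0)).exists
  obtain ⟨r, hr, hrτ⟩ := intermediate_value_Icc hR0 (continuous_normalBall 0).continuousOn
    (show 1 - τ ∈ Set.Icc (normalBall 0 0) (normalBall 0 R) by
      rw [normalBall_zero]; exact ⟨by linarith, hR.le⟩)
  refine ⟨r, lt_of_le_of_ne hr.1 ?_, hrτ⟩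
  rintro rfl
  rw [normalBall_zero] at hrτ
  linarith

lemma Setting.ScaleBounds.eventually_nrm_sq {c C : ℝ} (hsc : S.ScaleBounds c C) :
    ∀ᶠ n in atTop, 0 < S.nrm (S.u n) ^ 2 ∧ S.nrm (S.u n) ^ 2 ≤ C :=
  hsc.bounds.mono fun _ h => ⟨hsc.pos.trans_le h.2.2.1, h.2.2.2⟩

/-- Convergence of the bootstrap critical values. -/
lemma Bootstrap.wpa1_quantB {b : ℕ → ℝ} (hb : ∀ᶠ n in atTop, 0 < b n)
    (hcdf : ∀ η : ℝ, 0 < η → Wpa1 P fun n z => ∀ t,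
      |T.cdfB S n z t - normalBall 0 √(t * b n)| ≤ η) {r s : ℝ} (hs : 0 < s) (hsr : s < r) :
    Wpa1 P fun n z => (r - s) ^ 2 ≤ T.quantB S n (normalBall 0 r) z * b n ∧
      T.quantB S n (normalBall 0 r) z * b n ≤ (r + s) ^ 2 := by
  have h1 := normalBall_strictMono 0 (show 0 ≤ r - s by linarith) (show r - s < r by linarith)
  have h2 := normalBall_strictMono 0 (show 0 ≤ r by linarith) (show r < r + s by linarith)
  -- Half of the smaller gap at r ± s leaves the strict inequality needed below the quantile.
  set η := min (normalBall 0 r - normalBall 0 (r - s))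
    (normalBall 0 (r + s) - normalBall 0 r) / 2 with hη
  have hη0 : 0 < η := half_pos (lt_min (by linarith) (by linarith))
  have h3 : 2 * η ≤ normalBall 0 r - normalBall 0 (r - s) := by
    rw [hη, mul_div_cancel₀ _ two_ne_zero]; exact min_le_left _ _
  have h4 : 2 * η ≤ normalBall 0 (r + s) - normalBall 0 r := by
    rw [hη, mul_div_cancel₀ _ two_ne_zero]; exact min_le_right _ _
  refine (hcdf η hη0).mono (hb.mono fun n hn z hz => ?_)
  exact sInf_quantile_mem hn (by linarith) (by linarith) hz (by linarith) (by linarith)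

/-- The conditional distribution function of the bootstrap statistic. -/
lemma Bootstrap.LQAB.wpa1_cdfB (hW : T.Weights) {c C : ℝ} (hsc : S.ScaleBounds c C)
    {Bω : ∀ n, Sample n 𝒳 𝒴 → Ω → ℝ} (hL : T.LQAB S β P Bω)
    (hq : BootSmall P T.PΩ fun n z w => T.QLRB S n z w / T.sigma ^ 2 -
      (√n * T.ZnB S n (β n) z w / T.sigma) ^ 2 / S.nrm (S.u n) ^ 2) {η : ℝ} (hη : 0 < η) :
    Wpa1 P fun n z => ∀ t,
      |T.cdfB S n z t - normalBall 0 √(t * S.nrm (S.u n) ^ 2)| ≤ η :=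
  hL.clt.wpa1_cdf (fun n z => ((hW.measurable_ZnB n _ z).const_mul _).div_const _)
    hsc.eventually_nrm_sq hq hη

/-- The bootstrap approximates the null distribution of the quasi likelihood ratio statistic. -/
lemma Bootstrap.bootSmall_iSup_cdf
    (hcdf : ∀ η : ℝ, 0 < η → Wpa1 P fun n z => ∀ t,
      |T.cdfB S n z t - normalBall 0 √(t * S.nrm (S.u n) ^ 2)| ≤ η)
    (hnull : ∀ η : ℝ, 0 < η → ∀ᶠ n in atTop, ∀ t, |(law S.P0 n).real {z | S.QLR n z ≤ t} -
      normalBall 0 √(t * S.nrm (S.u n) ^ 2)| ≤ η) :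
    BootSmall P T.PΩ fun n z _ => ⨆ t : ℝ,
      |T.cdfB S n z t - (law S.P0 n).real {z' | S.QLR n z' ≤ t}| := by
  have key : Tendsto (fun i : Σ n, Sample n 𝒳 𝒴 => ⨆ t : ℝ,
      |T.cdfB S i.1 i.2 t - (law S.P0 i.1).real {z' | S.QLR i.1 z' ≤ t}|) (wpF P) (𝓝 0) := by
    rw [Metric.nhds_basis_closedBall.tendsto_right_iff]
    intro ε hε
    have h := (hcdf (ε / 2) (half_pos hε)).eventually
    filter_upwards [h, (tendsto_fst_wpF P).eventually (hnull (ε / 2) (half_pos hε))]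
      with i h1 h2
    rw [Metric.mem_closedBall, dist_zero_right, Real.norm_eq_abs,
      abs_of_nonneg (Real.iSup_nonneg fun _ => abs_nonneg _)]
    refine Real.iSup_le (fun t => ?_) hε.le
    have := abs_le.1 (h1 t)
    have := abs_le.1 (h2 t)
    rw [abs_le]
    constructor <;> linarith
  have h := key.comp (tendsto_bwF_wpF P T.PΩ)
  rw [bootSmall_iff_tendsto]
  exact h

lemma Bootstrap.LQAB.bootBounded_sq (hW : T.Weights) {c C : ℝ} (hsc : S.ScaleBounds c C)
    {Bω : ∀ n, Sample n 𝒳 𝒴 → Ω → ℝ} (hL : T.LQAB S β P Bω) :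
    BootBounded P T.PΩ fun n z w =>
      (√n * T.ZnB S n (β n) z w / T.sigma) ^ 2 / S.nrm (S.u n) ^ 2 := by
  have h := hL.bootBounded hW
  rw [bootBounded_iff] at h ⊢
  intro ε hε
  obtain ⟨M, hM, h⟩ := h ε hε
  have hc := hsc.pos
  refine ⟨M ^ 2 / c, by positivity, h.mono ?_⟩
  filter_upwards [hsc.bounds] with n hn z hz
  refine (measure_mono ?_).trans hz
  intro w hw hw'
  refine hw ?_
  have hw'' : |√n * T.ZnB S n (β n) z w / T.sigma| ≤ M := hw'
  rw [abs_of_nonneg (by positivity), ← sq_abs]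
  exact div_le_div₀ (by positivity) (pow_le_pow_left₀ (abs_nonneg _) hw'' 2) hc hn.2.2.1

variable [StandardBorelSpace 𝒴] [Nonempty 𝒴]

/-- The null distribution function of the quasi likelihood ratio statistic. -/
lemma Setting.LQA.eventually_null_cdf (hS : S.Basic) (hR : S.Riesz) (hφ : S.PhiLocal)
    (hFeas : S.LocalFeasible) {c C c₀ : ℝ} (hsc : S.ScaleBounds c C)
    {B : ∀ n, Sample n 𝒳 𝒴 → ℝ} (hL : S.LQA (fun _ => S.alpha0) (fun _ => S.P0) B)
    (hD : S.Dgp (fun _ => S.alpha0) (fun _ => S.P0) c₀)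
    (hB : SmallP (fun _ => S.P0) fun n z => B n z - S.nrm (S.u n) ^ 2)
    (hRest : S.RestrictedEst fun _ => S.P0) {η : ℝ} (hη : 0 < η) :
    ∀ᶠ n in atTop, ∀ t, |(law S.P0 n).real {z | S.QLR n z ≤ t} -
      normalBall 0 √(t * S.nrm (S.u n) ^ 2)| ≤ η := by
  have h0 : ∀ n, S.ip (S.u n) (S.alpha0 - S.alpha0) = 0 := fun n => by simp [ip]
  have h := hL.smallP_qlr hS hR hφ hFeas hsc hD hD nearNull_const hB hRest (K := 0)
    (Eventually.of_forall fun n => by rw [h0, mul_zero, abs_zero])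
  simp only [h0, mul_zero, sub_zero] at h
  exact hL.clt.eventually_cdf (fun n => (hS.measurable_ZnW n _ _).const_mul _)
    hsc.eventually_nrm_sq h hη

namespace Setting

/-- The drift of the statistic along local alternatives. -/
lemma LocalAlt.eventually_drift (hS : S.Basic) (hR : S.Riesz) {c C : ℝ}
    (hsc : S.ScaleBounds c C) {d : ℕ → ℝ} {Δ : ℕ → Par dθ H} {κ : ℝ} (hA : S.LocalAlt d Δ κ)
    (hβ : ∀ n, β n = S.alpha0 + d n • Δ n) :
    ∀ᶠ n : ℕ in atTop, √n * d n / S.sd n * S.dphi (Δ n) =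
      √n * S.ip (S.u n) (β n - S.alpha0) := by
  filter_upwards [hR.eventually_dphi_eq hsc, hA.dir_mem, hsc.bounds] with n h1 h2 h3
  have := h3.1.ne'
  rw [h1 _ h2, hβ, add_sub_cancel_left, hS.ip_smul_right]
  field_simp

/-- Local power of a test with convergent critical values. -/
lemma LQA.tendsto_localPower (hS : S.Basic) (hR : S.Riesz) (hφ : S.PhiLocal)
    (hFeas : S.LocalFeasible) {c C c₀ c₁ : ℝ} (hsc : S.ScaleBounds c C)
    {B : ∀ n, Sample n 𝒳 𝒴 → ℝ} (hL : S.LQA β P B) (hD : S.Dgp β P c₁)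
    (hD₀ : S.Dgp (fun _ => S.alpha0) (fun _ => S.P0) c₀) (hβ : S.NearNull β)
    (hB : SmallP P fun n z => B n z - S.nrm (S.u n) ^ 2) (hRest : S.RestrictedEst P) {κ : ℝ}
    (hκ : Tendsto (fun n : ℕ => √n * S.ip (S.u n) (β n - S.alpha0)) atTop (𝓝 κ))
    {q : ∀ n, Sample n 𝒳 𝒴 → ℝ} {r : ℝ} (hr : 0 < r)
    (hq : ∀ s, 0 < s → s < r → Wpa1 P fun n z => (r - s) ^ 2 ≤ q n z * S.nrm (S.u n) ^ 2 ∧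
      q n z * S.nrm (S.u n) ^ 2 ≤ (r + s) ^ 2) :
    Tendsto (fun n => (law (P n) n).real {z | q n z ≤ S.QLR n z}) atTop
      (𝓝 (1 - normalBall κ r)) := by
  set k : ℕ → ℝ := fun n => √n * S.ip (S.u n) (β n - S.alpha0) with hk
  have hkK : ∀ᶠ n in atTop, |k n| ≤ |κ| + 1 :=
    (hκ.abs.eventually_lt_const (lt_add_one |κ|)).mono fun _ h => h.le
  have h1 := smallP_iff_tendsto.1 (hL.smallP_qlr hS hR hφ hFeas hsc hD hD₀ hβ hB hRest hkK)
  have hN := tendsto_fst_wpF P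
  refine hL.clt.tendsto_rejection (fun n => (hS.measurable_ZnW n _ _).const_mul _)
    (hsc.eventually_nrm_sq.mono fun _ h => h.1) hr ?_ hq
  rw [smallP_iff_tendsto]
  refine tendsto_wpF_of_boundedP (hL.boundedP hS) fun K => ?_
  set F := wpF P ⊓ 𝓟 {i | |√i.1 * S.Zn i.1 (β i.1) i.2| ≤ K}
  have hle : F ≤ wpF P := inf_le_left
  have h2 := (h1.mono_left hle).abs.mul_const C
  have h3 := ((hκ.comp hN).mono_left hle).sub_const κ |>.abs.mul_const (2 * K + (2 * |κ| + 1))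
  simp only [abs_zero, zero_mul, sub_self] at h2 h3
  have h4 := h2.add h3
  rw [add_zero] at h4
  refine squeeze_zero_norm' ?_ h4
  have hX : ∀ᶠ i in F, |√i.1 * S.Zn i.1 (β i.1) i.2| ≤ K :=
    eventually_inf_principal.2 (Eventually.of_forall fun _ h => h)
  filter_upwards [hX, (hN.mono_left hle).eventually hkK,
    (hN.mono_left hle).eventually hsc.eventually_nrm_sq] with i g1 g2 g3
  set X := √i.1 * S.Zn i.1 (β i.1) i.2
  -- Multiplication by b removes the nonconvergent scale; the second summand replaces the drift by
  -- its limit and is small because X is bounded on this event.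
  have hid : S.nrm (S.u i.1) ^ 2 * S.QLR i.1 i.2 - (X - κ) ^ 2 =
      (S.QLR i.1 i.2 - (X - k i.1) ^ 2 / S.nrm (S.u i.1) ^ 2) * S.nrm (S.u i.1) ^ 2 +
        (k i.1 - κ) * (k i.1 + κ - 2 * X) := by
    rw [sub_mul, div_mul_cancel₀ _ g3.1.ne']; ring
  rw [Real.norm_eq_abs, hid]
  refine (abs_add_le _ _).trans (add_le_add ?_ ?_)
  · rw [abs_mul, abs_of_pos g3.1]
    exact mul_le_mul_of_nonneg_left g3.2 (abs_nonneg _)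
  · rw [abs_mul]
    refine mul_le_mul_of_nonneg_left ?_ (abs_nonneg _)
    have e1 := abs_sub (k i.1 + κ) (2 * X)
    have e2 := abs_add_le (k i.1) κ
    rw [abs_mul, abs_two] at e1
    linarith

/-- Consistency of a test with bounded critical values. -/
lemma LQA.tendsto_power (hS : S.Basic) (hR : S.Riesz) (hφ : S.PhiLocal)
    (hFeas : S.LocalFeasible) {c C c₀ c₁ : ℝ} (hsc : S.ScaleBounds c C)
    {B : ∀ n, Sample n 𝒳 𝒴 → ℝ} (hL : S.LQA β P B) (hD : S.Dgp β P c₁)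
    (hD₀ : S.Dgp (fun _ => S.alpha0) (fun _ => S.P0) c₀) (hβ : S.NearNull β)
    (hB : SmallP P fun n z => B n z - S.nrm (S.u n) ^ 2) (hRest : S.RestrictedEst P)
    (hk : Tendsto (fun n : ℕ => |√n * S.ip (S.u n) (β n - S.alpha0)|) atTop atTop)
    {q : ∀ n, Sample n 𝒳 𝒴 → ℝ} {D : ℝ} (hq : Wpa1 P fun n z => q n z ≤ D) :
    Tendsto (fun n => (law (P n) n).real {z | q n z ≤ S.QLR n z}) atTop (𝓝 1) := by
  have hN := tendsto_fst_wpF P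
  have h1 := (hL.qlrSetup hS hR hsc hD hD₀ hβ hB hRest).eventually_le_qlr hS hR hφ hFeas hsc
    (hD₀.eventually_mem_Tn hS)
  simp only [add_zero] at h1
  have h2 := hq.eventually
  -- With the score bounded by K, a drift beyond K + D + C + 4 pushes the linear lower bound above
  -- D.
  have key : ∀ᶠ i in wpF P, q i.1 i.2 ≤ S.QLR i.1 i.2 := by
    refine eventually_wpF_of_tight
      (E := fun K n z => |√n * S.Zn n (β n) z| ≤ K) (fun ε hε => ?_) fun K => ?_
    · obtain ⟨M, hM⟩ := hL.boundedP hS ε hε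
      exact ⟨M, hM.mono fun n hn => by simpa only [not_le] using hn⟩
    · rw [eventually_inf_principal]
      filter_upwards [h1, h2, hN.eventually (hk.eventually_ge_atTop (K + (D + C + 4)))]
        with i g1 g2 g3 g4
      refine g2.trans (le_trans ?_ g1)
      have hg4 : |√i.1 * S.Zn i.1 (β i.1) i.2| ≤ K := g4
      have e1 := abs_sub_abs_le_abs_sub (√i.1 * S.ip (S.u i.1) (β i.1 - S.alpha0))
        (√i.1 * S.Zn i.1 (β i.1) i.2)
      have e2 := abs_nonneg (√i.1 * S.Zn i.1 (β i.1) i.2 -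
        √i.1 * S.ip (S.u i.1) (β i.1 - S.alpha0))
      rw [abs_sub_comm] at e1
      linarith
  exact Wpa1.tendsto_real key

end Setting

end Tests

end PSMD

/-! ### Bootstrap consistency and local power -/

theorem mainTheorem9 {dθ dρ : ℕ} {𝒳 𝒴 H Ω : Type*}
    [MeasurableSpace 𝒳] [MeasurableSpace 𝒴] [StandardBorelSpace 𝒴] [Nonempty 𝒴]
    [NormedAddCommGroup H] [NormedSpace ℝ H] [CompleteSpace H] [MeasurableSpace Ω]
    (S : PSMD.Setting dθ dρ 𝒳 𝒴 H) (T : PSMD.Bootstrap dθ 𝒳 𝒴 H Ω)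
    (hBasic : S.Basic) (hRiesz : S.Riesz) (hPhi : S.PhiLocal) (hFeas : S.LocalFeasible)
    (hW : T.Weights)
    -- the null model, for the null law of the statistic
    (c₀ : ℝ) (B₀ : ∀ n, PSMD.Sample n 𝒳 𝒴 → ℝ)
    (hDgp₀ : S.Dgp (fun _ => S.alpha0) (fun _ => S.P0) c₀)
    (hLQA₀ : S.LQA (fun _ => S.alpha0) (fun _ => S.P0) B₀)
    (hB₀ : PSMD.SmallP (fun _ => S.P0) fun n z => B₀ n z - S.nrm (S.u n) ^ 2)
    (hR₀ : S.RestrictedEst fun _ => S.P0)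
    -- the local alternatives
    (d : ℕ → ℝ) (Δ : ℕ → PSMD.Par dθ H) (κ : ℝ) (hAlt : S.LocalAlt d Δ κ)
    (α : ℕ → PSMD.Par dθ H) (hα : ∀ n, α n = S.alpha0 + d n • Δ n)
    (P : ℕ → ProbabilityMeasure (𝒳 × 𝒴)) (c₁ cs : ℝ)
    (B : ∀ n, PSMD.Sample n 𝒳 𝒴 → ℝ) (Bω : ∀ n, PSMD.Sample n 𝒳 𝒴 → Ω → ℝ)
    (hDgp : S.Dgp α P c₁) (hLQA : S.LQA α P B)
    (hCrit : T.Crit S α P c₁ cs) (hLQAB : T.LQAB S α P Bω)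
    (hBω : PSMD.BootSmall P T.PΩ fun n z w => Bω n z w - S.nrm (S.u n) ^ 2) :
    -- the bootstrap statistic is correctly centred and stochastically bounded
    PSMD.BootSmall P T.PΩ (fun n z w => T.QLRB S n z w / T.sigma ^ 2 -
      (√n * T.ZnB S n (α n) z w / (T.sigma * S.nrm (S.u n))) ^ 2) ∧
    PSMD.BootBounded P T.PΩ (fun n z w => T.QLRB S n z w / T.sigma ^ 2) ∧
    PSMD.BootBounded P T.PΩ (fun n z w =>
      (√n * T.ZnB S n (α n) z w / (T.sigma * S.nrm (S.u n))) ^ 2) ∧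
    -- its conditional distribution function approximates the null one of the original statistic
    PSMD.BootSmall P T.PΩ (fun n z _ => ⨆ t : ℝ,
      |T.cdfB S n z t - (PSMD.law S.P0 n).real {z' | S.QLR n z' ≤ t}|) ∧
    -- local power
    (PSMD.SmallP P (fun n z => B n z - S.nrm (S.u n) ^ 2) → S.RestrictedEst P →
      ∀ τ : ℝ, 0 < τ → τ < 1 →
        ((∀ᶠ n : ℕ in atTop, d n = S.sd n / √n) →
          ∃ ℓ : ℝ, τ < ℓ ∧ ℓ < 1 ∧ Tendsto
            (fun n => (PSMD.law (P n) n).real {z | T.quantB S n (1 - τ) z ≤ S.QLR n z})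
            atTop (𝓝 ℓ)) ∧
        (Tendsto (fun n : ℕ => √n * d n / S.sd n) atTop atTop →
          Tendsto
            (fun n => (PSMD.law (P n) n).real {z | T.quantB S n (1 - τ) z ≤ S.QLR n z})
            atTop (𝓝 1))) := by
  obtain ⟨c, C, hsc⟩ := hLQA₀.exists_scaleBounds hBasic hRiesz hDgp₀ hB₀
  have hβ := hAlt.nearNull hBasic hα
  have hq := hLQAB.bootSmall_qlr hBasic hRiesz hPhi hFeas hW hsc hLQA hDgp hDgp₀ hβ hCrit hBω
  have hbd := hLQAB.bootBounded_sq hW hsc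
  have hcdf : ∀ η : ℝ, 0 < η → PSMD.Wpa1 P fun n z => ∀ t, |T.cdfB S n z t -
      PSMD.normalBall 0 √(t * S.nrm (S.u n) ^ 2)| ≤ η := fun η hη => hLQAB.wpa1_cdfB hW hsc hq hη
  have hsq : ∀ (n : ℕ) z w, (√n * T.ZnB S n (α n) z w / (T.sigma * S.nrm (S.u n))) ^ 2 =
      (√n * T.ZnB S n (α n) z w / T.sigma) ^ 2 / S.nrm (S.u n) ^ 2 := fun n z w => by
    rw [← div_div, div_pow _ (S.nrm (S.u n))]
  simp only [hsq]
  refine ⟨hq, hbd.of_sub hq, hbd, PSMD.Bootstrap.bootSmall_iSup_cdf hcdf fun η hη =>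
    hLQA₀.eventually_null_cdf hBasic hRiesz hPhi hFeas hsc hDgp₀ hB₀ hR₀ hη, ?_⟩
  intro hB hR τ hτ0 hτ1
  obtain ⟨r, hr, hrτ⟩ := PSMD.exists_normalBall_eq hτ0 hτ1
  have hquant : ∀ s, 0 < s → s < r → PSMD.Wpa1 P fun n z =>
      (r - s) ^ 2 ≤ T.quantB S n (1 - τ) z * S.nrm (S.u n) ^ 2 ∧
        T.quantB S n (1 - τ) z * S.nrm (S.u n) ^ 2 ≤ (r + s) ^ 2 := fun s hs hsr => by
    rw [← hrτ]
    exact PSMD.Bootstrap.wpa1_quantB (hsc.eventually_nrm_sq.mono fun _ h => h.1) hcdf hs hsr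
  have hdrift := hAlt.eventually_drift hBasic hRiesz hsc hα
  constructor
  · intro hd
    -- The limit exceeds τ because the interval of half-length r is off centre, and is below 1
    -- because r > 0.
    refine ⟨1 - PSMD.normalBall κ r, ?_, ?_, ?_⟩
    · have := PSMD.normalBall_lt_center hAlt.kappa_ne hr
      linarith
    · have := PSMD.normalBall_strictMono κ le_rfl hr
      rw [PSMD.normalBall_zero] at this
      linarith
    · refine hLQA.tendsto_localPower hBasic hRiesz hPhi hFeas hsc hDgp hDgp₀ hβ hB hR ?_ hr hquant
      refine hAlt.dir_phi.congr' ?_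
      filter_upwards [hdrift, hd, hsc.bounds, eventually_gt_atTop 0] with n h1 h2 h3 hn
      have hn' : √(n : ℝ) ≠ 0 := (Real.sqrt_pos.2 (by exact_mod_cast hn)).ne'
      rw [← h1, h2, mul_div_cancel₀ _ hn', div_self h3.1.ne', one_mul]
  · intro hd
    have hk : Tendsto (fun n : ℕ => |√n * S.ip (S.u n) (α n - S.alpha0)|) atTop atTop := by
      have h1 := hd.atTop_mul_pos (abs_pos.2 hAlt.kappa_ne) hAlt.dir_phi.abs
      refine h1.congr' ?_
      filter_upwards [hdrift, hd.eventually_ge_atTop 0] with n h1 h2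
      rw [← h1, abs_mul, abs_of_nonneg h2]
    -- The bound on the critical value is the upper end (r + s)² at s = r/2 divided by the lower
    -- bound c of ‖u_n‖².
    refine hLQA.tendsto_power hBasic hRiesz hPhi hFeas hsc hDgp hDgp₀ hβ hB hR hk
      (D := (r + r / 2) ^ 2 / c) ?_
    refine (hquant (r / 2) (half_pos hr) (half_lt_self hr)).mono ?_
    filter_upwards [hsc.bounds] with n hn z hz
    have hb : 0 < S.nrm (S.u n) ^ 2 := hsc.pos.trans_le hn.2.2.1
    exact ((le_div_iff₀ hb).2 hz.2).trans
      (div_le_div_of_nonneg_left (sq_nonneg _) hsc.pos hn.2.2.1)
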